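/- Theorem 2. Let $d\ge 2$, let $\mathbb X\subset\mathbb R^{d}$ be compact with diameter $r_0$, and consider the system $\dot x_1=x_2,\dots,\dot x_{d-1}=x_d,\ \dot x_d=f(x)+g(x)u$ with state $x\in\mathbb X$ and unknown $f,g:\mathbb X\to\mathbb R$. Prior and data. $f$ and $g$ are independent Gaussian processes on $\mathbb X$ with mean functions $\hat f,\hat g$ and squared exponential covariance functions $k_f,k_g$, where $k_\bullet(x,x')=s_\bullet^2\exp(-\|x-x'\|^2/(2l_\bullet^2))$, $s_f>0$, $s_g\ge0$, $l_f,l_g>0$. Given are inputs $x^{(n)}\in\mathbb X$, $u^{(n)}\in\mathbb R$ and measurements $y^{(n)}=f(x^{(n)})-\hat f(x^{(n)})+(g(x^{(n)})-\hat g(x^{(n)}))u^{(n)}+\omega^{(n)}$, $n=1,\dots,N$, with i.i.d. noise $\omega^{(n)}\sim\mathcal N(0,s_{on}^2)$, $s_{on}>0$, independent of $(f,g)$. Put $U=\mathrm{diag}(u^{(1)},\dots,u^{(N)})$, $(k_f(x))_n=k_f(x^{(n)},x)$, $(k_g(x))_n=k_g(x^{(n)},x)$, $K_{nm}=k_f(x^{(n)},x^{(m)})+u^{(n)}k_g(x^{(n)},x^{(m)})u^{(m)}$,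 $G=K+s_{on}^2I$, and $$\mu_f=\hat f+k_f^TG^{-1}y,\quad \mu_g=\hat g+k_g^TUG^{-1}y,$$ $$\sigma_f^2(x)=k_f(x,x)-k_f(x)^TG^{-1}k_f(x),\quad \sigma_g^2(x)=k_g(x,x)-k_g(x)^TUG^{-1}Uk_g(x).$$ Let $L_f,L_g,L_{\mu_f},L_{\mu_g},L_{\sigma_f^2},L_{\sigma_g^2}$ be Lipschitz constants on $\mathbb X$ of the realized functions $f,g,\mu_f,\mu_g,\sigma_f^2,\sigma_g^2$. For $\delta\in(0,1)$ and $\tau>0$ put $\beta=2d\log(1+r_0/\tau)-2\log\delta$ and $\gamma_\bullet=(L_{\mu_\bullet}+L_\bullet)\tau+\sqrt{\beta L_{\sigma_\bullet^2}\tau}$ for $\bullet\in\{f,g\}$. Controller. Let $x_d:\mathbb R\to\mathbb R$ be $d$ times continuously differentiable with $x_d,\dot x_d,\dots,x_d^{(d)}$ bounded on $[0,\infty)$, let $\mathbf x_d=(x_d,\dots,x_d^{(d-1)})$, $e=x-\mathbf x_d$, and let $\lambda\in\mathbb R^{d-1}$ be Hurwitz (all roots of $s^{d-1}+\lambda_{d-1}s^{d-2}+\dots+\lambda_1$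 have negative real part). With $r=[\lambda^T\ 1]e$ and $\Lambda=[\lambda^T\ 1]^T[\lambda^T\ 1]$ (so $\sqrt{e^T\Lambda e}=|r|$), apply, for a gain $k_c>0$, $$\pi=\mu_g^{-1}(\nu-\mu_f),\qquad \nu=-k_cr-\lambda^Te_{2:d}+x_d^{(d)}.$$ Put $$\alpha(x)=\frac{\sqrt\beta\,\sigma_g(x)+\gamma_g}{|\mu_g(x)|},\qquad \eta(k_c)=\min\Big\{\tfrac{k_c\lambda_2}{k_c\lambda_2+\lambda_1},\dots,\tfrac{k_c\lambda_{d-1}}{k_c\lambda_{d-1}+\lambda_{d-2}},\tfrac{k_c}{k_c+\lambda_{d-1}}\Big\},$$ $\tilde k_c(x)=k_c(1-\alpha(x)/\eta(k_c))$, $c(t,x)=|x_d^{(d)}(t)-\mu_f(x)|$, and $$\varrho(t,x)=\frac{\sqrt\beta\,\sigma_f(x)+\gamma_f+\alpha(x)c(t,x)}{\tilde k_c(x)}.$$ Claim. There is an event whose conditional probability given the training data is almost surely at least $1-2\delta$ and on which the following holds. Suppose that the data are such that $\mu_g\ne0$ on $\mathbb X$ and that $\alpha(x)<\eta(k_0)$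 for all $x\in\mathbb X$, for some $k_0>0$. Then there are a gain $K>0$ and a radius $\varepsilon>0$, determined by the data and the Lipschitz constants but not otherwise by the realized $f,g$, such that for every $k_c\ge K$: 1. $\alpha(x)<\eta(k_c)$ for all $x\in\mathbb X$, hence $\tilde k_c>0$ on $\mathbb X$; 2. for every closed-loop trajectory $x:[0,\infty)\to\mathbb X$: if $x_d^{(d)}$ is uniformly continuous on $[0,\infty)$, then the tracking error reaches the ultimately bounded set for good, that is, $\sqrt{e(t)^T\Lambda e(t)}\le\varrho(t,x(t))$ for all sufficiently large $t$; and, without uniform continuity, for every $b$ with $\varrho(t,x(t))\le b$ for all sufficiently large $t$, also $\sqrt{e(t)^T\Lambda e(t)}\le b$ for all sufficiently large $t$; 3. if for some $\rho>0$ the closed $\rho$-balls around all $\mathbf x_d(t)$, $t\ge0$, lie in $\mathbb X$, then for every $x_0$ with $\|x_0-\mathbf x_d(0)\|<\varepsilon$ there is a closed-loop trajectory $x:[0,\infty)\to\mathbb X$ with $x(0)=x_0$. -/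

import Mathlib

open MeasureTheory ProbabilityTheory Filter Topology
open scoped NNReal ENNReal Matrix ProbabilityTheory

namespace GPTracking

/-- The state space `ℝ^d` with its Euclidean norm. -/
abbrev State (d : ℕ) : Type := EuclideanSpace ℝ (Fin d)

/-- The squared exponential kernel with signal variance `s ^ 2` and length scale `l`. -/
noncomputable def seKernel {d : ℕ} (s l : ℝ) (x x' : State d) : ℝ :=
  s ^ 2 * Real.exp (-(‖x - x'‖ ^ 2 / (2 * l ^ 2)))

/-- Everything the designer fixes before the noisy outputs are measured: prior mean functions,
kernel hyperparameters, noise standard deviation, and the `N` training inputs `(xs n, us n)`. -/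
structure Model (d N : ℕ) where
  fhat : State d → ℝ
  ghat : State d → ℝ
  sf : ℝ
  lf : ℝ
  sg : ℝ
  lg : ℝ
  son : ℝ
  xs : Fin N → State d
  us : Fin N → ℝ

namespace Model

variable {d N : ℕ} (M : Model d N)

/-- The covariance function for `f`. -/
noncomputable def kf : State d → State d → ℝ := seKernel M.sf M.lf

/-- The covariance function for `g`. -/
noncomputable def kg : State d → State d → ℝ := seKernel M.sg M.lg

/-- The composite kernel `k((x,u),(x',u')) = k_f(x,x') + u k_g(x,x') u'`. -/
noncomputable def k (z z' : State d × ℝ) : ℝ := M.kf z.1 z'.1 + z.2 * M.kg z.1 z'.1 * z'.2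

/-- The matrix `K + s_on² I`. -/
noncomputable def gram : Matrix (Fin N) (Fin N) ℝ :=
  Matrix.of (fun i j => M.k (M.xs i, M.us i) (M.xs j, M.us j)) + M.son ^ 2 • 1

/-- The vector `k_f(x)`. -/
noncomputable def kfVec (x : State d) : Fin N → ℝ := fun i => M.kf (M.xs i) x

/-- The vector `U k_g(x)`. -/
noncomputable def ukgVec (x : State d) : Fin N → ℝ := fun i => M.us i * M.kg (M.xs i) x

/-- Posterior mean component for `f`, given the target vector `y`. -/
noncomputable def muf (y : Fin N → ℝ) (x : State d) : ℝ :=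
  M.fhat x + M.kfVec x ⬝ᵥ (M.gram⁻¹ *ᵥ y)

/-- Posterior mean component for `g`, given the target vector `y`. -/
noncomputable def mug (y : Fin N → ℝ) (x : State d) : ℝ :=
  M.ghat x + M.ukgVec x ⬝ᵥ (M.gram⁻¹ *ᵥ y)

/-- Posterior variance component for `f`. -/
noncomputable def varf (x : State d) : ℝ :=
  M.kf x x - M.kfVec x ⬝ᵥ (M.gram⁻¹ *ᵥ M.kfVec x)

/-- Posterior variance component for `g`. -/
noncomputable def varg (x : State d) : ℝ :=
  M.kg x x - M.ukgVec x ⬝ᵥ (M.gram⁻¹ *ᵥ M.ukgVec x)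

/-- Posterior standard deviation component for `f`. -/
noncomputable def sigf (x : State d) : ℝ := √(M.varf x)

/-- Posterior standard deviation component for `g`. -/
noncomputable def sigg (x : State d) : ℝ := √(M.varg x)

/-- The targets `y⁽ⁿ⁾ = Δ(x⁽ⁿ⁾, u⁽ⁿ⁾) + ω⁽ⁿ⁾` with
`Δ(x, u) = f(x) - fhat(x) + (g(x) - ghat(x)) u`, as a random vector. -/
def targets {Ω : Type*} (f g : Ω → State d → ℝ) (noise : Ω → Fin N → ℝ) (ω : Ω) : Fin N → ℝ :=
  fun n => f ω (M.xs n) - M.fhat (M.xs n) + (g ω (M.xs n) - M.ghat (M.xs n)) * M.us n + noise ω n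

end Model

/-- The random function `h` is, on `X`, a Gaussian process with mean function `m` and covariance
function `k`. -/
structure IsGPOn {d : ℕ} {Ω : Type*} [MeasurableSpace Ω] (h : Ω → State d → ℝ) (X : Set (State d))
    (m : State d → ℝ) (k : State d → State d → ℝ) (P : Measure Ω) : Prop where
  measurable : ∀ x ∈ X, Measurable fun ω => h ω x
  gaussian : IsGaussianProcess (fun (x : X) ω => h ω x) P
  mean : ∀ x ∈ X, ∫ ω, h ω x ∂P = m x
  cov : ∀ x ∈ X, ∀ x' ∈ X, cov[fun ω => h ω x, fun ω => h ω x'; P] = k x x'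

/-- The probabilistic assumptions: the training states lie in `X`, `f` and `g` are drawn from
independent Gaussian process priors on `X`, and the measurement noise is i.i.d. centred Gaussian
with variance `son ^ 2` and independent of `(f, g)`. -/
structure GPData {d N : ℕ} {Ω : Type*} [MeasurableSpace Ω] (M : Model d N) (X : Set (State d))
    (f g : Ω → State d → ℝ) (noise : Ω → Fin N → ℝ) (P : Measure Ω) : Prop where
  xs_mem : ∀ n, M.xs n ∈ X
  prior_f : IsGPOn f X M.fhat M.kf P
  prior_g : IsGPOn g X M.ghat M.kg P
  indep_fg : IndepFun (fun ω (x : X) => f ω x) (fun ω (x : X) => g ω x) P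
  noise_measurable : Measurable noise
  noise_law : ∀ n, P.map (fun ω => noise ω n) = gaussianReal 0 (M.son ^ 2).toNNReal
  noise_indep : iIndepFun (fun n ω => noise ω n) P
  noise_indep_fg :
    IndepFun (fun ω => ((fun x : X => f ω x), (fun x : X => g ω x))) noise P

/-- A choice of Lipschitz constants for `f`, `g`, the posterior mean components, and the posterior
variance components. -/
structure LipConsts where
  f : ℝ≥0
  g : ℝ≥0
  muf : ℝ≥0
  mug : ℝ≥0
  varf : ℝ≥0
  varg : ℝ≥0

/-- The constants are valid on `X` for the posterior mean and variance components. -/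
structure LipConsts.ValidPosterior {d N : ℕ} (L : LipConsts) (M : Model d N) (X : Set (State d))
    (y : Fin N → ℝ) : Prop where
  muf : LipschitzOnWith L.muf (M.muf y) X
  mug : LipschitzOnWith L.mug (M.mug y) X
  varf : LipschitzOnWith L.varf M.varf X
  varg : LipschitzOnWith L.varg M.varg X

/-- `β(τ) = 2 d log(1 + r₀ / τ) - 2 log δ`, where `r₀` is the diameter of `X`. -/
noncomputable def beta {d : ℕ} (X : Set (State d)) (δ τ : ℝ) : ℝ :=
  2 * d * Real.log (1 + Metric.diam X / τ) - 2 * Real.log δ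

/-- `γ_f(τ)`. -/
noncomputable def gammaf {d : ℕ} (X : Set (State d)) (δ τ : ℝ) (L : LipConsts) : ℝ :=
  (L.muf + L.f) * τ + √(beta X δ τ * L.varf * τ)

/-- `γ_g(τ)`. -/
noncomputable def gammag {d : ℕ} (X : Set (State d)) (δ τ : ℝ) (L : LipConsts) : ℝ :=
  (L.mug + L.g) * τ + √(beta X δ τ * L.varg * τ)

/-- `α(x)`, the bound on the error of the model of `g` relative to the size of that model. -/
noncomputable def alpha {d N : ℕ} (M : Model d N) (X : Set (State d)) (δ τ : ℝ)
    (y : Fin N → ℝ) (L : LipConsts) (x : State d) : ℝ :=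
  (√(beta X δ τ) * M.sigg x + gammag X δ τ L) / |M.mug y x|

/-! The state dimension is `d = n + 1`, and `lam i` (`i : Fin n`) are the filter coefficients
`λ_1, …, λ_{d-1}`. -/

/-- `lam` is Hurwitz: all complex roots of `s^n + λ_n s^(n-1) + ⋯ + λ_2 s + λ_1` have negative
real part. -/
def IsHurwitz {n : ℕ} (lam : Fin n → ℝ) : Prop :=
  ∀ s : ℂ, s ^ n + ∑ i : Fin n, (lam i : ℂ) * s ^ (i : ℕ) = 0 → s.re < 0

/-- The vector `[λᵀ 1]ᵀ`. -/
def lamExt {n : ℕ} (lam : Fin n → ℝ) : Fin (n + 1) → ℝ := Fin.snoc lam 1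

/-- The matrix `Λ = [λᵀ 1]ᵀ [λᵀ 1]`. -/
def Lam {n : ℕ} (lam : Fin n → ℝ) : Matrix (Fin (n + 1)) (Fin (n + 1)) ℝ :=
  Matrix.vecMulVec (lamExt lam) (lamExt lam)

/-- The filtered state `r = [λᵀ 1] e`. -/
def filtered {n : ℕ} (lam : Fin n → ℝ) (e : State (n + 1)) : ℝ := lamExt lam ⬝ᵥ e.ofLp

/-- The size `√(eᵀ Λ e)` of the tracking error. -/
noncomputable def errSize {n : ℕ} (lam : Fin n → ℝ) (e : State (n + 1)) : ℝ :=
  √(e.ofLp ⬝ᵥ (Lam lam *ᵥ e.ofLp))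

/-- `η`: the minimum of `k_c λ_{i+1} / (k_c λ_{i+1} + λ_i)` over `i = 1, …, d - 1`, where
`λ_d = 1`. -/
noncomputable def eta {n : ℕ} (lam : Fin n → ℝ) (kc : ℝ) : ℝ :=
  ⨅ i : Fin n, kc * lamExt lam i.succ / (kc * lamExt lam i.succ + lamExt lam i.castSucc)

/-- The reference state `[x_d, ẋ_d, …, x_d^(d-1)]` at time `t`. -/
noncomputable def refState {n : ℕ} (xd : ℝ → ℝ) (t : ℝ) : State (n + 1) :=
  WithLp.toLp 2 fun i => iteratedDeriv (i : ℕ) xd t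

/-- The input `ν = -k_c r - λᵀ e_{2:d} + x_d^(d)` to the linearized system. -/
noncomputable def nu {n : ℕ} (lam : Fin n → ℝ) (kc : ℝ) (xd : ℝ → ℝ) (t : ℝ)
    (x : State (n + 1)) : ℝ :=
  -kc * filtered lam (x - refState xd t)
    - ∑ i : Fin n, lam i * (x - refState xd t).ofLp i.succ
    + iteratedDeriv (n + 1) xd t

/-- The control law `π = μ_g⁻¹ (ν - μ_f)`. -/
noncomputable def control {n N : ℕ} (M : Model (n + 1) N) (y : Fin N → ℝ) (lam : Fin n → ℝ)
    (kc : ℝ) (xd : ℝ → ℝ) (t : ℝ) (x : State (n + 1)) : ℝ :=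
  (M.mug y x)⁻¹ * (nu lam kc xd t x - M.muf y x)

/-- `x` is a trajectory on `[0, ∞)`, with values in `X`, of the canonical-form system
`ẋ_1 = x_2, …, ẋ_d = f(x) + g(x) u` under the time-varying state feedback `u = π(t, x)`. -/
structure IsTrajectory {n : ℕ} (X : Set (State (n + 1))) (f g : State (n + 1) → ℝ)
    (π : ℝ → State (n + 1) → ℝ) (x : ℝ → State (n + 1)) : Prop where
  mem : ∀ t, 0 ≤ t → x t ∈ X
  chain : ∀ t, 0 ≤ t → ∀ i : Fin n,
    HasDerivWithinAt (fun s => x s i.castSucc) (x t i.succ) (Set.Ici 0) t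
  last : ∀ t, 0 ≤ t →
    HasDerivWithinAt (fun s => x s (Fin.last n)) (f (x t) + g (x t) * π t (x t)) (Set.Ici 0) t

/-- The effective gain `k_c (1 - α(x) / η)`. -/
noncomputable def effGain {n N : ℕ} (M : Model (n + 1) N) (X : Set (State (n + 1))) (δ τ : ℝ)
    (y : Fin N → ℝ) (L : LipConsts) (lam : Fin n → ℝ) (kc : ℝ) (x : State (n + 1)) : ℝ :=
  kc * (1 - alpha M X δ τ y L x / eta lam kc)

/-- `c = |x_d^(d)(t) - μ_f(x)|`. -/
noncomputable def feedforward {n N : ℕ} (M : Model (n + 1) N) (y : Fin N → ℝ) (xd : ℝ → ℝ) (t : ℝ)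
    (x : State (n + 1)) : ℝ :=
  |iteratedDeriv (n + 1) xd t - M.muf y x|

/-- The error bound `(√β σ_f + γ_f + α c) / k̃_c` at time `t` and state `x`. -/
noncomputable def errBound {n N : ℕ} (M : Model (n + 1) N) (X : Set (State (n + 1))) (δ τ : ℝ)
    (y : Fin N → ℝ) (L : LipConsts) (lam : Fin n → ℝ) (kc : ℝ) (xd : ℝ → ℝ) (t : ℝ)
    (x : State (n + 1)) : ℝ :=
  (√(beta X δ τ) * M.sigf x + gammaf X δ τ L
    + alpha M X δ τ y L x * feedforward M y xd t x) / effGain M X δ τ y L lam kc x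

/-- The ultimately bounded set of tracking errors at time `t`; the state that belongs to the
error `e` is `x = x_d(t) + e`. -/
noncomputable def ultimateSet {n N : ℕ} (M : Model (n + 1) N) (X : Set (State (n + 1)))
    (δ τ : ℝ) (y : Fin N → ℝ) (L : LipConsts) (lam : Fin n → ℝ) (kc : ℝ) (xd : ℝ → ℝ) (t : ℝ) :
    Set (State (n + 1)) :=
  {e | errSize lam e ≤ errBound M X δ τ y L lam kc xd t (refState xd t + e)}

end GPTracking

open GPTracking

/-! The proof separates a probabilistic part, which yields confidence bounds with slack, from a
deterministic part, which spends the slack.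

Probability. A bounded set has a `τ`-net of at most `(1 + diam X / τ) ^ d` points. This sharp count
comes from the isodiametric inequality `volume_le_of_sum_sq_sub_le`, proved by Steiner
symmetrization. At the net points the residuals of the posterior means are Gaussian, have the
posterior variances, and are independent of the targets (`indepFun_residual`); so an event about
residuals has constant conditional probability, and a union bound gives `1 - 2δ`. Lipschitz
continuity carries the bounds to all of `X`. The two-sided Gaussian tail is strictly below its
Chernoff bound, so `√β` may be lowered to `κ * √β` with `κ < 1` at no cost in probability
(`exists_lt_one_gaussianReal_abs_gt_le`). Since the posterior variance of `f` is positive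
(`GPData.varf_pos`), compactness leaves a uniform margin `s > 0` in the bound on the error of `f`.

Dynamics. The filtered error satisfies `r' = -kc r + w`, and `|w|` is at most `Φ - s + α (kc |r| +
|lead| + c)`, where `lead = λᵀ e_{2:d}` is absent from the claimed bound. Because `α` stays below a
constant less than 1, `|r|` falls to order `1 / kc` in finite time. Stability of the Hurwitz filter
(`IsHurwitz.exists_bound`) then makes the whole error of order `1 / kc`, so for large `kc` half of
the margin absorbs `lead` (`LoopBounds.exists_eventually`). The other half forces strict decrease of
`|r|` whenever `kc |r|` exceeds `(Φ + α c) / (1 - α)`. A constant ultimate bound is thus reached in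
finite time. For the time-varying bound, the level is frozen over a short window whose length does
not depend on the gain; this is where uniform continuity of `x_d^(d)` enters. The claimed bound is
weaker than the one obtained, since `η < 1`.

Existence of trajectories: the closed-loop field is extended off `X` to a bounded Lipschitz one, and
the same estimates show that a solution with small initial error never leaves the tube around the
reference. -/

namespace GPTracking

/-! ### Steiner symmetrization and the isodiametric inequality -/

section Isodiametric

open Set

/-- Two nonempty sets of reals whose points are mutually within `m` have total length at most
`2 m`. -/
lemma volume_add_volume_le_of_abs_sub_le {S T : Set ℝ} (hS : S.Nonempty) (hT : T.Nonempty) {m : ℝ}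
    (h : ∀ s ∈ S, ∀ t ∈ T, |s - t| ≤ m) : volume S + volume T ≤ ENNReal.ofReal (2 * m) := by
  obtain ⟨s₀, hs₀⟩ := hS
  obtain ⟨t₀, ht₀⟩ := hT
  have bS : BddAbove S := ⟨t₀ + m, fun s hs => by linarith [(abs_le.1 (h s hs t₀ ht₀)).2]⟩
  have bS' : BddBelow S := ⟨t₀ - m, fun s hs => by linarith [(abs_le.1 (h s hs t₀ ht₀)).1]⟩
  have bT : BddAbove T := ⟨s₀ + m, fun t ht => by linarith [(abs_le.1 (h s₀ hs₀ t ht)).1]⟩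
  have bT' : BddBelow T := ⟨s₀ - m, fun t ht => by linarith [(abs_le.1 (h s₀ hs₀ t ht)).2]⟩
  have key : ∀ U : Set ℝ, BddAbove U → BddBelow U →
      volume U ≤ ENNReal.ofReal (sSup U - sInf U) := fun U h1 h2 => by
    rw [← Real.volume_Icc]
    exact measure_mono fun u hu => ⟨csInf_le h2 hu, le_csSup h1 hu⟩
  have h1 : sSup S - sInf T ≤ m := by
    have : sSup S ≤ sInf T + m := csSup_le ⟨s₀, hs₀⟩ fun s hs => by
      have : s - m ≤ sInf T := le_csInf ⟨t₀, ht₀⟩ fun t ht => by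
        linarith [(abs_le.1 (h s hs t ht)).2]
      linarith
    linarith
  have h2 : sSup T - sInf S ≤ m := by
    have : sSup T ≤ sInf S + m := csSup_le ⟨t₀, ht₀⟩ fun t ht => by
      have : t - m ≤ sInf S := le_csInf ⟨s₀, hs₀⟩ fun s hs => by
        linarith [(abs_le.1 (h s hs t ht)).1]
      linarith
    linarith
  calc volume S + volume T
      ≤ ENNReal.ofReal (sSup S - sInf S) + ENNReal.ofReal (sSup T - sInf T) :=
        add_le_add (key S bS bS') (key T bT bT')
    _ = ENNReal.ofReal ((sSup S - sInf S) + (sSup T - sInf T)) := by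
        rw [ENNReal.ofReal_add]
        · linarith [csInf_le bS' hs₀, le_csSup bS hs₀]
        · linarith [csInf_le bT' ht₀, le_csSup bT ht₀]
    _ ≤ _ := ENNReal.ofReal_le_ofReal (by linarith)

variable {ι : Type*} [DecidableEq ι]

/-- The slice of `A` through `x` in the direction of the coordinate `i`. -/
def coordSlice (A : Set (ι → ℝ)) (i : ι) (x : ι → ℝ) : Set ℝ := {t | Function.update x i t ∈ A}

/-- The Steiner symmetrization of `A` with respect to the hyperplane `x i = 0`. -/
def steiner (A : Set (ι → ℝ)) (i : ι) : Set (ι → ℝ) :=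
  {x | ENNReal.ofReal (2 * |x i|) < volume (coordSlice A i x)}

lemma coordSlice_update (A : Set (ι → ℝ)) (i : ι) (x : ι → ℝ) (t : ℝ) :
    coordSlice A i (Function.update x i t) = coordSlice A i x := by
  simp [coordSlice]

/-- Invariance of a set under the reflection in a coordinate. -/
def ReflInvariant (A : Set (ι → ℝ)) (j : ι) : Prop :=
  ∀ x ∈ A, Function.update x j (-x j) ∈ A

lemma reflInvariant_steiner_self (A : Set (ι → ℝ)) (i : ι) : ReflInvariant (steiner A i) i := by
  intro x hx
  simpa [steiner, coordSlice_update] using hx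

/-- For `j ≠ i`, reflecting in `j` maps the slice of `A` through `x` into the slice through the
reflected point, so slice lengths do not drop. Hence symmetrizing successive coordinates does not
destroy the symmetries already gained. -/
lemma ReflInvariant.steiner {A : Set (ι → ℝ)} {i j : ι} (h : ReflInvariant A j) :
    ReflInvariant (steiner A i) j := by
  by_cases hij : j = i
  · subst hij; exact reflInvariant_steiner_self A j
  intro x hx
  have : coordSlice A i x ⊆ coordSlice A i (Function.update x j (-x j)) := by
    intro t ht
    have := h _ ht
    rw [coordSlice, mem_ofPred_eq, Function.update_comm hij]
    simpa [Function.update_of_ne hij] using this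
  simp only [GPTracking.steiner, mem_ofPred_eq, Function.update_of_ne (Ne.symm hij)] at hx ⊢
  exact hx.trans_le (measure_mono this)

lemma measurable_volume_coordSlice {A : Set (ι → ℝ)} (hA : MeasurableSet A) (i : ι) :
    Measurable fun x => volume (coordSlice A i x) := by
  have h := Measurable.lmarginal (s := {i}) (fun _ : ι => (volume : Measure ℝ))
    (measurable_one.indicator hA : Measurable (A.indicator (1 : (ι → ℝ) → ℝ≥0∞)))
  rw [lmarginal_singleton] at h
  convert h using 2 with x
  rw [← lintegral_indicator_one]
  · rfl
  · exact hA.preimage (measurable_update x)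

lemma measurableSet_coordSlice {A : Set (ι → ℝ)} (hA : MeasurableSet A) (i : ι) (x : ι → ℝ) :
    MeasurableSet (coordSlice A i x) := hA.preimage (measurable_update x)

lemma measurableSet_steiner {A : Set (ι → ℝ)} (hA : MeasurableSet A) (i : ι) :
    MeasurableSet (steiner A i) :=
  measurableSet_lt (by fun_prop) (measurable_volume_coordSlice hA i)

lemma volume_ofReal_two_mul_abs_lt (ℓ : ℝ≥0∞) :
    volume {t : ℝ | ENNReal.ofReal (2 * |t|) < ℓ} = ℓ := by
  by_cases h : ℓ = ∞
  · simp [h, ENNReal.mul_lt_top_iff]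
  have : {t : ℝ | ENNReal.ofReal (2 * |t|) < ℓ} = Ioo (-(ℓ.toReal / 2)) (ℓ.toReal / 2) := by
    ext t
    rw [mem_ofPred_eq, ENNReal.ofReal_lt_iff_lt_toReal (by positivity) h, Set.mem_Ioo, ← abs_lt]
    constructor <;> intro h <;> linarith
  rw [this, Real.volume_Ioo]
  simp [h]

variable [Fintype ι]

/-- Fubini: each slice in direction `i` is replaced by a centred open interval of the same length,
so the marginals over `{i}` coincide. -/
lemma volume_steiner {A : Set (ι → ℝ)} (hA : MeasurableSet A) (i : ι) :
    volume (steiner A i) = volume A := by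
  have hB := measurableSet_steiner hA i
  rw [← lintegral_indicator_one hA, ← lintegral_indicator_one hB]
  refine lintegral_eq_of_lmarginal_eq (μ := fun _ : ι => (volume : Measure ℝ)) {i}
    (measurable_one.indicator hB) (measurable_one.indicator hA) ?_
  simp only [lmarginal_singleton]
  ext x
  have e : ∀ C : Set (ι → ℝ), MeasurableSet C →
      ∫⁻ t, C.indicator (1 : (ι → ℝ) → ℝ≥0∞) (Function.update x i t) =
        volume (coordSlice C i x) := fun C hC => by
    rw [← lintegral_indicator_one (measurableSet_coordSlice hC i x)]
    rfl
  rw [e _ hB, e _ hA]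
  have : coordSlice (steiner A i) i x =
      {t | ENNReal.ofReal (2 * |t|) < volume (coordSlice A i x)} := by
    ext t
    simp [coordSlice, steiner]
  rw [this, volume_ofReal_two_mul_abs_lt]

/-- Let `c` be the contribution of the coordinates other than `i`. Points of the two slices of `A`
are within `√(D - c)` of each other, so the slices have total length at most `2 √(D - c)`.
Membership in the symmetrization says that these lengths exceed `2 |x i|` and `2 |y i|`, hence `|x
i| + |y i| ≤ √(D - c)`. -/
lemma sum_sq_sub_le_of_steiner {A : Set (ι → ℝ)} {D : ℝ}
    (hD : ∀ x ∈ A, ∀ y ∈ A, ∑ j, (x j - y j) ^ 2 ≤ D) (i : ι) :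
    ∀ x ∈ steiner A i, ∀ y ∈ steiner A i, ∑ j, (x j - y j) ^ 2 ≤ D := by
  intro x hx y hy
  set c := ∑ j ∈ Finset.univ.erase i, (x j - y j) ^ 2 with hc
  have hne : ∀ z ∈ steiner A i, (coordSlice A i z).Nonempty := fun z hz => by
    by_contra h
    rw [not_nonempty_iff_eq_empty] at h
    simp [steiner, h] at hz
  have key : ∀ s ∈ coordSlice A i x, ∀ t ∈ coordSlice A i y, |s - t| ≤ √(D - c) := by
    intro s hs t ht
    have := hD _ hs _ ht
    rw [← Finset.add_sum_erase _ _ (Finset.mem_univ i)] at this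
    have e : ∑ j ∈ Finset.univ.erase i,
        (Function.update x i s j - Function.update y i t j) ^ 2 = c := by
      refine Finset.sum_congr rfl fun j hj => ?_
      rw [Function.update_of_ne (Finset.ne_of_mem_erase hj),
        Function.update_of_ne (Finset.ne_of_mem_erase hj)]
    rw [e] at this
    simp only [Function.update_self] at this
    exact Real.abs_le_sqrt (by linarith)
  have h0 : 0 ≤ D - c := by
    obtain ⟨s, hs⟩ := hne x hx
    obtain ⟨t, ht⟩ := hne y hy
    have := hD _ hs _ ht
    rw [← Finset.add_sum_erase _ _ (Finset.mem_univ i)] at this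
    have e : ∑ j ∈ Finset.univ.erase i,
        (Function.update x i s j - Function.update y i t j) ^ 2 = c := by
      refine Finset.sum_congr rfl fun j hj => ?_
      rw [Function.update_of_ne (Finset.ne_of_mem_erase hj),
        Function.update_of_ne (Finset.ne_of_mem_erase hj)]
    rw [e] at this
    nlinarith [sq_nonneg (Function.update x i s i - Function.update y i t i)]
  have h1 := volume_add_volume_le_of_abs_sub_le (hne x hx) (hne y hy) key
  have h2 : ENNReal.ofReal (2 * |x i| + 2 * |y i|) ≤ ENNReal.ofReal (2 * √(D - c)) := by
    rw [ENNReal.ofReal_add (by positivity) (by positivity)]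
    exact (add_le_add (le_of_lt hx) (le_of_lt hy)).trans h1
  have h3 : |x i - y i| ≤ √(D - c) := by
    have := (ENNReal.ofReal_le_ofReal_iff (by positivity)).1 h2
    have := abs_sub (x i) (y i)
    linarith
  have h4 : (x i - y i) ^ 2 ≤ D - c := by
    rw [← Real.sq_sqrt h0, ← sq_abs]
    gcongr
  rw [← Finset.add_sum_erase _ _ (Finset.mem_univ i)]
  linarith

/-- The isodiametric inequality. -/
lemma volume_le_of_sum_sq_sub_le {A : Set (ι → ℝ)} (hA : MeasurableSet A) {D : ℝ}
    (hD : ∀ x ∈ A, ∀ y ∈ A, ∑ j, (x j - y j) ^ 2 ≤ D) :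
    volume A ≤ volume {x : ι → ℝ | ∑ j, (2 * x j) ^ 2 ≤ D} := by
  have key : ∀ s : Finset ι, ∃ B : Set (ι → ℝ), MeasurableSet B ∧ volume B = volume A ∧
      (∀ x ∈ B, ∀ y ∈ B, ∑ j, (x j - y j) ^ 2 ≤ D) ∧ ∀ j ∈ s, ReflInvariant B j := by
    intro s
    induction s using Finset.induction_on with
    | empty => exact ⟨A, hA, rfl, hD, by simp⟩
    | insert i s _ ih =>
      obtain ⟨B, hB, hv, hd, hr⟩ := ih
      refine ⟨steiner B i, measurableSet_steiner hB i, (volume_steiner hB i).trans hv,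
        sum_sq_sub_le_of_steiner hd i, fun j hj => ?_⟩
      rcases Finset.mem_insert.1 hj with rfl | hj
      · exact reflInvariant_steiner_self B j
      · exact (hr j hj).steiner
  obtain ⟨B, _, hv, hd, hr⟩ := key Finset.univ
  rw [← hv]
  refine measure_mono fun x hx => ?_
  -- Reflecting in one coordinate after another puts `-x` into `B`, so `D` bounds the squared length
  -- of `x - (-x) = 2 x`.
  have hneg : ∀ s : Finset ι, (fun j => if j ∈ s then -x j else x j) ∈ B := by
    intro s
    induction s using Finset.induction_on with
    | empty => simpa using hx
    | insert i s hi ih =>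
      convert hr i (Finset.mem_univ i) _ ih using 1
      ext j
      by_cases hj : j = i
      · subst hj; simp [hi]
      · simp [hj]
  have h := hd _ hx _ (hneg Finset.univ)
  simpa [two_mul] using h

end Isodiametric

/-! ### Packing and covering numbers -/

section Packing

variable {d : ℕ}

/-- The isodiametric inequality for the Euclidean norm. -/
lemma volume_le_volume_closedBall {A : Set (State d)} (hA : MeasurableSet A) {D : ℝ}
    (hD0 : 0 ≤ D) (hD : ∀ x ∈ A, ∀ y ∈ A, dist x y ≤ D) :
    volume A ≤ volume (Metric.closedBall (0 : State d) (D / 2)) := by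
  have mp := (EuclideanSpace.volume_preserving_symm_measurableEquiv_toLp (Fin d))
  have mp' := (EuclideanSpace.volume_preserving_symm_measurableEquiv_toLp (Fin d)).symm
  have e : ∀ C : Set (State d),
      volume ((MeasurableEquiv.toLp 2 (Fin d → ℝ)) ⁻¹' C) = volume C := fun C =>
    mp'.measure_preimage_equiv C
  rw [← e A, ← e (Metric.closedBall _ _)]
  refine (volume_le_of_sum_sq_sub_le (D := D ^ 2)
    ((MeasurableEquiv.toLp 2 (Fin d → ℝ)).measurable hA) ?_).trans (measure_mono ?_)
  · intro x hx y hy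
    have := hD _ hx _ hy
    rw [EuclideanSpace.dist_eq, Real.sqrt_le_left hD0] at this
    simpa [Real.dist_eq] using this
  · intro x hx
    rw [Set.mem_preimage, mem_closedBall_zero_iff, EuclideanSpace.norm_eq]
    refine Real.sqrt_le_iff.2 ⟨by positivity, ?_⟩
    simp only [Set.mem_ofPred_eq, mul_pow, ← Finset.mul_sum] at hx
    simp only [MeasurableEquiv.toLp_apply, Real.norm_eq_abs, sq_abs]
    linarith

/-- A `τ`-separated subset of a bounded set `X` has at most `(1 + diam X / τ) ^ d` points. -/
lemma card_le_of_separated {X : Set (State d)} (hX : Bornology.IsBounded X) {τ : ℝ} (hτ : 0 < τ)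
    {S : Finset (State d)} (hS : ↑S ⊆ X) (hsep : ∀ x ∈ S, ∀ y ∈ S, x ≠ y → τ ≤ dist x y) :
    (S.card : ℝ) ≤ (1 + Metric.diam X / τ) ^ d := by
  set A : Set (State d) := ⋃ x ∈ S, Metric.ball x (τ / 2) with hAdef
  have hdiam : 0 ≤ Metric.diam X := Metric.diam_nonneg
  have hvol : volume A = S.card * volume (Metric.ball (0 : State d) (τ / 2)) := by
    rw [hAdef, measure_biUnion_finset _ fun _ _ => Metric.isOpen_ball.measurableSet]
    · simp [Measure.addHaar_ball_center]
    · intro x hx y hy hxy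
      exact Metric.ball_disjoint_ball (by linarith [hsep x hx y hy hxy])
  -- The union of the disjoint balls has diameter at most `diam X + τ`. The isodiametric inequality
  -- then allows comparison with a ball of half that radius; enclosing the union in a ball around
  -- one of its centres would only give `(1 + 2 diam X / τ) ^ d`.
  have hle : volume A ≤ volume (Metric.closedBall (0 : State d) ((Metric.diam X + τ) / 2)) := by
    refine volume_le_volume_closedBall (.biUnion S.countable_toSet
      fun _ _ => Metric.isOpen_ball.measurableSet) (by positivity) ?_
    intro x hx y hy
    simp only [Set.mem_iUnion, Metric.mem_ball, exists_prop] at hx hy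
    obtain ⟨p, hp, hxp⟩ := hx
    obtain ⟨q, hq, hyq⟩ := hy
    have h1 := Metric.dist_le_diam_of_mem hX (hS hp) (hS hq)
    have h2 := dist_triangle4 x p q y
    rw [dist_comm y q] at hyq
    linarith
  rw [hvol, Measure.addHaar_ball_of_pos _ _ (by positivity),
    Measure.addHaar_closedBall _ _ (by positivity), ← mul_assoc,
    ENNReal.mul_le_mul_iff_left (Metric.measure_ball_pos _ _ one_pos).ne'
      measure_ball_lt_top.ne] at hle
  rw [← ENNReal.ofReal_natCast, ← ENNReal.ofReal_mul (by positivity),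
    ENNReal.ofReal_le_ofReal_iff (by positivity), finrank_euclideanSpace_fin] at hle
  have e : 1 + Metric.diam X / τ = ((Metric.diam X + τ) / 2) / (τ / 2) := by
    field_simp; ring
  rw [e, div_pow, le_div_iff₀ (by positivity)]
  exact hle

/-- A bounded set `X` is covered by at most `(1 + diam X / τ) ^ d` balls of radius `τ` centred
in `X`. -/
lemma exists_finset_cover {X : Set (State d)} (hX : Bornology.IsBounded X) {τ : ℝ} (hτ : 0 < τ) :
    ∃ S : Finset (State d), ↑S ⊆ X ∧ (S.card : ℝ) ≤ (1 + Metric.diam X / τ) ^ d ∧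
      ∀ x ∈ X, ∃ p ∈ S, dist x p ≤ τ := by
  classical
  -- Cardinalities of `τ`-separated subsets are bounded, so a largest one exists; a point farther
  -- than `τ` from all of it could be added.
  let Q : ℕ → Prop := fun k => ∃ S : Finset (State d), ↑S ⊆ X ∧
    (∀ x ∈ S, ∀ y ∈ S, x ≠ y → τ ≤ dist x y) ∧ S.card = k
  have hQ : ∀ k, Q k → k ≤ ⌊(1 + Metric.diam X / τ) ^ d⌋₊ := by
    rintro k ⟨S, h1, h2, rfl⟩
    exact Nat.le_floor (card_le_of_separated hX hτ h1 h2)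
  have hQ0 : Q 0 := ⟨∅, by simp⟩
  obtain ⟨S, h1, h2, h3⟩ := Nat.findGreatest_spec (P := Q) (hQ 0 hQ0) hQ0
  refine ⟨S, h1, card_le_of_separated hX hτ h1 h2, fun x hx => ?_⟩
  by_contra! hcon
  have hxS : x ∉ S := fun h => by simpa [hτ.not_gt] using hcon x h
  have : Q (S.card + 1) := by
    refine ⟨insert x S, ?_, ?_, Finset.card_insert_of_notMem hxS⟩
    · simpa [Set.insert_subset_iff] using ⟨hx, h1⟩
    · intro a ha b hb hab
      rw [Finset.mem_insert] at ha hb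
      rcases ha with ha | ha <;> rcases hb with hb | hb
      · exact absurd (ha.trans hb.symm) hab
      · subst ha; exact (hcon b hb).le
      · subst hb; rw [dist_comm]; exact (hcon a ha).le
      · exact h2 a ha b hb hab
  have := Nat.le_findGreatest (hQ _ this) this
  omega

end Packing

/-! ### Strictness of the Chernoff bound -/

section GaussianTail

open Set

lemma gaussianReal_Iio_neg (v : ℝ≥0) (a : ℝ) :
    gaussianReal 0 v (Iio (-a)) = gaussianReal 0 v (Ioi a) := by
  have h := gaussianReal_map_neg (μ := 0) (v := v)
  rw [neg_zero] at h
  conv_lhs => rw [← h]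
  rw [Measure.map_apply (by fun_prop) measurableSet_Iio]
  congr 1
  ext x
  simp

lemma gaussianReal_abs_gt {v : ℝ≥0} {a : ℝ} (ha : 0 ≤ a) :
    gaussianReal 0 v {x | a < |x|} = 2 * gaussianReal 0 v (Ioi a) := by
  have : {x : ℝ | a < |x|} = Iio (-a) ∪ Ioi a := by
    ext x
    simp only [mem_ofPred_eq, lt_abs, mem_union, mem_Iio, mem_Ioi]
    constructor <;> rintro (h | h)
    · exact Or.inr h
    · exact Or.inl (by linarith)
    · exact Or.inr (by linarith)
    · exact Or.inl h
  rw [this, measure_union _ measurableSet_Ioi, gaussianReal_Iio_neg, two_mul]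
  exact Set.disjoint_left.2 fun x hx hx' => by
    simp only [mem_Iio, mem_Ioi] at hx hx'
    linarith

/-- Shift by `a`: the density at `u + a` is `exp (-a² / 2) * exp (-a u)` times the density at `u`.
Replacing `a` by a smaller `b` in the second factor makes the integral independent of the threshold,
which is what a continuity argument in the threshold needs. -/
lemma gaussianReal_Ioi_le (a b : ℝ) (hb : b ≤ a) :
    gaussianReal 0 1 (Ioi a) ≤ ENNReal.ofReal (Real.exp (-(a ^ 2 / 2))) *
      ∫⁻ u in Ioi 0, ENNReal.ofReal (Real.exp (-(b * u))) * gaussianPDF 0 1 u := by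
  rw [gaussianReal_apply _ one_ne_zero]
  have h := (measurePreserving_add_right volume a).setLIntegral_comp_preimage
    (measurableSet_Ioi (a := a)) (measurable_gaussianPDF 0 1)
  rw [← h, ← lintegral_const_mul _ (by fun_prop)]
  have e : (fun x => x + a) ⁻¹' Ioi a = Ioi (0 : ℝ) := by
    ext; simp
  rw [e]
  refine setLIntegral_mono (by fun_prop) fun u hu => ?_
  have hu : (0 : ℝ) < u := hu
  rw [gaussianPDF, gaussianPDF, ← ENNReal.ofReal_mul (by positivity),
    ← ENNReal.ofReal_mul (by positivity)]
  refine ENNReal.ofReal_le_ofReal ?_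
  rw [gaussianPDFReal, gaussianPDFReal, mul_left_comm (Real.exp (-(b * u))),
    mul_left_comm (Real.exp (-(a ^ 2 / 2))), ← Real.exp_add, ← Real.exp_add]
  refine mul_le_mul_of_nonneg_left (Real.exp_le_exp.2 ?_) (by positivity)
  simp only [NNReal.coe_one, sub_zero, mul_one]
  nlinarith

/-- By symmetry the half line has mass at most `1 / 2`, and the exponential factor is strictly below
1 there. -/
lemma two_mul_setLIntegral_exp_mul_gaussianPDF_lt_one {b : ℝ} (hb : 0 < b) :
    2 * ∫⁻ u in Ioi 0, ENNReal.ofReal (Real.exp (-(b * u))) * gaussianPDF 0 1 u < 1 := by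
  have hle : 2 * gaussianReal 0 1 (Ioi 0) ≤ 1 := by
    rw [← gaussianReal_abs_gt le_rfl]
    exact prob_le_one
  rw [gaussianReal_apply _ one_ne_zero] at hle
  refine lt_of_lt_of_le ?_ hle
  refine ENNReal.mul_lt_mul_right (by simp) (by simp) ?_
  have hfin : ∫⁻ u in Ioi 0, gaussianPDF 0 1 u ≠ ∞ := by
    rw [← gaussianReal_apply _ one_ne_zero]
    exact measure_ne_top _ _
  have hlt : ∀ u ∈ Ioi (0 : ℝ), ENNReal.ofReal (Real.exp (-(b * u))) * gaussianPDF 0 1 u <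
      gaussianPDF 0 1 u := fun u hu => by
    have hu : (0 : ℝ) < u := hu
    have h1 : ENNReal.ofReal (Real.exp (-(b * u))) < 1 := by
      rw [ENNReal.ofReal_lt_one, Real.exp_lt_one_iff]
      have := mul_pos hb hu
      linarith
    calc _ < 1 * gaussianPDF 0 1 u :=
          ENNReal.mul_lt_mul_left (gaussianPDF_pos _ one_ne_zero u).ne' gaussianPDF_ne_top h1
      _ = _ := one_mul _
  exact setLIntegral_strict_mono measurableSet_Ioi (by simp) (by fun_prop)
    (ne_top_of_le_ne_top hfin (setLIntegral_mono (by fun_prop) fun u hu => (hlt u hu).le))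
    (Eventually.of_forall hlt)

/-- The two-sided tail of a centred Gaussian is strictly smaller than its Chernoff bound, so the
threshold can be lowered a little. -/
lemma exists_lt_one_gaussianReal_abs_gt_le {c : ℝ} (hc : 0 < c) :
    ∃ κ : ℝ, 0 < κ ∧ κ < 1 ∧ ∀ v : ℝ≥0,
      gaussianReal 0 v {x | κ * c * √v < |x|} ≤ ENNReal.ofReal (Real.exp (-(c ^ 2 / 2))) := by
  set ρ := 2 * ∫⁻ u in Ioi 0, ENNReal.ofReal (Real.exp (-(c / 2 * u))) * gaussianPDF 0 1 u
    with hρ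
  have hρ1 : ρ < 1 := two_mul_setLIntegral_exp_mul_gaussianPDF_lt_one (by positivity)
  obtain ⟨r, hr⟩ : ∃ r : ℝ≥0, ρ = r := ⟨ρ.toNNReal, by rw [ENNReal.coe_toNNReal hρ1.ne_top]⟩
  have hr1 : (r : ℝ) < 1 := by rw [hr] at hρ1; exact_mod_cast hρ1
  -- At `κ = 1` the estimate is smaller than the Chernoff bound by the factor `ρ < 1`, and `ρ` does
  -- not involve `κ`, so by continuity some `κ < 1` still works. Requiring `1 / 2 < κ` makes `c / 2`
  -- an admissible `b` for the threshold `κ * c`.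
  have hcont : ContinuousAt (fun κ : ℝ => Real.exp (-((κ * c) ^ 2 / 2)) * r) 1 := by fun_prop
  have hlt : Real.exp (-((1 * c) ^ 2 / 2)) * r < Real.exp (-(c ^ 2 / 2)) := by
    rw [one_mul]
    exact mul_lt_of_lt_one_right (Real.exp_pos _) hr1
  have hev := hcont.eventually (gt_mem_nhds hlt)
  obtain ⟨κ, ⟨hκ, hκ2⟩, hκ1⟩ := ((hev.and (lt_mem_nhds (by norm_num : (1 / 2 : ℝ) < 1))).filter_mono
    nhdsWithin_le_nhds |>.and (self_mem_nhdsWithin (s := Iio (1 : ℝ)))).exists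
  have hκ0 : 0 < κ := by linarith
  refine ⟨κ, hκ0, hκ1, fun v => ?_⟩
  -- Scaling by `√v` reduces to the standard Gaussian, so one `κ` serves all variances, including `v
  -- = 0`.
  have hmap := gaussianReal_map_const_mul (μ := 0) (v := 1) (√v)
  have hv : NNReal.mk (√(v : ℝ) ^ 2) (sq_nonneg _) * 1 = v := by
    ext; simp
  rw [mul_zero, hv] at hmap
  rw [← hmap, Measure.map_apply (by fun_prop) (measurableSet_lt (by fun_prop) (by fun_prop))]
  calc gaussianReal 0 1 ((fun x => √↑v * x) ⁻¹' {x | κ * c * √↑v < |x|})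
      ≤ gaussianReal 0 1 {x | κ * c < |x|} := measure_mono fun x hx => by
        simp only [mem_preimage, mem_ofPred_eq, abs_mul, abs_of_nonneg (Real.sqrt_nonneg _)] at hx ⊢
        by_contra! hcon
        have := mul_le_mul_of_nonneg_left hcon (Real.sqrt_nonneg (v : ℝ))
        linarith
    _ = 2 * gaussianReal 0 1 (Ioi (κ * c)) := gaussianReal_abs_gt (by positivity)
    _ ≤ 2 * (ENNReal.ofReal (Real.exp (-((κ * c) ^ 2 / 2))) *
        ∫⁻ u in Ioi 0, ENNReal.ofReal (Real.exp (-(c / 2 * u))) * gaussianPDF 0 1 u) := by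
        gcongr
        exact gaussianReal_Ioi_le _ _ (by nlinarith)
    _ = ENNReal.ofReal (Real.exp (-((κ * c) ^ 2 / 2)) * r) := by
        rw [mul_left_comm, ← hρ, hr, ENNReal.ofReal_mul (by positivity),
          ENNReal.ofReal_coe_nnreal]
    _ ≤ _ := ENNReal.ofReal_le_ofReal hκ.le

end GaussianTail

/-! ### Gaussian regression -/

section Regression

variable {Ω : Type*} [MeasurableSpace Ω] {P : Measure Ω}

/-- The residuals of a linear prediction and the predictors are jointly Gaussian. -/
lemma hasGaussianLaw_residual {ι κ : Type*} [Fintype ι] [Fintype κ] {Y : ι → Ω → ℝ}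
    {Z : κ → Ω → ℝ} (h : HasGaussianLaw (fun ω => (fun k => Z k ω, fun i => Y i ω)) P)
    (G : Matrix ι ι ℝ) (c : κ → ι → ℝ) :
    HasGaussianLaw (fun ω =>
      (fun k => Z k ω - c k ⬝ᵥ (G *ᵥ fun i => Y i ω), fun i => Y i ω)) P := by
  let T : (κ → ℝ) × (ι → ℝ) →ₗ[ℝ] (κ → ℝ) × (ι → ℝ) :=
    { toFun := fun v => (fun k => v.1 k - c k ⬝ᵥ (G *ᵥ v.2), v.2)
      map_add' := fun v w => by
        ext k
        · simp [Matrix.mulVec_add, dotProduct_add]; ring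
        · simp
      map_smul' := fun a v => by
        ext k
        · simp [Matrix.mulVec_smul, dotProduct_smul]; ring
        · simp }
  exact h.map_fun T.toContinuousLinearMap

variable [IsProbabilityMeasure P]

lemma variance_sum_mul {ι : Type*} [Fintype ι] {D : ι → Ω → ℝ}
    (hD : ∀ i, MemLp (D i) 2 P) (a : ι → ℝ) :
    Var[fun ω => ∑ i, a i * D i ω; P] = a ⬝ᵥ (Matrix.of (fun i j => cov[D i, D j; P]) *ᵥ a) := by
  rw [← covariance_self (by
    have := fun i => (hD i).aemeasurable
    fun_prop), covariance_fun_sum_fun_sum (fun i => (hD i).const_mul _)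
    (fun i => (hD i).const_mul _)]
  simp only [covariance_const_mul_left, covariance_const_mul_right, dotProduct, Matrix.mulVec,
    Matrix.of_apply, Finset.mul_sum]
  exact Finset.sum_congr rfl fun i _ => Finset.sum_congr rfl fun j _ => by ring

/-- The matrix of covariances is positive semidefinite. -/
lemma posSemidef_covariance {ι : Type*} [Fintype ι] {D : ι → Ω → ℝ}
    (hD : ∀ i, MemLp (D i) 2 P) :
    (Matrix.of (fun i j => cov[D i, D j; P])).PosSemidef := by
  refine Matrix.PosSemidef.of_dotProduct_mulVec_nonneg ?_ fun a => ?_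
  · ext i j
    simp [covariance_comm]
  · rw [star_trivial, ← variance_sum_mul hD]
    exact variance_nonneg _ _

lemma covariance_sum_mul_right {ι : Type*} [Fintype ι] {Y : ι → Ω → ℝ} {Z : Ω → ℝ}
    (hZ : MemLp Z 2 P) (hY : ∀ i, MemLp (Y i) 2 P) (a : ι → ℝ) :
    cov[Z, fun ω => ∑ i, a i * Y i ω; P] = a ⬝ᵥ fun i => cov[Z, Y i; P] := by
  rw [covariance_fun_sum_right (fun i => (hY i).const_mul _) hZ]
  simp only [covariance_const_mul_right, dotProduct]

/-- Gaussian regression: the residuals of the best linear predictor are independent of the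
predictors. -/
lemma indepFun_residual {ι κ : Type*} [Fintype ι] [Fintype κ] [DecidableEq ι] {Y : ι → Ω → ℝ}
    {Z : κ → Ω → ℝ} (h : HasGaussianLaw (fun ω => (fun k => Z k ω, fun i => Y i ω)) P)
    {G : Matrix ι ι ℝ} (hG : ∀ i j, G i j = cov[Y i, Y j; P]) (hdet : IsUnit G.det) {c : κ → ι → ℝ}
    (hc : ∀ k i, c k i = cov[Z k, Y i; P]) :
    IndepFun (fun ω k => Z k ω - c k ⬝ᵥ (G⁻¹ *ᵥ fun i => Y i ω)) (fun ω i => Y i ω) P := by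
  have hZ : ∀ k, MemLp (Z k) 2 P := fun k => (h.fst.eval k).memLp_two
  have hY : ∀ i, MemLp (Y i) 2 P := fun i => (h.snd.eval i).memLp_two
  have hsymm : G.IsSymm := by ext i j; simp [hG, covariance_comm]
  have e : ∀ k ω, c k ⬝ᵥ (G⁻¹ *ᵥ fun i => Y i ω) = ∑ i, (G⁻¹ *ᵥ c k) i * Y i ω := fun k ω => by
    rw [Matrix.dotProduct_mulVec, ← Matrix.mulVec_transpose, Matrix.transpose_nonsing_inv, hsymm.eq]
    rfl
  -- For jointly Gaussian vectors, independence is vanishing of cross covariances, and here these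
  -- are the entries of `c - G G⁻¹ c`.
  refine HasGaussianLaw.indepFun_of_covariance_eval
    (X := fun k ω => Z k ω - c k ⬝ᵥ (G⁻¹ *ᵥ fun i => Y i ω)) ?_ ?_
  · exact hasGaussianLaw_residual h _ c
  · intro k j
    simp only [e]
    rw [covariance_fun_sub_left (hZ k) (memLp_finsetSum _ fun i _ => (hY i).const_mul _) (hY j),
      covariance_comm (fun ω => ∑ i, (G⁻¹ *ᵥ c k) i * Y i ω), covariance_sum_mul_right (hY j) hY,
      ← hc]
    have : (fun i => cov[Y j, Y i; P]) = G j := by ext i; rw [hG]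
    rw [this, dotProduct_comm]
    change c k j - (G *ᵥ (G⁻¹ *ᵥ c k)) j = 0
    rw [Matrix.mulVec_mulVec, Matrix.mul_nonsing_inv _ hdet, Matrix.one_mulVec, sub_self]

/-- The variance of the residual of the best linear predictor. -/
lemma variance_residual {ι : Type*} [Fintype ι] [DecidableEq ι] {Y : ι → Ω → ℝ}
    {Z : Ω → ℝ} (hZ : MemLp Z 2 P) (hY : ∀ i, MemLp (Y i) 2 P)
    {G : Matrix ι ι ℝ} (hG : ∀ i j, G i j = cov[Y i, Y j; P]) (hdet : IsUnit G.det) {c : ι → ℝ}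
    (hc : ∀ i, c i = cov[Z, Y i; P]) :
    Var[fun ω => Z ω - c ⬝ᵥ (G⁻¹ *ᵥ fun i => Y i ω); P] = Var[Z; P] - c ⬝ᵥ (G⁻¹ *ᵥ c) := by
  have hsymm : G.IsSymm := by ext i j; simp [hG, covariance_comm]
  have e : ∀ ω, c ⬝ᵥ (G⁻¹ *ᵥ fun i => Y i ω) = ∑ i, (G⁻¹ *ᵥ c) i * Y i ω := fun ω => by
    rw [Matrix.dotProduct_mulVec, ← Matrix.mulVec_transpose, Matrix.transpose_nonsing_inv, hsymm.eq]
    rfl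
  simp only [e]
  rw [variance_fun_sub hZ (memLp_finsetSum _ fun i _ => (hY i).const_mul _),
    covariance_sum_mul_right hZ hY, variance_sum_mul hY]
  have h1 : Matrix.of (fun i j => cov[Y i, Y j; P]) = G := by ext i j; simp [hG]
  have h2 : (fun i => cov[Z, Y i; P]) = c := by ext i; rw [hc]
  rw [h1, h2, Matrix.mulVec_mulVec, Matrix.mul_nonsing_inv _ hdet, Matrix.one_mulVec,
    dotProduct_comm c]
  ring

end Regression

/-! ### Covariances of the data and positivity of the posterior variance -/

lemma Model.kf_comm {d N : ℕ} (M : Model d N) (x x' : State d) : M.kf x x' = M.kf x' x := by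
  rw [Model.kf, seKernel, seKernel, norm_sub_rev]

lemma Model.kg_comm {d N : ℕ} (M : Model d N) (x x' : State d) : M.kg x x' = M.kg x' x := by
  rw [Model.kg, seKernel, seKernel, norm_sub_rev]

lemma Model.kf_self {d N : ℕ} (M : Model d N) (x : State d) : M.kf x x = M.sf ^ 2 := by
  simp [Model.kf, seKernel]

section Covariance

variable {Ω : Type*} [MeasurableSpace Ω] {P : Measure Ω} [IsFiniteMeasure P] {X Y Z : Ω → ℝ}

lemma covariance_fun_add_left (hX : MemLp X 2 P) (hY : MemLp Y 2 P) (hZ : MemLp Z 2 P) :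
    cov[fun ω => X ω + Y ω, Z; P] = cov[X, Z; P] + cov[Y, Z; P] := covariance_add_left hX hY hZ

lemma covariance_fun_add_right (hX : MemLp X 2 P) (hY : MemLp Y 2 P) (hZ : MemLp Z 2 P) :
    cov[X, fun ω => Y ω + Z ω; P] = cov[X, Y; P] + cov[X, Z; P] := covariance_add_right hX hY hZ

end Covariance

namespace GPData

/-- The noise-free part of the `n`-th target. -/
def clean {d N : ℕ} {Ω : Type*} (M : Model d N) (f g : Ω → State d → ℝ) (n : Fin N) (ω : Ω) : ℝ :=
  f ω (M.xs n) - M.fhat (M.xs n) + (g ω (M.xs n) - M.ghat (M.xs n)) * M.us n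

lemma targets_eq {d N : ℕ} {Ω : Type*} {M : Model d N} {f g : Ω → State d → ℝ}
    {noise : Ω → Fin N → ℝ} (n : Fin N) :
    (fun ω => M.targets f g noise ω n) = fun ω => clean M f g n ω + noise ω n := rfl

variable {d N : ℕ} {Ω : Type*} [MeasurableSpace Ω] {M : Model d N} {X : Set (State d)}
  {f g : Ω → State d → ℝ} {noise : Ω → Fin N → ℝ} {P : Measure Ω}

lemma hasGaussianLaw_noise (h : GPData M X f g noise P) : HasGaussianLaw noise P :=
  h.noise_indep.hasGaussianLaw fun n => ⟨by rw [h.noise_law n]; infer_instance⟩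

lemma memLp_f (h : GPData M X f g noise P) {x : State d} (hx : x ∈ X) :
    MemLp (fun ω => f ω x) 2 P := (h.prior_f.gaussian.hasGaussianLaw_eval ⟨x, hx⟩).memLp_two

lemma memLp_g (h : GPData M X f g noise P) {x : State d} (hx : x ∈ X) :
    MemLp (fun ω => g ω x) 2 P := (h.prior_g.gaussian.hasGaussianLaw_eval ⟨x, hx⟩).memLp_two

lemma measurable_targets (h : GPData M X f g noise P) : Measurable (M.targets f g noise) := by
  have hf := fun n => h.prior_f.measurable _ (h.xs_mem n)
  have hg := fun n => h.prior_g.measurable _ (h.xs_mem n)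
  have hn := h.noise_measurable
  unfold Model.targets
  fun_prop

lemma memLp_noise (h : GPData M X f g noise P) (n : Fin N) :
    MemLp (fun ω => noise ω n) 2 P := (h.hasGaussianLaw_noise.eval n).memLp_two

/-- The values of `f` and `g` at finitely many points and the targets are jointly Gaussian. -/
lemma hasGaussianLaw_joint (h : GPData M X f g noise P) (S : Finset X) :
    HasGaussianLaw (fun ω =>
      ((fun k : S ⊕ S => Sum.elim (fun x : S => f ω x.1 - M.fhat x.1)
        (fun x : S => g ω x.1 - M.ghat x.1) k), fun i => M.targets f g noise ω i)) P := by
  classical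
  -- With the training states included, the vector in question is an affine image of the process
  -- values on `T` and the noise. These are independent Gaussian blocks, hence jointly Gaussian.
  let T : Finset X := S ∪ Finset.univ.image fun n => (⟨M.xs n, h.xs_mem n⟩ : X)
  have hS : ∀ x : S, x.1 ∈ T := fun x => Finset.mem_union_left _ x.2
  have hxs : ∀ n, (⟨M.xs n, h.xs_mem n⟩ : X) ∈ T := fun n =>
    Finset.mem_union_right _ (Finset.mem_image_of_mem _ (Finset.mem_univ n))
  have hF := h.prior_f.gaussian.hasGaussianLaw T
  have hG := h.prior_g.gaussian.hasGaussianLaw T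
  have hFG := IndepFun.hasGaussianLaw hF hG
    (h.indep_fg.comp (φ := T.restrict) (ψ := T.restrict) (by fun_prop) (by fun_prop))
  have hV := IndepFun.hasGaussianLaw hFG h.hasGaussianLaw_noise
    (h.noise_indep_fg.comp (φ := fun v => (T.restrict v.1, T.restrict v.2)) (ψ := id)
      (by fun_prop) measurable_id)
  let A : ((T → ℝ) × (T → ℝ)) × (Fin N → ℝ) →ₗ[ℝ] (S ⊕ S → ℝ) × (Fin N → ℝ) :=
    { toFun := fun v => (Sum.elim (fun x => v.1.1 ⟨x.1, hS x⟩) (fun x => v.1.2 ⟨x.1, hS x⟩),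
        fun n => v.1.1 ⟨_, hxs n⟩ + v.1.2 ⟨_, hxs n⟩ * M.us n + v.2 n)
      map_add' := fun v w => by
        ext k
        · rcases k with k | k <;> simp
        · simp; ring
      map_smul' := fun c v => by
        ext k
        · rcases k with k | k <;> simp
        · simp; ring }
  have hA := hV.map_fun A.toContinuousLinearMap
  let b : (S ⊕ S → ℝ) × (Fin N → ℝ) :=
    (Sum.elim (fun x => M.fhat x.1) (fun x => M.ghat x.1),
      fun n => M.fhat (M.xs n) + M.ghat (M.xs n) * M.us n)
  have := hA.isGaussian_map
  have hb : HasGaussianLaw (fun ω => A.toContinuousLinearMap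
      ((T.restrict fun x : X => f ω x, T.restrict fun x : X => g ω x), noise ω) - b) P := by
    refine ⟨?_⟩
    have e := AEMeasurable.map_map_of_aemeasurable (μ := P) (g := fun z => z - b)
      (by fun_prop) hA.aemeasurable
    have : IsGaussian ((P.map (fun ω => A.toContinuousLinearMap
      ((T.restrict fun x : X => f ω x, T.restrict fun x : X => g ω x), noise ω))).map
        fun z => z - b) := inferInstance
    rw [e] at this
    exact this
  convert hb using 1
  ext ω k
  · rcases k with k | k <;> simp [A, b]
  · simp [A, b, Model.targets]; ring

lemma cov_noise (h : GPData M X f g noise P) (n m : Fin N) :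
    cov[fun ω => noise ω n, fun ω => noise ω m; P] = if n = m then M.son ^ 2 else 0 := by
  split_ifs with hnm
  · subst hnm
    have hm : Measurable fun ω => noise ω n := (measurable_pi_apply n).comp h.noise_measurable
    rw [covariance_self hm.aemeasurable, ← variance_id_map hm.aemeasurable, h.noise_law n,
      variance_id_gaussianReal, Real.coe_toNNReal _ (sq_nonneg _)]
  · exact (h.noise_indep.indepFun hnm).covariance_eq_zero (h.memLp_noise n) (h.memLp_noise m)

variable [IsProbabilityMeasure P]

lemma memLp_fc (h : GPData M X f g noise P) {x : State d} (hx : x ∈ X) :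
    MemLp (fun ω => f ω x - M.fhat x) 2 P := (h.memLp_f hx).sub (memLp_const _)

lemma memLp_gc (h : GPData M X f g noise P) {x : State d} (hx : x ∈ X) :
    MemLp (fun ω => g ω x - M.ghat x) 2 P := (h.memLp_g hx).sub (memLp_const _)

lemma cov_f_f (h : GPData M X f g noise P) {x x' : State d} (hx : x ∈ X) (hx' : x' ∈ X) :
    cov[fun ω => f ω x - M.fhat x, fun ω => f ω x' - M.fhat x'; P] = M.kf x x' := by
  rw [covariance_sub_const_left ((h.memLp_f hx).integrable one_le_two),
    covariance_sub_const_right ((h.memLp_f hx').integrable one_le_two), h.prior_f.cov x hx x' hx']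

lemma cov_g_g (h : GPData M X f g noise P) {x x' : State d} (hx : x ∈ X) (hx' : x' ∈ X) :
    cov[fun ω => g ω x - M.ghat x, fun ω => g ω x' - M.ghat x'; P] = M.kg x x' := by
  rw [covariance_sub_const_left ((h.memLp_g hx).integrable one_le_two),
    covariance_sub_const_right ((h.memLp_g hx').integrable one_le_two), h.prior_g.cov x hx x' hx']

lemma cov_f_g (h : GPData M X f g noise P) {x x' : State d} (hx : x ∈ X) (hx' : x' ∈ X) :
    cov[fun ω => f ω x - M.fhat x, fun ω => g ω x' - M.ghat x'; P] = 0 :=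
  IndepFun.covariance_eq_zero (h.indep_fg.comp (φ := fun v : X → ℝ => v ⟨x, hx⟩ - M.fhat x)
    (ψ := fun v : X → ℝ => v ⟨x', hx'⟩ - M.ghat x') (by fun_prop) (by fun_prop))
    (h.memLp_fc hx) (h.memLp_gc hx')

lemma cov_f_noise (h : GPData M X f g noise P) {x : State d} (hx : x ∈ X) (n : Fin N) :
    cov[fun ω => f ω x - M.fhat x, fun ω => noise ω n; P] = 0 :=
  IndepFun.covariance_eq_zero (h.noise_indep_fg.comp
    (φ := fun v : (X → ℝ) × (X → ℝ) => v.1 ⟨x, hx⟩ - M.fhat x)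
    (ψ := fun v : Fin N → ℝ => v n) (by fun_prop) (by fun_prop)) (h.memLp_fc hx) (h.memLp_noise n)

lemma cov_g_noise (h : GPData M X f g noise P) {x : State d} (hx : x ∈ X) (n : Fin N) :
    cov[fun ω => g ω x - M.ghat x, fun ω => noise ω n; P] = 0 :=
  IndepFun.covariance_eq_zero (h.noise_indep_fg.comp
    (φ := fun v : (X → ℝ) × (X → ℝ) => v.2 ⟨x, hx⟩ - M.ghat x)
    (ψ := fun v : Fin N → ℝ => v n) (by fun_prop) (by fun_prop)) (h.memLp_gc hx) (h.memLp_noise n)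

lemma memLp_clean (h : GPData M X f g noise P) (n : Fin N) : MemLp (clean M f g n) 2 P :=
  (h.memLp_fc (h.xs_mem n)).add ((h.memLp_gc (h.xs_mem n)).mul_const _)

lemma memLp_targets (h : GPData M X f g noise P) (n : Fin N) :
    MemLp (fun ω => M.targets f g noise ω n) 2 P :=
  (h.memLp_clean n).add (h.memLp_noise n)

lemma cov_f_clean (h : GPData M X f g noise P) {x : State d} (hx : x ∈ X) (n : Fin N) :
    cov[fun ω => f ω x - M.fhat x, clean M f g n; P] = M.kfVec x n := by
  unfold clean
  rw [covariance_fun_add_right (h.memLp_fc hx) (h.memLp_fc (h.xs_mem n))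
    ((h.memLp_gc (h.xs_mem n)).mul_const _), covariance_mul_const_right, h.cov_f_f hx (h.xs_mem n),
    h.cov_f_g hx (h.xs_mem n), zero_mul, add_zero, Model.kfVec, Model.kf_comm]

lemma cov_g_clean (h : GPData M X f g noise P) {x : State d} (hx : x ∈ X) (n : Fin N) :
    cov[fun ω => g ω x - M.ghat x, clean M f g n; P] = M.ukgVec x n := by
  unfold clean
  rw [covariance_fun_add_right (h.memLp_gc hx) (h.memLp_fc (h.xs_mem n))
    ((h.memLp_gc (h.xs_mem n)).mul_const _), covariance_mul_const_right, h.cov_g_g hx (h.xs_mem n),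
    covariance_comm, h.cov_f_g (h.xs_mem n) hx, zero_add, Model.ukgVec, Model.kg_comm, mul_comm]

lemma cov_noise_clean (h : GPData M X f g noise P) (m n : Fin N) :
    cov[fun ω => noise ω m, clean M f g n; P] = 0 := by
  unfold clean
  rw [covariance_fun_add_right (h.memLp_noise m) (h.memLp_fc (h.xs_mem n))
    ((h.memLp_gc (h.xs_mem n)).mul_const _), covariance_mul_const_right, covariance_comm,
    h.cov_f_noise (h.xs_mem n), covariance_comm, h.cov_g_noise (h.xs_mem n), zero_mul, add_zero]

lemma cov_clean_clean (h : GPData M X f g noise P) (m n : Fin N) :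
    cov[clean M f g m, clean M f g n; P] = M.k (M.xs m, M.us m) (M.xs n, M.us n) := by
  conv_lhs => enter [1]; unfold clean
  rw [covariance_fun_add_left (h.memLp_fc (h.xs_mem m))
    ((h.memLp_gc (h.xs_mem m)).mul_const _) (h.memLp_clean n), covariance_mul_const_left,
    h.cov_f_clean (h.xs_mem m), h.cov_g_clean (h.xs_mem m), Model.k, Model.kfVec, Model.ukgVec,
    Model.kf_comm, Model.kg_comm]
  ring

lemma cov_f_targets (h : GPData M X f g noise P) {x : State d} (hx : x ∈ X) (n : Fin N) :
    cov[fun ω => f ω x - M.fhat x, fun ω => M.targets f g noise ω n; P] = M.kfVec x n := by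
  rw [targets_eq, covariance_fun_add_right (h.memLp_fc hx) (h.memLp_clean n) (h.memLp_noise n),
    h.cov_f_clean hx, h.cov_f_noise hx, add_zero]

lemma cov_g_targets (h : GPData M X f g noise P) {x : State d} (hx : x ∈ X) (n : Fin N) :
    cov[fun ω => g ω x - M.ghat x, fun ω => M.targets f g noise ω n; P] = M.ukgVec x n := by
  rw [targets_eq, covariance_fun_add_right (h.memLp_gc hx) (h.memLp_clean n) (h.memLp_noise n),
    h.cov_g_clean hx, h.cov_g_noise hx, add_zero]

lemma gram_apply (M : Model d N) (m n : Fin N) :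
    M.gram m n = M.k (M.xs m, M.us m) (M.xs n, M.us n) + if m = n then M.son ^ 2 else 0 := by
  simp [Model.gram, Matrix.one_apply]

lemma cov_targets_targets (h : GPData M X f g noise P) (m n : Fin N) :
    cov[fun ω => M.targets f g noise ω m, fun ω => M.targets f g noise ω n; P] = M.gram m n := by
  have hn : MemLp (fun ω => clean M f g n ω + noise ω n) 2 P := h.memLp_targets n
  rw [targets_eq, targets_eq, covariance_fun_add_left (h.memLp_clean m) (h.memLp_noise m) hn,
    covariance_fun_add_right (h.memLp_clean m) (h.memLp_clean n) (h.memLp_noise n),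
    covariance_fun_add_right (h.memLp_noise m) (h.memLp_clean n) (h.memLp_noise n),
    h.cov_clean_clean, h.cov_noise_clean, covariance_comm (clean M f g m), h.cov_noise_clean,
    h.cov_noise, gram_apply]
  ring

lemma gram_eq (h : GPData M X f g noise P) :
    M.gram = Matrix.of (fun i j => cov[clean M f g i, clean M f g j; P]) + M.son ^ 2 • 1 := by
  simp only [h.cov_clean_clean, Model.gram]

/-- The covariance matrix of the noise-free targets is positive semidefinite, and the noise adds a
positive multiple of the identity. -/
lemma isUnit_det_gram (h : GPData M X f g noise P) (hson : 0 < M.son) : IsUnit M.gram.det := by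
  rw [← Matrix.isUnit_iff_isUnit_det, h.gram_eq]
  refine (Matrix.PosDef.posSemidef_add (posSemidef_covariance h.memLp_clean) ?_).isUnit
  exact Matrix.PosDef.one.smul (by positivity)

/-- The posterior variance of `f` is positive. -/
lemma varf_pos (h : GPData M X f g noise P) (hsf : 0 < M.sf) (hson : 0 < M.son) {x : State d}
    (hx : x ∈ X) : 0 < M.varf x := by
  set v := M.kfVec x with hv
  set a := M.gram⁻¹ *ᵥ v with ha
  have hva : v = M.gram *ᵥ a := by
    rw [ha, Matrix.mulVec_mulVec, Matrix.mul_nonsing_inv _ (h.isUnit_det_gram hson),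
      Matrix.one_mulVec]
  have hsum : MemLp (fun ω => ∑ i, a i * clean M f g i ω) 2 P :=
    memLp_finsetSum _ fun i _ => (h.memLp_clean i).const_mul _
  -- Using the weights `a` on the noise-free targets gives a residual of variance `k_f(x, x) - a ⬝ᵥ
  -- v - son² (a ⬝ᵥ a)`. Its nonnegativity says that the posterior variance is at least `son² (a ⬝ᵥ
  -- a)`; for `a = 0` the posterior variance is the prior variance `sf²`.
  have hvar := variance_fun_sub (h.memLp_fc hx) hsum
  rw [covariance_sum_mul_right (h.memLp_fc hx) h.memLp_clean, variance_sum_mul h.memLp_clean,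
    ← covariance_self (h.memLp_fc hx).aemeasurable, h.cov_f_f hx hx] at hvar
  have e1 : (fun i => cov[fun ω => f ω x - M.fhat x, clean M f g i; P]) = v := by
    ext i; rw [h.cov_f_clean hx]
  have e2 : Matrix.of (fun i j => cov[clean M f g i, clean M f g j; P]) *ᵥ a =
      v - M.son ^ 2 • a := by
    rw [hva, h.gram_eq, Matrix.add_mulVec, Matrix.smul_mulVec, Matrix.one_mulVec,
      add_sub_cancel_right]
  rw [e1, e2, dotProduct_sub, dotProduct_smul] at hvar
  have h0 := variance_nonneg (fun ω => f ω x - M.fhat x - ∑ i, a i * clean M f g i ω) P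
  have hvarf : M.varf x = M.kf x x - a ⬝ᵥ v := by rw [Model.varf, dotProduct_comm]
  rcases eq_or_ne a 0 with h0a | h0a
  · rw [hvarf, h0a, zero_dotProduct, Model.kf_self, sub_zero]
    positivity
  · have : 0 < a ⬝ᵥ a := lt_of_le_of_ne
      (Finset.sum_nonneg fun i _ => mul_self_nonneg (a i))
      (Ne.symm fun h => h0a (dotProduct_self_eq_zero.1 h))
    have : 0 < M.son ^ 2 * (a ⬝ᵥ a) := by positivity
    rw [smul_eq_mul] at hvar
    linarith

lemma integral_fc (h : GPData M X f g noise P) {x : State d} (hx : x ∈ X) :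
    ∫ ω, (f ω x - M.fhat x) ∂P = 0 := by
  rw [integral_sub ((h.memLp_f hx).integrable one_le_two) (integrable_const _), h.prior_f.mean x hx]
  simp

lemma integral_gc (h : GPData M X f g noise P) {x : State d} (hx : x ∈ X) :
    ∫ ω, (g ω x - M.ghat x) ∂P = 0 := by
  rw [integral_sub ((h.memLp_g hx).integrable one_le_two) (integrable_const _), h.prior_g.mean x hx]
  simp

lemma integral_targets (h : GPData M X f g noise P) (n : Fin N) :
    ∫ ω, M.targets f g noise ω n ∂P = 0 := by
  have hn : ∫ ω, noise ω n ∂P = 0 := by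
    have hm : Measurable fun ω => noise ω n := (measurable_pi_apply n).comp h.noise_measurable
    have e := integral_map (f := id) hm.aemeasurable (by fun_prop) (μ := P)
    rw [h.noise_law n] at e
    exact e.symm.trans integral_id_gaussianReal
  have e : ∀ ω, M.targets f g noise ω n = clean M f g n ω + noise ω n := fun _ => rfl
  simp only [e]
  rw [integral_add ((h.memLp_clean n).integrable one_le_two)
    ((h.memLp_noise n).integrable one_le_two), hn]
  unfold clean
  rw [integral_add ((h.memLp_fc (h.xs_mem n)).integrable one_le_two)
    (((h.memLp_gc (h.xs_mem n)).mul_const _).integrable one_le_two), integral_mul_const,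
    h.integral_fc (h.xs_mem n), h.integral_gc (h.xs_mem n)]
  simp

lemma integral_residual (h : GPData M X f g noise P) {Z : Ω → ℝ} (hZ : MemLp Z 2 P)
    (hZ0 : ∫ ω, Z ω ∂P = 0) (c : Fin N → ℝ) (G : Matrix (Fin N) (Fin N) ℝ) :
    ∫ ω, (Z ω - c ⬝ᵥ (G *ᵥ M.targets f g noise ω)) ∂P = 0 := by
  have hi : ∀ n, Integrable (fun ω => M.targets f g noise ω n) P := fun n =>
    (h.memLp_targets n).integrable one_le_two
  have e : ∀ ω, c ⬝ᵥ (G *ᵥ M.targets f g noise ω) =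
      ∑ i, (c ᵥ* G) i * M.targets f g noise ω i := fun ω => by
    rw [Matrix.dotProduct_mulVec]; rfl
  simp only [e]
  rw [integral_sub (hZ.integrable one_le_two)
      (integrable_finsetSum _ fun i _ => (hi i).const_mul _),
    hZ0, integral_finsetSum _ fun i _ => (hi i).const_mul _]
  simp [integral_const_mul, h.integral_targets]

end GPData

/-! ### Uniform confidence bounds -/

lemma beta_pos {d : ℕ} (X : Set (State d)) {δ τ : ℝ} (hδ : 0 < δ) (hδ1 : δ < 1) (hτ : 0 < τ) :
    0 < beta X δ τ := by
  have h1 : 0 ≤ Real.log (1 + Metric.diam X / τ) :=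
    Real.log_nonneg (le_add_of_nonneg_right (div_nonneg Metric.diam_nonneg hτ.le))
  have h2 := Real.log_neg hδ hδ1
  unfold beta
  have : 0 ≤ 2 * (d : ℝ) * Real.log (1 + Metric.diam X / τ) := by positivity
  linarith

/-- `β` is calibrated so that covering number times Chernoff bound is `δ`; counting `f` and `g`
separately gives the total failure probability `2δ`. -/
lemma pow_mul_exp_neg_beta {d : ℕ} (X : Set (State d)) {δ τ : ℝ} (hδ : 0 < δ) (hτ : 0 < τ) :
    (1 + Metric.diam X / τ) ^ d * Real.exp (-(beta X δ τ / 2)) = δ := by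
  have h0 : 0 < 1 + Metric.diam X / τ := by
    have := div_nonneg (Metric.diam_nonneg (s := X)) hτ.le
    linarith
  have e : -(beta X δ τ / 2) = -(d * Real.log (1 + Metric.diam X / τ)) + Real.log δ := by
    unfold beta; ring
  rw [e, Real.exp_add, Real.exp_log hδ, Real.exp_neg, Real.exp_nat_mul, Real.exp_log h0,
    ← mul_assoc, mul_inv_cancel₀ (pow_pos h0 d).ne', one_mul]

/-- Extension of a pointwise bound at a nearby point by Lipschitz continuity. -/
lemma abs_sub_le_of_near {E : Type*} [PseudoMetricSpace E] {X : Set E} {h m v : E → ℝ}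
    {Lh Lm Lv : ℝ≥0} (hh : LipschitzOnWith Lh h X) (hm : LipschitzOnWith Lm m X)
    (hv : LipschitzOnWith Lv v X) {κ β τ : ℝ} (hκ0 : 0 ≤ κ) (hκ1 : κ ≤ 1) (hβ : 0 ≤ β) (hτ : 0 ≤ τ)
    {x p : E} (hx : x ∈ X) (hp : p ∈ X) (hxp : dist x p ≤ τ)
    (hb : |h p - m p| ≤ κ * √β * √(v p)) :
    |h x - m x| ≤ κ * √β * √(v x) + ((Lm + Lh) * τ + √(β * Lv * τ)) := by
  have h1 := hh.dist_le_mul x hx p hp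
  have h2 := hm.dist_le_mul x hx p hp
  have h3 := hv.dist_le_mul p hp x hx
  rw [Real.dist_eq] at h1 h2 h3
  rw [dist_comm p x] at h3
  have h1' : |h x - h p| ≤ Lh * τ := h1.trans (mul_le_mul_of_nonneg_left hxp Lh.2)
  have h2' : |m x - m p| ≤ Lm * τ := h2.trans (mul_le_mul_of_nonneg_left hxp Lm.2)
  have h3' : v p ≤ v x + Lv * τ := by
    have := h3.trans (mul_le_mul_of_nonneg_left hxp Lv.2)
    linarith [(abs_le.1 this).2]
  have h4 : √(v p) ≤ √(v x) + √(Lv * τ) := by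
    refine (Real.sqrt_le_sqrt h3').trans ?_
    -- `v` may be negative here; then `√(v x) = 0` and `v p ≤ Lv * τ` suffices.
    rcases le_total 0 (v x) with h0 | h0
    · refine Real.sqrt_le_iff.2 ⟨by positivity, ?_⟩
      nlinarith [Real.sq_sqrt h0, Real.sq_sqrt (by positivity : 0 ≤ (Lv : ℝ) * τ),
        mul_nonneg (Real.sqrt_nonneg (v x)) (Real.sqrt_nonneg (Lv * τ))]
    · rw [Real.sqrt_eq_zero'.2 h0, zero_add]
      exact Real.sqrt_le_sqrt (by linarith)
  -- The factor `κ` is kept only in front of `√(v x)`, where the margin will come from, and is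
  -- bounded by 1 in the Lipschitz correction.
  have h5 : κ * √β * √(v p) ≤ κ * √β * √(v x) + √(β * Lv * τ) := by
    have e : √(β * Lv * τ) = √β * √(Lv * τ) := by rw [mul_assoc, Real.sqrt_mul hβ]
    calc κ * √β * √(v p) ≤ κ * √β * (√(v x) + √(Lv * τ)) := by gcongr
      _ = κ * √β * √(v x) + κ * (√β * √(Lv * τ)) := by ring
      _ ≤ κ * √β * √(v x) + 1 * (√β * √(Lv * τ)) := by gcongr
      _ = _ := by rw [one_mul, e]
  have h6 : h x - m x = (h x - h p) + (h p - m p) - (m x - m p) := by ring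
  rw [h6]
  refine (abs_sub _ _).trans ?_
  have := abs_add_le (h x - h p) (h p - m p)
  linarith

/-- If `W` is independent of `Y`, then events determined by `W` have constant conditional
probability given `Y`. -/
lemma condProb_preimage_of_indepFun {Ω A B : Type*} [MeasurableSpace Ω] [mA : MeasurableSpace A]
    [mB : MeasurableSpace B] {P : Measure Ω} [IsProbabilityMeasure P] {W : Ω → A} {Y : Ω → B}
    (hW : Measurable W) (hY : Measurable Y) (h : IndepFun W Y P) {s : Set A}
    (hs : MeasurableSet s) :
    P⟦W ⁻¹' s | MeasurableSpace.comap Y mB⟧ =ᵐ[P] fun _ => P.real (W ⁻¹' s) := by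
  have h1 := condExp_indep_eq (f := (W ⁻¹' s).indicator fun _ => (1 : ℝ)) hW.comap_le hY.comap_le
    (stronglyMeasurable_const.indicator ⟨s, hs, rfl⟩) ((IndepFun_iff_Indep _ _ _).1 h)
  refine h1.trans (Eventually.of_forall fun ω => ?_)
  simp only
  rw [integral_indicator_const _ (hW hs), smul_eq_mul, mul_one]

/-- The event on which the posterior confidence bounds hold uniformly on `X`. The bound for `f`
holds with a factor `κ < 1` in front of the standard deviation. -/
lemma GPData.exists_event {d N : ℕ} {X : Set (State d)} (hX : Bornology.IsBounded X) {M : Model d N}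
    (hson : 0 < M.son) {Ω : Type*} [MeasurableSpace Ω] {P : Measure Ω} [IsProbabilityMeasure P]
    {f g : Ω → State d → ℝ} {noise : Ω → Fin N → ℝ} (h : GPData M X f g noise P)
    {δ τ : ℝ} (hδ : 0 < δ) (hδ1 : δ < 1) (hτ : 0 < τ) :
    ∃ κ : ℝ, 0 < κ ∧ κ < 1 ∧ ∃ E : Set Ω, MeasurableSet E ∧
      (∀ᵐ ω ∂P, 1 - 2 * δ ≤
        (P⟦E | MeasurableSpace.comap (M.targets f g noise) inferInstance⟧) ω) ∧
      ∀ ω ∈ E, ∀ L : LipConsts, L.ValidPosterior M X (M.targets f g noise ω) →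
        LipschitzOnWith L.f (f ω) X → LipschitzOnWith L.g (g ω) X → ∀ x ∈ X,
          |f ω x - M.muf (M.targets f g noise ω) x| ≤
            κ * √(beta X δ τ) * M.sigf x + gammaf X δ τ L ∧
          |g ω x - M.mug (M.targets f g noise ω) x| ≤
            √(beta X δ τ) * M.sigg x + gammag X δ τ L := by
  classical
  have hβ := beta_pos X hδ hδ1 hτ
  obtain ⟨κ, hκ0, hκ1, htail⟩ := exists_lt_one_gaussianReal_abs_gt_le (Real.sqrt_pos.2 hβ)
  rw [Real.sq_sqrt hβ.le] at htail
  obtain ⟨S₀, hS₀X, hcard₀, hcov₀⟩ := exists_finset_cover hX hτ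
  let S : Finset X := S₀.subtype (· ∈ X)
  have hcard : (S.card : ℝ) ≤ (1 + Metric.diam X / τ) ^ d := by
    refine le_trans ?_ hcard₀
    rw [Finset.card_subtype]
    exact_mod_cast Finset.card_filter_le _ _
  let Y : Fin N → Ω → ℝ := fun i ω => M.targets f g noise ω i
  let Z : S ⊕ S → Ω → ℝ := fun k ω => Sum.elim (fun x : S => f ω x.1 - M.fhat x.1)
    (fun x : S => g ω x.1 - M.ghat x.1) k
  let c : S ⊕ S → Fin N → ℝ := Sum.elim (fun x => M.kfVec x.1) (fun x => M.ukgVec x.1)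
  -- At the net points the deviation of the plant from the posterior mean is exactly this residual,
  -- which is independent of the targets.
  let W : Ω → S ⊕ S → ℝ := fun ω k => Z k ω - c k ⬝ᵥ (M.gram⁻¹ *ᵥ fun i => Y i ω)
  let v : S ⊕ S → ℝ := Sum.elim (fun x => M.varf x.1) (fun x => M.varg x.1)
  have hdet := h.isUnit_det_gram hson
  have hZm : ∀ k, Measurable (Z k) := by
    rintro (x | x)
    · exact (h.prior_f.measurable _ x.1.2).sub_const _
    · exact (h.prior_g.measurable _ x.1.2).sub_const _
  have hYm := h.measurable_targets
  have hYmi : ∀ i, Measurable (Y i) := fun i => (measurable_pi_apply i).comp hYm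
  have hW : Measurable W := by
    refine measurable_pi_lambda _ fun k => (hZm k).sub ?_
    simp only [dotProduct, Matrix.mulVec]
    fun_prop
  have hcY : ∀ k i, c k i = cov[Z k, Y i; P] := by
    rintro (x | x) i
    · exact (h.cov_f_targets x.1.2 i).symm
    · exact (h.cov_g_targets x.1.2 i).symm
  have hGY : ∀ i j, M.gram i j = cov[Y i, Y j; P] := fun i j => (h.cov_targets_targets i j).symm
  have hZ2 : ∀ k, MemLp (Z k) 2 P := by
    rintro (x | x)
    · exact h.memLp_fc x.1.2
    · exact h.memLp_gc x.1.2
  have hZ0 : ∀ k, ∫ ω, Z k ω ∂P = 0 := by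
    rintro (x | x)
    · exact h.integral_fc x.1.2
    · exact h.integral_gc x.1.2
  have hY2 : ∀ i, MemLp (Y i) 2 P := h.memLp_targets
  have hindep : IndepFun W (M.targets f g noise) P :=
    indepFun_residual (h.hasGaussianLaw_joint S) hGY hdet hcY
  have hlaw : ∀ k, P.map (fun ω => W ω k) = gaussianReal 0 (v k).toNNReal := by
    intro k
    have h1 := (hasGaussianLaw_residual (h.hasGaussianLaw_joint S) M.gram⁻¹ c).fst.eval k
    rw [h1.map_eq_gaussianReal]
    have hvar := variance_residual (hZ2 k) hY2 hGY hdet (hcY k)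
    have hvar' : Var[Z k; P] - c k ⬝ᵥ (M.gram⁻¹ *ᵥ c k) = v k := by
      rw [← covariance_self (hZm k).aemeasurable]
      rcases k with x | x
      · exact congrArg (· - _) (h.cov_f_f x.1.2 x.1.2)
      · exact congrArg (· - _) (h.cov_g_g x.1.2 x.1.2)
    have hmean := h.integral_residual (hZ2 k) (hZ0 k) (c k) M.gram⁻¹
    congr 1
    exact congrArg Real.toNNReal (hvar.trans hvar')
  have htailW : ∀ k, P {ω | κ * √(beta X δ τ) * √(v k) < |W ω k|} ≤
      ENNReal.ofReal (Real.exp (-(beta X δ τ / 2))) := by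
    intro k
    have := htail (v k).toNNReal
    rw [← hlaw k, Measure.map_apply (by fun_prop)
      (measurableSet_lt (by fun_prop) (by fun_prop))] at this
    refine le_trans (measure_mono fun ω hω => ?_) this
    have e : √((v k).toNNReal : ℝ) = √(v k) := by
      rcases le_total 0 (v k) with h0 | h0
      · rw [Real.coe_toNNReal _ h0]
      · rw [Real.toNNReal_of_nonpos h0, Real.sqrt_eq_zero'.2 h0]; simp
    rw [Set.mem_preimage, Set.mem_ofPred_eq, e]
    exact hω
  -- Only residuals at finitely many points are constrained. Neither targets nor Lipschitz constants
  -- occur, so one event serves all `y` and `L`.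
  let B : Set (S ⊕ S → ℝ) := ⋂ k, {w | |w k| ≤ κ * √(beta X δ τ) * √(v k)}
  have hB : MeasurableSet B := MeasurableSet.iInter fun k =>
    measurableSet_le (by fun_prop) (by fun_prop)
  have hPE : 1 - 2 * δ ≤ P.real (W ⁻¹' B) := by
    have hcompl : P (W ⁻¹' B)ᶜ ≤ ENNReal.ofReal (2 * δ) := by
      have e : (W ⁻¹' B)ᶜ = ⋃ k, {ω | κ * √(beta X δ τ) * √(v k) < |W ω k|} := by
        ext ω
        simp only [B, Set.mem_compl_iff, Set.mem_preimage, Set.mem_iInter, Set.mem_iUnion,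
          Set.mem_ofPred_eq, not_forall, not_le]
      rw [e]
      refine (measure_iUnion_fintype_le _ _).trans ?_
      refine (Finset.sum_le_sum fun k _ => htailW k).trans ?_
      rw [Finset.sum_const, nsmul_eq_mul, ← ENNReal.ofReal_natCast,
        ← ENNReal.ofReal_mul (by positivity)]
      refine ENNReal.ofReal_le_ofReal ?_
      have hβδ := pow_mul_exp_neg_beta X hδ hτ
      refine le_trans ?_ (by rw [mul_assoc, hβδ] :
        2 * (1 + Metric.diam X / τ) ^ d * Real.exp (-(beta X δ τ / 2)) ≤ 2 * δ)
      refine mul_le_mul_of_nonneg_right ?_ (Real.exp_pos _).le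
      rw [Finset.card_univ, Fintype.card_sum, Fintype.card_coe]
      push_cast
      linarith
    have h2 : P.real (W ⁻¹' B)ᶜ ≤ 2 * δ := ENNReal.toReal_le_of_le_ofReal (by positivity) hcompl
    rw [probReal_compl_eq_one_sub (hW hB)] at h2
    linarith
  refine ⟨κ, hκ0, hκ1, W ⁻¹' B, hW hB, ?_, ?_⟩
  · filter_upwards [condProb_preimage_of_indepFun hW hYm hindep hB] with ω hω
    exact hPE.trans hω.ge
  · intro ω hω L hL hLf hLg x hx
    have hω' : ∀ k, |W ω k| ≤ κ * √(beta X δ τ) * √(v k) := fun k => Set.mem_iInter.1 hω k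
    obtain ⟨p, hp, hxp⟩ := hcov₀ x hx
    have hpX := hS₀X hp
    have hpS : (⟨p, hpX⟩ : X) ∈ S := Finset.mem_subtype.2 hp
    have e1 : f ω p - M.muf (M.targets f g noise ω) p = W ω (Sum.inl ⟨⟨p, hpX⟩, hpS⟩) := by
      simp only [W, Z, c, Y, Sum.elim_inl, Model.muf]; ring
    have e2 : g ω p - M.mug (M.targets f g noise ω) p = W ω (Sum.inr ⟨⟨p, hpX⟩, hpS⟩) := by
      simp only [W, Z, c, Y, Sum.elim_inr, Model.mug]; ring
    constructor
    · exact abs_sub_le_of_near hLf hL.muf hL.varf hκ0.le hκ1.le hβ.le hτ.le hx hpX hxp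
        (by rw [e1]; exact hω' _)
    · refine (abs_sub_le_of_near hLg hL.mug hL.varg hκ0.le hκ1.le hβ.le hτ.le hx hpX hxp
        (by rw [e2]; exact hω' _)).trans ?_
      unfold gammag Model.sigg
      gcongr
      exact mul_le_of_le_one_left (Real.sqrt_nonneg _) hκ1.le

/-! ### Scalar comparison lemmas -/

section Comparison

open Set

/-- A function that decreases with speed at least `c` as long as it is at least `ℓ` either
is at most `ℓ` at the end of an interval or has decreased all the time. -/
lemma le_max_of_deriv_le {φ φ' : ℝ → ℝ} {a b ℓ c : ℝ} (hab : a ≤ b) (hc : 0 < c)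
    (hφ : ContinuousOn φ (Icc a b))
    (hφ' : ∀ t ∈ Ico a b, HasDerivWithinAt φ (φ' t) (Ici t) t)
    (h : ∀ t ∈ Ico a b, ℓ ≤ φ t → φ' t ≤ -c) : φ b ≤ max ℓ (φ a - c * (b - a)) := by
  -- Once at or below `ℓ`, the function cannot cross `ℓ` upwards, as its derivative is negative
  -- there. Otherwise it stays above `ℓ` and the decay rate can be integrated over the whole
  -- interval.
  by_cases hs : ∃ s ∈ Icc a b, φ s ≤ ℓ
  · obtain ⟨s, hs, hsℓ⟩ := hs
    refine le_max_of_le_left ?_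
    refine image_le_of_deriv_right_lt_deriv_boundary (B := fun _ => ℓ) (B' := fun _ => 0)
      (hφ.mono (Icc_subset_Icc_left hs.1))
      (fun t ht => hφ' t ⟨hs.1.trans ht.1, ht.2⟩) hsℓ (fun _ => hasDerivAt_const _ _)
      (fun t ht hte => ?_) (right_mem_Icc.2 hs.2)
    have := h t ⟨hs.1.trans ht.1, ht.2⟩ hte.ge
    linarith
  · push Not at hs
    refine le_max_of_le_right ?_
    refine image_le_of_deriv_right_le_deriv_boundary (B := fun t => φ a - c * (t - a))
      (B' := fun _ => -c) hφ hφ' (by simp) (by fun_prop) (fun t _ => ?_)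
      (fun t ht => h t ht (hs t ⟨ht.1, ht.2.le⟩).le) (right_mem_Icc.2 hab)
    have := (((hasDerivAt_id t).sub_const a).const_mul c).const_sub (φ a)
    simpa using this.hasDerivWithinAt

/-- The response of a stable scalar linear system to a bounded input. -/
lemma norm_le_of_scalar_filter {κ D W B a b : ℝ} {s : ℂ} (hs : s.re < -κ) (hκ : 0 < κ)
    (hD : 0 ≤ D) (hW : 0 ≤ W) (hB : 0 ≤ B) {v u : ℝ → ℂ} (hv : ContinuousOn v (Icc a b))
    (hv' : ∀ t ∈ Ico a b, HasDerivWithinAt v (s * v t + u t) (Ici t) t) (hva : ‖v a‖ ≤ W)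
    (hu : ∀ t ∈ Icc a b, ‖u t‖ ≤ D * (W * Real.exp (-(κ * (t - a))) + B)) :
    ∀ t ∈ Icc a b, ‖v t‖ ≤
      (1 + D / (-s.re - κ)) * (W * Real.exp (-(κ * (t - a))) + B) := by
  set σ := -s.re with hσ
  have hσκ : 0 < σ - κ := by linarith
  set c := 1 + D / (σ - κ) with hc
  have hc1 : 1 ≤ c := le_add_of_nonneg_right (by positivity)
  have hcD : D ≤ c * (σ - κ) := by
    rw [hc, add_mul, div_mul_cancel₀ _ hσκ.ne']; linarith
  have hE : ∀ t : ℝ, HasDerivAt (fun t : ℝ => Complex.exp (-s * (t - a)))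
      (Complex.exp (-s * (t - a)) * (-s)) t := fun t => by
    have h1 : HasDerivAt (fun t : ℝ => -s * ((t : ℂ) - a)) (-s) t := by
      simpa using (((hasDerivAt_id t).ofReal_comp).sub_const (a : ℂ)).const_mul (-s)
    exact h1.cexp
  have hnE : ∀ t : ℝ, ‖Complex.exp (-s * (t - a))‖ = Real.exp (σ * (t - a)) := fun t => by
    rw [Complex.norm_exp]; simp [hσ]
  -- The integrating factor `exp (-s (t - a))` removes the term `s * v`. The comparison function
  -- starts high enough because `1 ≤ c` and grows fast enough because `D ≤ c (σ - κ) ≤ c σ`.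
  have key := image_norm_le_of_norm_deriv_right_le_deriv_boundary (a := a) (b := b)
    (f := fun t : ℝ => Complex.exp (-s * (t - a)) * v t)
    (f' := fun t : ℝ => Complex.exp (-s * (t - a)) * u t)
    (B := fun t => c * (W * Real.exp ((σ - κ) * (t - a)) + B * Real.exp (σ * (t - a))))
    (B' := fun t => c * (W * (Real.exp ((σ - κ) * (t - a)) * (σ - κ)) +
      B * (Real.exp (σ * (t - a)) * σ)))
    (ContinuousOn.mul (fun t _ => (hE t).continuousAt.continuousWithinAt) hv)
    (fun t ht => by
      have := (hE t).hasDerivWithinAt.mul (hv' t ht) (s := Ici t)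
      exact this.congr_deriv (by ring))
    (by
      simp only [sub_self, mul_zero, Complex.exp_zero, one_mul, Real.exp_zero, mul_one]
      nlinarith)
    (fun t => by
      have h1 : ∀ k : ℝ, HasDerivAt (fun t => Real.exp (k * (t - a)))
          (Real.exp (k * (t - a)) * k) t := fun k => by
        have : HasDerivAt (fun t => k * (t - a)) k t := by
          simpa using ((hasDerivAt_id t).sub_const a).const_mul k
        exact this.exp
      exact (((h1 (σ - κ)).const_mul W).add ((h1 σ).const_mul B)).const_mul c)
    (fun t ht => by
      rw [norm_mul, hnE]
      have hut := hu t ⟨ht.1, ht.2.le⟩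
      have e : Real.exp ((σ - κ) * (t - a)) =
          Real.exp (σ * (t - a)) * Real.exp (-(κ * (t - a))) := by
        rw [← Real.exp_add]; ring_nf
      rw [e]
      set E := Real.exp (σ * (t - a))
      set F := Real.exp (-(κ * (t - a)))
      have hE0 : 0 < E := Real.exp_pos _
      have hF0 : 0 < F := Real.exp_pos _
      calc E * ‖u t‖ ≤ E * (D * (W * F + B)) := by gcongr
        _ = D * (W * (E * F)) + D * (B * E) := by ring
        _ ≤ (c * (σ - κ)) * (W * (E * F)) + (c * σ) * (B * E) := by
            gcongr
            nlinarith
        _ = _ := by ring)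
  intro t ht
  have h := key ht
  rw [norm_mul, hnE] at h
  have e : Real.exp ((σ - κ) * (t - a)) =
      Real.exp (σ * (t - a)) * Real.exp (-(κ * (t - a))) := by
    rw [← Real.exp_add]; ring_nf
  rw [e] at h
  refine le_of_mul_le_mul_left (h.trans (le_of_eq ?_)) (Real.exp_pos (σ * (t - a)))
  ring

end Comparison

/-! ### Input-to-state stability of linear filters -/

section Filter

open Set Polynomial

/-- The polynomial differential operator `p` applied to a chain of derivatives `w`. -/
noncomputable def polyApply (p : ℂ[X]) (w : ℕ → ℂ) : ℂ := p.sum fun i c => c * w i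

lemma polyApply_add (p q : ℂ[X]) (w : ℕ → ℂ) :
    polyApply (p + q) w = polyApply p w + polyApply q w :=
  sum_add_index p q _ (by simp) (by intros; ring)

lemma polyApply_monomial (k : ℕ) (c : ℂ) (w : ℕ → ℂ) :
    polyApply (monomial k c) w = c * w k := sum_monomial_index _ _ (by simp)

/-- A root factor of the operator can be moved into the chain, which lowers the degree by one; this
drives the induction for the filter bound. -/
lemma polyApply_X_sub_C_mul (s : ℂ) (q : ℂ[X]) (w : ℕ → ℂ) :
    polyApply ((X - C s) * q) w = polyApply q fun i => w (i + 1) - s * w i := by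
  induction q using Polynomial.induction_on' with
  | add p q hp hq => rw [mul_add, polyApply_add, hp, hq, polyApply_add]
  | monomial k c =>
    have e : (X - C s) * monomial k c = monomial (k + 1) c + monomial k (-(s * c)) := by
      rw [sub_mul, X_mul_monomial, C_mul_monomial, sub_eq_add_neg, ← map_neg]
    rw [e, polyApply_add, polyApply_monomial, polyApply_monomial, polyApply_monomial]
    ring

/-- Input-to-state stability of a linear filter: if a stable polynomial differential operator maps
the first entry of a chain of derivatives to a small signal, the whole chain is small up to an
exponentially decaying contribution of the initial values. -/
lemma exists_filter_bound {κ : ℝ} (hκ : 0 < κ) : ∀ (m : ℕ) (p : ℂ[X]), p.Monic → p.natDegree = m →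
    (∀ z, p.IsRoot z → z.re < -κ) →
    ∃ C : ℝ, 0 ≤ C ∧ ∀ (a b : ℝ) (w : ℕ → ℝ → ℂ) (W B : ℝ), 0 ≤ W → 0 ≤ B →
      (∀ i < m, ContinuousOn (w i) (Icc a b)) →
      (∀ i < m, ∀ t ∈ Ico a b, HasDerivWithinAt (w i) (w (i + 1) t) (Ici t) t) →
      (∀ i < m, ‖w i a‖ ≤ W) →
      (∀ t ∈ Icc a b, ‖polyApply p fun i => w i t‖ ≤ W * Real.exp (-(κ * (t - a))) + B) →
      ∀ t ∈ Icc a b, ∀ i ≤ m, ‖w i t‖ ≤ C * (W * Real.exp (-(κ * (t - a))) + B) := by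
  intro m
  induction m with
  | zero =>
    intro p hp hdeg _
    refine ⟨1, zero_le_one, fun a b w W B _ _ _ _ _ h t ht i hi => ?_⟩
    obtain rfl : p = 1 := by
      rw [eq_C_of_natDegree_eq_zero hdeg]
      have := hp.coeff_natDegree
      rw [hdeg] at this
      rw [this, C_1]
    have := h t ht
    rw [← monomial_zero_one, polyApply_monomial] at this
    obtain rfl : i = 0 := by omega
    simpa using this
  | succ m ih =>
    intro p hp hdeg hroot
    -- Split off a root `s`. The induction hypothesis for the cofactor bounds the chain `u_i =
    -- w_{i+1} - s w_i`; then `w_0' = s w_0 + u_0` is a stable scalar equation, and the higher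
    -- entries are recovered algebraically.
    obtain ⟨s, hs⟩ := IsAlgClosed.exists_root p (by
      rw [degree_eq_natDegree hp.ne_zero, hdeg]; exact_mod_cast Nat.succ_ne_zero m)
    obtain ⟨q, rfl⟩ := dvd_iff_isRoot.2 hs
    have hqm : q.Monic := (monic_X_sub_C s).of_mul_monic_left hp
    have hqd : q.natDegree = m := by
      rw [(monic_X_sub_C s).natDegree_mul hqm, natDegree_X_sub_C] at hdeg
      omega
    obtain ⟨C, hC, hfil⟩ := ih q hqm hqd fun z hz => hroot z (by
      rw [IsRoot, eval_mul, hz.eq_zero, mul_zero])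
    have hsre := hroot s hs
    set D := C * (1 + ‖s‖) with hD
    have hD0 : 0 ≤ D := by positivity
    set C₀ := 1 + D / (-s.re - κ) with hC₀
    have hC₀0 : 0 ≤ C₀ := by
      have : 0 ≤ D / (-s.re - κ) := div_nonneg hD0 (by linarith)
      linarith
    refine ⟨(C₀ + D) * (1 + ‖s‖) ^ (m + 1), by positivity, ?_⟩
    intro a b w W B hW hB hcont hder hinit hbd t ht
    have hu : ∀ t ∈ Icc a b, ∀ i ≤ m, ‖w (i + 1) t - s * w i t‖ ≤
        D * (W * Real.exp (-(κ * (t - a))) + B) := by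
      intro t ht i hi
      have := hfil a b (fun i t => w (i + 1) t - s * w i t) ((1 + ‖s‖) * W) ((1 + ‖s‖) * B)
        (by positivity) (by positivity)
        (fun i hi => (hcont (i + 1) (by omega)).sub
          (continuousOn_const.mul (hcont i (by omega))))
        (fun i hi t ht => (hder (i + 1) (by omega) t ht).sub
          ((hder i (by omega) t ht).const_mul s))
        (fun i hi => by
          refine (norm_sub_le _ _).trans ?_
          rw [norm_mul, add_mul, one_mul]
          gcongr
          · exact hinit _ (by omega)
          · exact hinit _ (by omega))
        (fun t ht => by
          have h1 := hbd t ht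
          rw [polyApply_X_sub_C_mul] at h1
          refine h1.trans ?_
          have h2 : 0 ≤ W * Real.exp (-(κ * (t - a))) + B := by positivity
          nlinarith [norm_nonneg s, mul_nonneg (norm_nonneg s) h2])
        t ht i hi
      refine this.trans (le_of_eq ?_)
      rw [hD]; ring
    set Φ := W * Real.exp (-(κ * (t - a))) + B with hΦ
    have hΦ0 : 0 ≤ Φ := by positivity
    have h0 : ‖w 0 t‖ ≤ C₀ * Φ := by
      refine norm_le_of_scalar_filter (u := fun t => w 1 t - s * w 0 t) hsre hκ hD0 hW hB
        (hcont 0 (by omega)) (fun t ht => ?_) (hinit 0 (by omega)) (fun t ht => ?_) t ht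
      · simpa using hder 0 (by omega) t ht
      · simpa using hu t ht 0 (Nat.zero_le _)
    -- Each step `w_{i+1} = u_i + s w_i` costs a factor `1 + ‖s‖`, since the starting constant `C₀ +
    -- D` already dominates the bound `D` on `u_i`.
    have hi : ∀ i ≤ m + 1, ‖w i t‖ ≤ (C₀ + D) * (1 + ‖s‖) ^ i * Φ := by
      intro i
      induction i with
      | zero =>
        intro _
        rw [pow_zero, mul_one]
        exact h0.trans (by gcongr; linarith)
      | succ i ihi =>
        intro hi
        have h1 := hu t ht i (by omega)
        have h2 := ihi (by omega)
        have e : w (i + 1) t = (w (i + 1) t - s * w i t) + s * w i t := by ring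
        rw [e]
        refine (norm_add_le _ _).trans ?_
        rw [norm_mul]
        have h3 : (1 : ℝ) ≤ (1 + ‖s‖) ^ i := one_le_pow₀ (by linarith [norm_nonneg s])
        calc _ ≤ D * Φ + ‖s‖ * ((C₀ + D) * (1 + ‖s‖) ^ i * Φ) := by gcongr
          _ ≤ (C₀ + D) * (1 + ‖s‖) ^ i * Φ + ‖s‖ * ((C₀ + D) * (1 + ‖s‖) ^ i * Φ) := by
              gcongr
              nlinarith
          _ = _ := by ring
    intro i hi'
    refine (hi i hi').trans ?_
    gcongr
    · linarith [norm_nonneg s]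

end Filter

/-! ### Hurwitz polynomials: positive coefficients and stability -/

section Hurwitz

open Polynomial

/-- All coefficients up to the degree are positive. -/
def CoeffPos (p : ℝ[X]) : Prop := ∀ i ≤ p.natDegree, 0 < p.coeff i

lemma CoeffPos.coeff_nonneg {p : ℝ[X]} (hp : CoeffPos p) (i : ℕ) : 0 ≤ p.coeff i := by
  rcases le_or_gt i p.natDegree with h | h
  · exact (hp i h).le
  · rw [coeff_eq_zero_of_natDegree_lt h]

/-- All summands of a coefficient of the product are nonnegative, and up to the degree the pair that
takes as much as possible from `p` contributes a positive one. -/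
lemma CoeffPos.mul {p q : ℝ[X]} (hp : CoeffPos p) (hq : CoeffPos q) : CoeffPos (p * q) := by
  intro k hk
  have hk' := hk.trans natDegree_mul_le
  rw [coeff_mul]
  refine Finset.sum_pos' (fun x _ => mul_nonneg (hp.coeff_nonneg _) (hq.coeff_nonneg _)) ?_
  refine ⟨(min k p.natDegree, k - min k p.natDegree), ?_, ?_⟩
  · rw [Finset.HasAntidiagonal.mem_antidiagonal]; simp
  · exact mul_pos (hp _ (min_le_right _ _)) (hq _ (by simp only; omega))

/-- A monic real polynomial whose roots have negative real parts has positive coefficients. -/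
lemma coeffPos_of_roots : ∀ (m : ℕ) (p : ℝ[X]), p.Monic → p.natDegree = m →
    (∀ z : ℂ, aeval z p = 0 → z.re < 0) → CoeffPos p := by
  intro m
  induction m using Nat.strong_induction_on with
  | _ m ih =>
    intro p hp hdeg hroot
    rcases Nat.eq_zero_or_pos m with rfl | hm
    · intro i hi
      obtain rfl : i = 0 := by omega
      have := hp.coeff_natDegree
      rw [hdeg] at this
      rw [this]; exact one_pos
    · obtain ⟨z, hz⟩ := IsAlgClosed.exists_aeval_eq_zero ℂ p (by
        rw [degree_eq_natDegree hp.ne_zero, hdeg]; exact_mod_cast hm.ne')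
      have hzre := hroot z hz
      -- It suffices to split off one real factor with positive coefficients: `X - Re z` for a real
      -- root, `X² - 2 Re z X + ‖z‖²` for a conjugate pair. Both are positive because `Re z < 0`.
      have step : ∀ r : ℝ[X], r.Monic → 0 < r.natDegree → CoeffPos r → r ∣ p → CoeffPos p := by
        rintro r hr hrd hrc ⟨q, rfl⟩
        have hq : q.Monic := hr.of_mul_monic_left hp
        rw [hr.natDegree_mul hq] at hdeg
        exact hrc.mul (ih q.natDegree (by omega) q hq rfl fun z hz => hroot z (by
          rw [map_mul, hz, mul_zero]))
      by_cases him : z.im = 0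
      · have hzr : z = (z.re : ℂ) := by apply Complex.ext <;> simp [him]
        refine step (X - C z.re) (monic_X_sub_C _) (by simp) ?_ ?_
        · intro i hi
          rw [natDegree_X_sub_C] at hi
          interval_cases i <;> simp [hzre]
        · rw [dvd_iff_isRoot, IsRoot, ← Complex.ofReal_inj, Complex.ofReal_zero, ← hz]
          conv_rhs => rw [hzr]
          exact (aeval_algebraMap_apply ℂ z.re p).symm
      · have hn : 0 < ‖z‖ ^ 2 := by
          have : z ≠ 0 := fun h => him (by simp [h])
          positivity
        have hform : X ^ 2 - C (2 * z.re) * X + C (‖z‖ ^ 2) =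
            C (1 : ℝ) * X ^ 2 + C (-(2 * z.re)) * X + C (‖z‖ ^ 2) := by
          simp only [C_1, one_mul, map_neg]; ring
        have hd : (X ^ 2 - C (2 * z.re) * X + C (‖z‖ ^ 2)).natDegree = 2 := by
          rw [hform]; exact natDegree_quadratic one_ne_zero
        refine step (X ^ 2 - C (2 * z.re) * X + C (‖z‖ ^ 2)) ?_ (by omega) ?_
          (quadratic_dvd_of_aeval_eq_zero_im_ne_zero p hz him)
        · rw [Monic, hform]; exact leadingCoeff_quadratic one_ne_zero
        · intro i hi
          rw [hd] at hi
          rw [hform]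
          generalize ‖z‖ ^ 2 = N at hn
          interval_cases i
          · simpa using hn
          · simp
            linarith
          · simp

variable {n : ℕ} (lam : Fin n → ℝ)

/-- The polynomial `s^n + λ_n s^(n-1) + ⋯ + λ_2 s + λ_1`. -/
noncomputable def charPoly : ℝ[X] := X ^ n + ∑ i : Fin n, C (lam i) * X ^ (i : ℕ)

lemma charPoly_monic : (charPoly lam).Monic := monic_X_pow_add (degree_sum_fin_lt lam)

lemma charPoly_natDegree : (charPoly lam).natDegree = n := by
  rw [charPoly, natDegree_add_eq_left_of_degree_lt, natDegree_X_pow]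
  rw [degree_X_pow]
  exact degree_sum_fin_lt lam

lemma charPoly_coeff (i : Fin n) : (charPoly lam).coeff i = lam i := by
  rw [charPoly, coeff_add, coeff_X_pow, if_neg i.2.ne, zero_add, finsetSum_coeff,
    Finset.sum_eq_single i]
  · simp
  · intro j _ hj
    rw [coeff_C_mul, coeff_X_pow, if_neg (fun h => hj (Fin.ext h.symm)), mul_zero]
  · simp

lemma aeval_charPoly (z : ℂ) :
    aeval z (charPoly lam) = z ^ n + ∑ i : Fin n, (lam i : ℂ) * z ^ (i : ℕ) := by
  simp [charPoly]

variable {lam}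

lemma IsHurwitz.pos (h : IsHurwitz lam) (i : Fin n) : 0 < lam i := by
  have := coeffPos_of_roots n (charPoly lam) (charPoly_monic lam) (charPoly_natDegree lam)
    (fun z hz => h z (by rw [← aeval_charPoly, hz])) i (by rw [charPoly_natDegree]; exact i.2.le)
  rwa [charPoly_coeff] at this

lemma IsHurwitz.lamExt_pos (h : IsHurwitz lam) (i : Fin (n + 1)) : 0 < lamExt lam i := by
  induction i using Fin.lastCases with
  | last => simp [lamExt]
  | cast i => simpa [lamExt] using h.pos i

/-- Input-to-state stability of the filter `r = [λᵀ 1] e`. -/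
lemma IsHurwitz.exists_bound (h : IsHurwitz lam) :
    ∃ κ : ℝ, 0 < κ ∧ ∃ C : ℝ, 0 ≤ C ∧ ∀ (a b : ℝ) (e : ℝ → Fin (n + 1) → ℝ) (W B : ℝ),
      0 ≤ W → 0 ≤ B → (∀ i : Fin n, ContinuousOn (fun t => e t i.castSucc) (Set.Icc a b)) →
      (∀ i : Fin n, ∀ t ∈ Set.Ico a b,
        HasDerivWithinAt (fun t => e t i.castSucc) (e t i.succ) (Set.Ici t) t) →
      (∀ i, |e a i| ≤ W) →
      (∀ t ∈ Set.Icc a b, |lamExt lam ⬝ᵥ e t| ≤ W * Real.exp (-(κ * (t - a))) + B) →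
      ∀ t ∈ Set.Icc a b, ∀ i, |e t i| ≤ C * (W * Real.exp (-(κ * (t - a))) + B) := by
  set p := (charPoly lam).map (algebraMap ℝ ℂ) with hp
  have hpm : p.Monic := (charPoly_monic lam).map _
  have hpd : p.natDegree = n := by rw [hp, natDegree_map, charPoly_natDegree]
  have hroot : ∀ z, p.IsRoot z → z.re < 0 := fun z hz => h z (by
    rw [← aeval_charPoly, ← eval_map_algebraMap]; exact hz)
  -- There are finitely many roots, so half of the largest real part gives a uniform decay rate;
  -- without roots any rate will do.
  obtain ⟨κ, hκ, hκr⟩ : ∃ κ : ℝ, 0 < κ ∧ ∀ z, p.IsRoot z → z.re < -κ := by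
    rcases p.roots.toFinset.eq_empty_or_nonempty with h0 | h0
    · refine ⟨1, one_pos, fun z hz => ?_⟩
      have : z ∈ p.roots.toFinset := by simpa [hpm.ne_zero] using hz
      simp [h0] at this
    · obtain ⟨z₀, hz₀, hmax⟩ := p.roots.toFinset.exists_max_image Complex.re h0
      have h1 : z₀.re < 0 := hroot z₀ (by simpa [hpm.ne_zero] using hz₀)
      refine ⟨-z₀.re / 2, by linarith, fun z hz => ?_⟩
      have := hmax z (by simpa [hpm.ne_zero] using hz)
      linarith
  obtain ⟨C, hC, hfil⟩ := exists_filter_bound hκ n p hpm hpd hκr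
  refine ⟨κ, hκ, C, hC, fun a b e W B hW hB hcont hder hinit hbd t ht i => ?_⟩
  -- The default 0 is never seen: only indices up to `n` enter.
  let w : ℕ → ℝ → ℂ := fun i t => if hi : i < n + 1 then (e t ⟨i, hi⟩ : ℂ) else 0
  have hw : ∀ (i : Fin (n + 1)) t, w i t = (e t i : ℂ) := fun i t => by
    simp only [w, i.2, dif_pos]
  have hwn : ∀ i, (hi : i < n) → ∀ t, w i t = (e t (Fin.castSucc ⟨i, hi⟩) : ℂ) := fun i hi t =>
    hw (Fin.castSucc ⟨i, hi⟩) t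
  have hwn' : ∀ i, (hi : i < n) → ∀ t, w (i + 1) t = (e t (Fin.succ ⟨i, hi⟩) : ℂ) := fun i hi t =>
    hw (Fin.succ ⟨i, hi⟩) t
  have hpoly : ∀ t, polyApply p (fun i => w i t) = ((lamExt lam ⬝ᵥ e t : ℝ) : ℂ) := by
    intro t
    rw [polyApply, sum_over_range' _ (by simp) (n + 1) (by omega),
      Finset.sum_range (fun i => p.coeff i * w i t), dotProduct]
    push_cast
    refine Finset.sum_congr rfl fun i _ => ?_
    rw [hw, hp, coeff_map]
    congr 1
    induction i using Fin.lastCases with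
    | last =>
      have := (charPoly_monic lam).coeff_natDegree
      rw [charPoly_natDegree] at this
      simp [lamExt, this]
    | cast i => simp [lamExt, charPoly_coeff]
  have := hfil a b w W B hW hB
    (fun i hi => by
      have : w i = fun t => (e t (Fin.castSucc ⟨i, hi⟩) : ℂ) := funext fun t => hwn i hi t
      rw [this]
      exact Complex.continuous_ofReal.comp_continuousOn (hcont ⟨i, hi⟩))
    (fun i hi t ht => by
      have : w i = fun t => (e t (Fin.castSucc ⟨i, hi⟩) : ℂ) := funext fun t => hwn i hi t
      rw [this, hwn' i hi]
      exact (hder ⟨i, hi⟩ t ht).ofReal_comp)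
    (fun i hi => by rw [hwn i hi, Complex.norm_real]; exact hinit _)
    (fun t ht => by rw [hpoly, Complex.norm_real]; exact hbd t ht)
    t ht i (Nat.lt_succ_iff.1 i.2)
  rwa [hw, Complex.norm_real] at this

end Hurwitz

/-! ### Global solutions of bounded Lipschitz equations -/

section GlobalODE

open Set

variable {E : Type*} [NormedAddCommGroup E] [NormedSpace ℝ E] [CompleteSpace E]

/-- A bounded Lipschitz vector field has global forward solutions. -/
lemma exists_global_solution {F : ℝ → E → E} {K L : ℝ≥0} (hF : ∀ t, LipschitzWith K (F t))
    (hc : ∀ x, Continuous fun t => F t x) (hb : ∀ t x, ‖F t x‖ ≤ L) (x₀ : E) :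
    ∃ x : ℝ → E, x 0 = x₀ ∧ ∀ t, 0 ≤ t → HasDerivWithinAt x (F t (x t)) (Ici 0) t := by
  have hloc : ∀ m : ℕ, ∃ α : ℝ → E, α 0 = x₀ ∧
      ∀ t ∈ Icc (0 : ℝ) (m + 1), HasDerivWithinAt α (F t (α t)) (Icc 0 (m + 1)) t := by
    intro m
    -- The global bound `L` confines solutions on `[0, m + 1]` to the ball of radius `L (m + 1)`, so
    -- the time interval need not be small.
    have hpl : IsPicardLindelof F (tmin := 0) (tmax := m + 1) ⟨0, by constructor <;> positivity⟩ x₀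
        (L * (m + 1)) 0 L K :=
      { lipschitzOnWith := fun t _ => (hF t).lipschitzOnWith
        continuousOn := fun x _ => (hc x).continuousOn
        norm_le := fun t _ x _ => hb t x
        mul_max_le := by
          have : (0 : ℝ) ≤ m + 1 := by positivity
          simp [max_eq_left this] }
    exact hpl.exists_eq_forall_mem_Icc_hasDerivWithinAt₀
  choose α hα0 hα using hloc
  have hagree : ∀ (m k : ℕ) (t : ℝ), 0 ≤ t → t ≤ m + 1 → t ≤ k + 1 → α m t = α k t := by
    intro m k t ht htm htk
    have hR : ∀ (j : ℕ), t ≤ j + 1 → ContinuousOn (α j) (Icc 0 t) ∧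
        ∀ s ∈ Ico 0 t, HasDerivWithinAt (α j) (F s (α j s)) (Ici s) s := fun j hj => by
      refine ⟨fun s hs => ((hα j s ⟨hs.1, hs.2.trans hj⟩).continuousWithinAt).mono
        (Icc_subset_Icc_right hj), fun s hs => ?_⟩
      refine (hα j s ⟨hs.1, hs.2.le.trans hj⟩).mono_of_mem_nhdsWithin ?_
      exact Icc_mem_nhdsGE_of_mem ⟨hs.1, hs.2.trans_le hj⟩
    exact ODE_solution_unique hF (hR m htm).1 (hR m htm).2 (hR k htk).1 (hR k htk).2
      ((hα0 m).trans (hα0 k).symm) (right_mem_Icc.2 ht)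
  refine ⟨fun t => α ⌊t⌋₊ t, by simp [hα0], fun t ht => ?_⟩
  have hfl : ∀ s : ℝ, s ≤ ⌊s⌋₊ + 1 := fun s => (Nat.lt_floor_add_one s).le
  -- Near `t` the glued curve agrees with the piece of index `⌊t⌋₊ + 1`, whose interval extends
  -- beyond `t`; this avoids trouble at integer times.
  have heq : ∀ s : ℝ, 0 ≤ s → s ≤ (⌊t⌋₊ + 1 : ℕ) + 1 → α ⌊s⌋₊ s = α (⌊t⌋₊ + 1) s :=
    fun s hs hs' => hagree _ _ s hs (hfl s) hs'
  have htlt : t < (⌊t⌋₊ + 1 : ℕ) + 1 := by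
    have := Nat.lt_floor_add_one t
    push_cast
    linarith
  have h1 := hα (⌊t⌋₊ + 1) t ⟨ht, htlt.le⟩
  have h2 : HasDerivWithinAt (α (⌊t⌋₊ + 1)) (F t (α (⌊t⌋₊ + 1) t)) (Ici 0) t := by
    refine h1.mono_of_mem_nhdsWithin ?_
    filter_upwards [self_mem_nhdsWithin, nhdsWithin_le_nhds (Iio_mem_nhds htlt)] with s hs hs'
    exact ⟨hs, le_of_lt hs'⟩
  rw [← heq t ht htlt.le] at h2
  refine h2.congr_of_eventuallyEq ?_ (heq t ht htlt.le)
  filter_upwards [self_mem_nhdsWithin, nhdsWithin_le_nhds (Iio_mem_nhds htlt)] with s hs hs'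
  exact heq s hs (le_of_lt hs')

end GlobalODE

/-! ### The factor `η` -/

section Eta

variable {n : ℕ} {lam : Fin n → ℝ}

/-- Hurwitz coefficients are positive, so the quotients `k a / (k a + b)` lie below 1. Thus `α <
η(k₀)` keeps `α` away from 1. -/
lemma IsHurwitz.eta_lt_one (h : IsHurwitz lam) (hn : 1 ≤ n) {kc : ℝ} (hk : 0 < kc) :
    eta lam kc < 1 := by
  refine (ciInf_le (Set.finite_range _).bddBelow (⟨0, hn⟩ : Fin n)).trans_lt ?_
  have h1 := mul_pos hk (h.lamExt_pos (⟨0, hn⟩ : Fin n).succ)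
  have h2 := h.lamExt_pos (⟨0, hn⟩ : Fin n).castSucc
  rw [div_lt_one (by linarith)]
  linarith

/-- The quotients `k a / (k a + b)` increase with `k`, so feasibility at `k₀` persists for larger
gains. -/
lemma IsHurwitz.eta_mono (h : IsHurwitz lam) {k k' : ℝ} (hk : 0 < k) (hkk : k ≤ k') :
    eta lam k ≤ eta lam k' := by
  refine ciInf_mono (Set.finite_range _).bddBelow fun i => ?_
  have ha := h.lamExt_pos i.succ
  have hb := h.lamExt_pos i.castSucc
  have h1 := mul_pos hk ha
  have h2 := mul_pos (hk.trans_le hkk) ha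
  rw [div_le_div_iff₀ (by linarith) (by linarith)]
  have := mul_le_mul_of_nonneg_right hkk (mul_pos ha hb).le
  nlinarith

end Eta

/-! ### Closed-loop dynamics of the filtered error -/

section Loop

variable {n : ℕ}

lemma errSize_eq_abs_filtered (lam : Fin n → ℝ) (e : State (n + 1)) :
    errSize lam e = |filtered lam e| := by
  rw [errSize, Lam, Matrix.vecMulVec_mulVec, ← Real.sqrt_sq_eq_abs, filtered]
  congr 1
  simp only [dotProduct_smul, MulOpposite.smul_eq_mul_unop, MulOpposite.unop_op]
  rw [dotProduct_comm, sq]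

lemma filtered_eq (lam : Fin n → ℝ) (e : State (n + 1)) :
    filtered lam e = ∑ i : Fin n, lam i * e i.castSucc + e (Fin.last n) := by
  simp [filtered, dotProduct, Fin.sum_univ_castSucc, lamExt]

lemma norm_le_of_abs_le {e : State (n + 1)} {c : ℝ} (hc : 0 ≤ c) (h : ∀ i, |e i| ≤ c) :
    ‖e‖ ≤ (n + 1) * c := by
  rw [EuclideanSpace.norm_eq]
  refine Real.sqrt_le_iff.2 ⟨by positivity, ?_⟩
  calc ∑ i, ‖e i‖ ^ 2 ≤ ∑ _i : Fin (n + 1), c ^ 2 :=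
        Finset.sum_le_sum fun i _ => pow_le_pow_left₀ (norm_nonneg _) (h i) 2
    _ = (n + 1) * c ^ 2 := by simp
    _ ≤ ((n + 1) * c) ^ 2 := by
        have : (1 : ℝ) ≤ n + 1 := by linarith [n.cast_nonneg (α := ℝ)]
        rw [mul_pow]
        gcongr
        nlinarith

/-- The feedforward combination `λᵀ e_{2:d}` of the tracking error. -/
noncomputable def lead (lam : Fin n → ℝ) (xd : ℝ → ℝ) (t : ℝ) (x : State (n + 1)) : ℝ :=
  ∑ i : Fin n, lam i * (x - refState xd t).ofLp i.succ

/-- The certainty-equivalent linearizing feedback for the models `mf`, `mg` of `f`, `g`. -/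
noncomputable def feedback (mf mg : State (n + 1) → ℝ) (lam : Fin n → ℝ) (kc : ℝ) (xd : ℝ → ℝ)
    (t : ℝ) (x : State (n + 1)) : ℝ :=
  (mg x)⁻¹ * (nu lam kc xd t x - mf x)

/-- `x` solves the closed loop on `[a, b]` without leaving `X`. -/
structure IsSolOn (X : Set (State (n + 1))) (f g : State (n + 1) → ℝ)
    (π : ℝ → State (n + 1) → ℝ) (x : ℝ → State (n + 1)) (a b : ℝ) : Prop where
  mem : ∀ t ∈ Set.Icc a b, x t ∈ X
  cont : ∀ i, ContinuousOn (fun t => x t i) (Set.Icc a b)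
  chain : ∀ t ∈ Set.Ico a b, ∀ i : Fin n,
    HasDerivWithinAt (fun s => x s i.castSucc) (x t i.succ) (Set.Ici t) t
  last : ∀ t ∈ Set.Ico a b,
    HasDerivWithinAt (fun s => x s (Fin.last n)) (f (x t) + g (x t) * π t (x t)) (Set.Ici t) t

lemma IsTrajectory.isSolOn {X : Set (State (n + 1))} {f g : State (n + 1) → ℝ}
    {π : ℝ → State (n + 1) → ℝ} {x : ℝ → State (n + 1)} (h : IsTrajectory X f g π x) {a b : ℝ}
    (ha : 0 ≤ a) : IsSolOn X f g π x a b where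
  mem t ht := h.mem t (ha.trans ht.1)
  cont i := by
    have : ContinuousOn (fun t => x t i) (Set.Ici 0) := by
      intro t ht
      induction i using Fin.lastCases with
      | last => exact (h.last t ht).continuousWithinAt
      | cast i => exact (h.chain t ht i).continuousWithinAt
    exact this.mono fun t ht => ha.trans ht.1
  chain t ht i := (h.chain t (ha.trans ht.1) i).mono (Set.Ici_subset_Ici.2 (ha.trans ht.1))
  last t ht := (h.last t (ha.trans ht.1)).mono (Set.Ici_subset_Ici.2 (ha.trans ht.1))

variable {X : Set (State (n + 1))} {f g mf mg : State (n + 1) → ℝ} {lam : Fin n → ℝ} {kc : ℝ}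
  {xd : ℝ → ℝ} {x : ℝ → State (n + 1)} {a b : ℝ}

/-- The disturbance that acts on the filtered state. -/
noncomputable def disturbance (f g mf mg : State (n + 1) → ℝ) (lam : Fin n → ℝ) (kc : ℝ)
    (xd : ℝ → ℝ) (t : ℝ) (x : State (n + 1)) : ℝ :=
  (f x - mf x) + (g x - mg x) * ((mg x)⁻¹ * (nu lam kc xd t x - mf x))

lemma hasDerivAt_refState (hxd : ContDiff ℝ (n + 1 : ℕ) xd) (t : ℝ) (i : Fin (n + 1)) :
    HasDerivAt (fun s => refState (n := n) xd s i) (iteratedDeriv (i + 1) xd t) t := by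
  have h : DifferentiableAt ℝ (iteratedDeriv i xd) t :=
    (hxd.differentiable_iteratedDeriv i (by exact_mod_cast i.2)) t
  rw [iteratedDeriv_succ]
  exact h.hasDerivAt

lemma IsSolOn.hasDerivWithinAt_err (hxd : ContDiff ℝ (n + 1 : ℕ) xd)
    {π : ℝ → State (n + 1) → ℝ} (h : IsSolOn X f g π x a b) {t : ℝ} (ht : t ∈ Set.Ico a b)
    (i : Fin n) :
    HasDerivWithinAt (fun s => (x s - refState xd s).ofLp i.castSucc)
      ((x t - refState xd t).ofLp i.succ) (Set.Ici t) t :=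
  (h.chain t ht i).sub (hasDerivAt_refState hxd t i.castSucc).hasDerivWithinAt

lemma IsSolOn.continuousOn_err (hxd : ContDiff ℝ (n + 1 : ℕ) xd)
    {π : ℝ → State (n + 1) → ℝ} (h : IsSolOn X f g π x a b) (i : Fin (n + 1)) :
    ContinuousOn (fun s => (x s - refState xd s).ofLp i) (Set.Icc a b) :=
  (h.cont i).sub fun t _ => (hasDerivAt_refState hxd t i).continuousAt.continuousWithinAt

lemma IsSolOn.continuousOn_filtered (hxd : ContDiff ℝ (n + 1 : ℕ) xd)
    {π : ℝ → State (n + 1) → ℝ} (h : IsSolOn X f g π x a b) :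
    ContinuousOn (fun s => filtered lam (x s - refState xd s)) (Set.Icc a b) := by
  simp only [filtered_eq]
  exact (continuousOn_finsetSum _ fun i _ =>
    continuousOn_const.mul (h.continuousOn_err hxd i.castSucc)).add (h.continuousOn_err hxd _)

/-- The dynamics of the filtered state. -/
lemma IsSolOn.hasDerivWithinAt_filtered (hxd : ContDiff ℝ (n + 1 : ℕ) xd)
    (hmg : ∀ x ∈ X, mg x ≠ 0) (h : IsSolOn X f g (feedback mf mg lam kc xd) x a b) {t : ℝ}
    (ht : t ∈ Set.Ico a b) :
    HasDerivWithinAt (fun s => filtered lam (x s - refState xd s))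
      (-kc * filtered lam (x t - refState xd t) + disturbance f g mf mg lam kc xd t (x t))
      (Set.Ici t) t := by
  have h1 : HasDerivWithinAt
      (fun s => ∑ i : Fin n, lam i * (x s - refState xd s).ofLp i.castSucc +
        (x s (Fin.last n) - refState (n := n) xd s (Fin.last n)))
      (∑ i : Fin n, lam i * (x t - refState xd t).ofLp i.succ +
        ((f (x t) + g (x t) * feedback mf mg lam kc xd t (x t)) - iteratedDeriv (n + 1) xd t))
      (Set.Ici t) t :=
    (HasDerivWithinAt.fun_sum fun i _ => (h.hasDerivWithinAt_err hxd ht i).const_mul (lam i)).add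
      ((h.last t ht).sub (hasDerivAt_refState hxd t (Fin.last n)).hasDerivWithinAt)
  simp only [filtered_eq]
  refine h1.congr_deriv ?_
  -- Since `mg * π = ν - mf`, the plant acts as `f + g π = ν + disturbance`, and the other terms of
  -- `ν` cancel `λᵀ e_{2:d}` and `x_d^(d)`.
  have hne := hmg _ (h.mem t ⟨ht.1, ht.2.le⟩)
  rw [← filtered_eq, disturbance, feedback]
  have hnu : nu lam kc xd t (x t) = -kc * filtered lam (x t - refState xd t) -
    ∑ i : Fin n, lam i * (x t - refState xd t).ofLp i.succ + iteratedDeriv (n + 1) xd t := rfl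
  set S := ∑ i : Fin n, lam i * (x t - refState xd t).ofLp i.succ
  set v := nu lam kc xd t (x t)
  field_simp
  rw [hnu]
  ring

/-- The error of the model of `g` multiplies the input `(ν - mf) / mg`, so a relative error `α`
contributes `α |ν - mf|`. The part `lead` of `ν` is the one that the claimed error bound does not
contain. -/
lemma abs_disturbance_le {Φ s α : ℝ} {t : ℝ} {z : State (n + 1)} (hkc : 0 ≤ kc)
    (hmg : mg z ≠ 0) (hf : |f z - mf z| ≤ Φ - s) (hg : |g z - mg z| ≤ α * |mg z|) (hα : 0 ≤ α) :
    |disturbance f g mf mg lam kc xd t z| ≤ Φ - s +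
      α * (kc * |filtered lam (z - refState xd t)| + |lead lam xd t z| +
        |iteratedDeriv (n + 1) xd t - mf z|) := by
  have h1 : |nu lam kc xd t z - mf z| ≤ kc * |filtered lam (z - refState xd t)| +
      |lead lam xd t z| + |iteratedDeriv (n + 1) xd t - mf z| := by
    have e : nu lam kc xd t z - mf z = (-kc * filtered lam (z - refState xd t) -
        lead lam xd t z) + (iteratedDeriv (n + 1) xd t - mf z) := by
      rw [nu, lead]; ring
    rw [e]
    refine (abs_add_le _ _).trans (add_le_add_left ((abs_sub _ _).trans ?_) _)
    rw [abs_mul, abs_neg, abs_of_nonneg hkc]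
  have h2 : |(g z - mg z) * ((mg z)⁻¹ * (nu lam kc xd t z - mf z))| ≤
      α * |nu lam kc xd t z - mf z| := by
    rw [abs_mul, abs_mul, abs_inv, ← mul_assoc]
    refine mul_le_mul_of_nonneg_right ?_ (abs_nonneg _)
    rw [← div_eq_mul_inv, div_le_iff₀ (abs_pos.2 hmg)]
    exact hg
  refine (abs_add_le _ _).trans (add_le_add hf (h2.trans ?_))
  exact mul_le_mul_of_nonneg_left h1 hα

/-- Comparison for a stable scalar equation `r' = -k r + w` with a state-dependent bound on `w`. -/
lemma abs_le_max_of_disturbance {r w : ℝ → ℝ} {k ℓ c : ℝ} (hab : a ≤ b) (hc : 0 < c) (hℓ : 0 ≤ ℓ)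
    (hr : ContinuousOn r (Set.Icc a b))
    (hr' : ∀ t ∈ Set.Ico a b, HasDerivWithinAt r (-k * r t + w t) (Set.Ici t) t)
    (hw : ∀ t ∈ Set.Ico a b, ℓ ≤ |r t| → |w t| ≤ k * |r t| - c) :
    |r b| ≤ max ℓ (|r a| - c * (b - a)) := by
  refine abs_le'.2 ⟨?_, ?_⟩
  · refine (le_max_of_deriv_le hab hc hr hr' fun t ht hle => ?_).trans
      (max_le_max le_rfl (sub_le_sub_right (le_abs_self _) _))
    have h0 : |r t| = r t := abs_of_nonneg (hℓ.trans hle)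
    have := hw t ht (by rwa [h0])
    rw [h0] at this
    linarith [le_abs_self (w t)]
  · refine (le_max_of_deriv_le hab hc hr.neg (fun t ht => (hr' t ht).neg) fun t ht hle => ?_).trans
      (max_le_max le_rfl (sub_le_sub_right (neg_le_abs _) _))
    have hle : ℓ ≤ -r t := hle
    have h0 : |r t| = -r t := abs_of_nonpos (by linarith)
    have := hw t ht (by rwa [h0])
    rw [h0] at this
    linarith [neg_abs_le (w t)]

end Loop

/-! ### Ultimate bounds -/

section Ultimate

variable {n : ℕ}

/-- Uniform bounds for the closed loop that do not depend on the plant or the gain: `A` bounds the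
relative model error `α`, `B` bounds all other signals, and `s` is a margin in the bound `Φ` on the
error of the model of `f`. -/
structure LoopBounds (X : Set (State (n + 1))) (mf mg Φ α : State (n + 1) → ℝ) (lam : Fin n → ℝ)
    (xd : ℝ → ℝ) (s A B : ℝ) : Prop where
  s_pos : 0 < s
  A_lt_one : A < 1
  B_nonneg : 0 ≤ B
  alpha_nonneg : ∀ x ∈ X, 0 ≤ α x
  alpha_le : ∀ x ∈ X, α x ≤ A
  mg_ne : ∀ x ∈ X, mg x ≠ 0
  Phi_ge : ∀ x ∈ X, s ≤ Φ x
  state_le : ∀ x ∈ X, ∀ i, |x i| ≤ B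
  err_le : ∀ t, 0 ≤ t → ∀ x ∈ X, ∀ i, |(x - refState xd t).ofLp i| ≤ B
  deriv_le : ∀ t, 0 ≤ t → |iteratedDeriv (n + 1) xd t| ≤ B
  total_le : ∀ t, 0 ≤ t → ∀ x ∈ X,
    Φ x + |lead lam xd t x| + |iteratedDeriv (n + 1) xd t - mf x| ≤ B

/-- The errors of the models `mf`, `mg` of the plant `f`, `g`. -/
structure PlantBounds (X : Set (State (n + 1))) (f g mf mg Φ α : State (n + 1) → ℝ) (s : ℝ) :
    Prop where
  f_le : ∀ x ∈ X, |f x - mf x| ≤ Φ x - s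
  g_le : ∀ x ∈ X, |g x - mg x| ≤ α x * |mg x|

variable {X : Set (State (n + 1))} {f g mf mg Φ α : State (n + 1) → ℝ} {lam : Fin n → ℝ} {kc : ℝ}
  {xd : ℝ → ℝ} {x : ℝ → State (n + 1)} {a b s A B : ℝ}

/-- The scaled size that the filtered state eventually does not exceed. -/
noncomputable def scaledBound (A B : ℝ) : ℝ := (B + 1) / (1 - A)

lemma LoopBounds.scaledBound_pos (hL : LoopBounds X mf mg Φ α lam xd s A B) :
    0 < scaledBound A B :=
  div_pos (by linarith [hL.B_nonneg]) (by linarith [hL.A_lt_one])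

lemma LoopBounds.abs_disturbance_le (hL : LoopBounds X mf mg Φ α lam xd s A B)
    (hP : PlantBounds X f g mf mg Φ α s) (hkc : 0 < kc) {t : ℝ} {z : State (n + 1)}
    (hz : z ∈ X) :
    |disturbance f g mf mg lam kc xd t z| ≤ Φ z - s +
      α z * (kc * |filtered lam (z - refState xd t)| + |lead lam xd t z| +
        |iteratedDeriv (n + 1) xd t - mf z|) :=
  GPTracking.abs_disturbance_le hkc.le (hL.mg_ne z hz) (hP.f_le z hz) (hP.g_le z hz)
    (hL.alpha_nonneg z hz)

/-- Crude form for the transient: everything except the term in `kc |r|` goes into `B`. What matters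
is the coefficient `A < 1`, by which the feedback dominates. -/
lemma LoopBounds.abs_disturbance_le' (hL : LoopBounds X mf mg Φ α lam xd s A B)
    (hP : PlantBounds X f g mf mg Φ α s) (hkc : 0 < kc) {t : ℝ} (ht : 0 ≤ t) {z : State (n + 1)}
    (hz : z ∈ X) :
    |disturbance f g mf mg lam kc xd t z| ≤
      B + A * (kc * |filtered lam (z - refState xd t)|) := by
  have h1 := hL.abs_disturbance_le hP hkc (t := t) hz
  have h2 := hL.total_le t ht z hz
  have h3 := hL.alpha_le z hz
  have h4 := hL.alpha_nonneg z hz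
  have h5 := hL.s_pos
  have h6 := hL.A_lt_one
  have h7 : 0 ≤ kc * |filtered lam (z - refState xd t)| := by positivity
  have h8 := mul_le_mul_of_nonneg_right h3 h7
  have h9 : α z * (|lead lam xd t z| + |iteratedDeriv (n + 1) xd t - mf z|) ≤
      1 * (|lead lam xd t z| + |iteratedDeriv (n + 1) xd t - mf z|) :=
    mul_le_mul_of_nonneg_right (by linarith) (by positivity)
  linarith

/-- The filtered state decreases until it is of the order of `1 / kc`. -/
lemma LoopBounds.abs_filtered_le (hL : LoopBounds X mf mg Φ α lam xd s A B)
    (hP : PlantBounds X f g mf mg Φ α s) (hxd : ContDiff ℝ (n + 1 : ℕ) xd) (hkc : 0 < kc)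
    (ha : 0 ≤ a) (hab : a ≤ b) (h : IsSolOn X f g (feedback mf mg lam kc xd) x a b) :
    |filtered lam (x b - refState xd b)| ≤
      max (scaledBound A B / kc) (|filtered lam (x a - refState xd a)| - (b - a)) := by
  -- At or above this level `(1 - A) kc |r| ≥ B + 1`, so the disturbance falls short of `kc |r|` by
  -- at least 1.
  have key := abs_le_max_of_disturbance (c := 1) (k := kc) (ℓ := scaledBound A B / kc) hab one_pos
    (div_nonneg hL.scaledBound_pos.le hkc.le) (h.continuousOn_filtered hxd (lam := lam))
    (fun t ht => h.hasDerivWithinAt_filtered hxd hL.mg_ne ht) (fun t ht hle => by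
      have h1 := hL.abs_disturbance_le' hP hkc (ha.trans ht.1) (h.mem t ⟨ht.1, ht.2.le⟩)
      rw [div_le_iff₀ hkc, scaledBound, div_le_iff₀ (by linarith [hL.A_lt_one])] at hle
      linarith)
  rwa [one_mul] at key

/-- After a transient the filtered state is of the order of `1 / kc`, and so is the influence of
the rest of the tracking error on the disturbance. -/
lemma LoopBounds.exists_eventually (hL : LoopBounds X mf mg Φ α lam xd s A B)
    (hlam : IsHurwitz lam) (hxd : ContDiff ℝ (n + 1 : ℕ) xd) :
    ∃ K : ℝ, 0 < K ∧ ∀ f g : State (n + 1) → ℝ, PlantBounds X f g mf mg Φ α s →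
      ∀ kc, K ≤ kc → ∀ x, IsTrajectory X f g (feedback mf mg lam kc xd) x →
        ∀ᶠ t in atTop, |filtered lam (x t - refState xd t)| ≤ scaledBound A B / kc ∧
          |disturbance f g mf mg lam kc xd t (x t)| ≤ Φ (x t) - s / 2 +
            α (x t) * (kc * |filtered lam (x t - refState xd t)| +
              |iteratedDeriv (n + 1) xd t - mf (x t)|) := by
  obtain ⟨κ, hκ, C, hC, hfil⟩ := hlam.exists_bound
  set Q := scaledBound A B with hQ
  have hQ0 : 0 < Q := hL.scaledBound_pos
  have hs := hL.s_pos
  set Λ := ∑ i, |lam i| with hΛ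
  have hΛ0 : 0 ≤ Λ := Finset.sum_nonneg fun i _ => abs_nonneg _
  -- Eventually `|r| ≤ Q / kc`, and the filter turns this into components of size at most `2 C Q /
  -- kc`. The gain is chosen so that `|lead| ≤ 2 Λ C Q / kc ≤ s / 2`; the summand 1 keeps it
  -- positive.
  refine ⟨4 * Λ * C * Q / s + 1, by positivity, fun f g hP kc hk x hx => ?_⟩
  have hkc : 0 < kc := lt_of_lt_of_le (by positivity) hk
  have hsol : ∀ {a b : ℝ}, 0 ≤ a → IsSolOn X f g (feedback mf mg lam kc xd) x a b :=
    fun ha => hx.isSolOn ha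
  -- Decrease at unit rate ends the transient within this time.
  set T := |filtered lam (x 0 - refState xd 0)| with hT
  have hT0 : 0 ≤ T := abs_nonneg _
  have hr : ∀ t, T ≤ t → |filtered lam (x t - refState xd t)| ≤ Q / kc := by
    intro t ht
    refine (hL.abs_filtered_le hP hxd hkc le_rfl (hT0.trans ht) (hsol le_rfl)).trans
      (max_le le_rfl ?_)
    have : 0 ≤ Q / kc := by positivity
    linarith
  have hlim : Tendsto (fun t => B * Real.exp (-(κ * (t - T)))) atTop (𝓝 0) := by
    have h1 : Tendsto (fun t : ℝ => κ * (t - T)) atTop atTop :=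
      (tendsto_atTop_add_const_right _ _ tendsto_id).const_mul_atTop hκ
    simpa using (Real.tendsto_exp_neg_atTop_nhds_zero.comp h1).const_mul B
  filter_upwards [eventually_ge_atTop T, hlim.eventually (gt_mem_nhds (div_pos hQ0 hkc))]
    with t ht hexp
  have ht0 := hT0.trans ht
  refine ⟨hr t ht, ?_⟩
  have he := hfil T t (fun t => (x t - refState xd t).ofLp) B (Q / kc) hL.B_nonneg (by positivity)
    (fun i => (hsol hT0).continuousOn_err hxd i.castSucc)
    (fun i t ht => (hsol hT0).hasDerivWithinAt_err hxd ht i)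
    (fun i => hL.err_le T hT0 _ (hx.mem T hT0) i)
    (fun t ht => by
      have h1 : |filtered lam (x t - refState xd t)| ≤ Q / kc := hr t ht.1
      exact h1.trans (le_add_of_nonneg_left (mul_nonneg hL.B_nonneg (Real.exp_pos _).le)))
    t ⟨ht, le_rfl⟩
  have hz := hx.mem t ht0
  have hlead : |lead lam xd t (x t)| ≤ s / 2 := by
    calc |lead lam xd t (x t)| ≤ ∑ i : Fin n, |lam i| * (C * (Q / kc + Q / kc)) := by
          refine (Finset.abs_sum_le_sum_abs _ _).trans (Finset.sum_le_sum fun i _ => ?_)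
          rw [abs_mul]
          gcongr
          exact (he i.succ).trans (by gcongr)
      _ = 2 * Λ * C * Q / kc := by rw [← Finset.sum_mul]; ring
      _ ≤ s / 2 := by
          rw [div_le_iff₀ hkc]
          have : 4 * Λ * C * Q / s ≤ kc := by linarith
          rw [div_le_iff₀ hs] at this
          linarith
  have h1 := hL.abs_disturbance_le hP hkc (t := t) hz
  have h2 : α (x t) * |lead lam xd t (x t)| ≤ 1 * (s / 2) :=
    mul_le_mul ((hL.alpha_le _ hz).trans hL.A_lt_one.le) hlead (abs_nonneg _) zero_le_one
  linarith

/-- The bound `(Φ + α c) / (1 - α)` on the scaled filtered state. -/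
noncomputable def scaledErrBound (mf Φ α : State (n + 1) → ℝ) (xd : ℝ → ℝ) (t : ℝ)
    (z : State (n + 1)) : ℝ :=
  (Φ z + α z * |iteratedDeriv (n + 1) xd t - mf z|) / (1 - α z)

lemma LoopBounds.one_sub_alpha_pos (hL : LoopBounds X mf mg Φ α lam xd s A B) {z : State (n + 1)}
    (hz : z ∈ X) : 0 < 1 - α z := by linarith [hL.alpha_le z hz, hL.A_lt_one]

lemma LoopBounds.scaledErrBound_nonneg (hL : LoopBounds X mf mg Φ α lam xd s A B) {t : ℝ}
    {z : State (n + 1)} (hz : z ∈ X) : 0 ≤ scaledErrBound mf Φ α xd t z := by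
  have h1 := hL.alpha_nonneg z hz
  have h2 := hL.Phi_ge z hz
  have h3 := hL.s_pos
  exact div_nonneg (add_nonneg (h3.le.trans h2) (mul_nonneg h1 (abs_nonneg _)))
    (hL.one_sub_alpha_pos hz).le

/-- An ultimate bound on the bound is an ultimate bound on the filtered state. -/
lemma LoopBounds.exists_gain_of_le (hL : LoopBounds X mf mg Φ α lam xd s A B)
    (hlam : IsHurwitz lam) (hxd : ContDiff ℝ (n + 1 : ℕ) xd) :
    ∃ K : ℝ, 0 < K ∧ ∀ f g : State (n + 1) → ℝ, PlantBounds X f g mf mg Φ α s →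
      ∀ kc, K ≤ kc → ∀ x, IsTrajectory X f g (feedback mf mg lam kc xd) x →
        ∀ b, (∀ᶠ t in atTop, scaledErrBound mf Φ α xd t (x t) ≤ kc * b) →
          ∀ᶠ t in atTop, |filtered lam (x t - refState xd t)| ≤ b := by
  obtain ⟨K, hK, hev⟩ := hL.exists_eventually hlam hxd
  refine ⟨K, hK, fun f g hP kc hk x hx b hb => ?_⟩
  have hkc := hK.trans_le hk
  have hs := hL.s_pos
  obtain ⟨T, hT⟩ := eventually_atTop.1 ((hev f g hP kc hk x hx).and
    (hb.and (eventually_ge_atTop (0 : ℝ))))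
  have hT0 : 0 ≤ T := (hT T le_rfl).2.2
  have hb0 : 0 ≤ b := by
    have h1 := (hT T le_rfl).2.1
    have h2 := hL.scaledErrBound_nonneg (t := T) (hx.mem T hT0)
    exact nonneg_of_mul_nonneg_right (h2.trans h1) hkc
  set R := |filtered lam (x T - refState xd T)| with hR
  have hR0 : 0 ≤ R := abs_nonneg _
  filter_upwards [eventually_ge_atTop (T + R / (s / 2))] with t ht
  have hTt : T ≤ t := by
    have : 0 ≤ R / (s / 2) := by positivity
    linarith
  have hsol := hx.isSolOn (b := t) hT0
  -- If `|r| ≥ b`, then `Φ + α c ≤ (1 - α) kc |r|`, so `|w| ≤ kc |r| - s / 2`. The level `b` is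
  -- reached within time `R / (s / 2)`.
  have key := abs_le_max_of_disturbance (c := s / 2) (k := kc) (ℓ := b) hTt (by positivity) hb0
    (hsol.continuousOn_filtered hxd (lam := lam))
    (fun t ht => hsol.hasDerivWithinAt_filtered hxd hL.mg_ne ht) (fun t ht hle => by
      obtain ⟨⟨-, h1⟩, h2, h3⟩ := hT t ht.1
      have hz := hx.mem t h3
      have h4 := hL.one_sub_alpha_pos hz
      rw [scaledErrBound, div_le_iff₀ h4] at h2
      have h5 := mul_le_mul_of_nonneg_right (mul_le_mul_of_nonneg_left hle hkc.le) h4.le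
      linarith)
  refine key.trans (max_le le_rfl ?_)
  have : R / (s / 2) ≤ t - T := by linarith
  rw [div_le_iff₀ (by positivity)] at this
  linarith

/-- The last state derivative in the closed loop. -/
lemma closedLoop_eq {z : State (n + 1)} {t : ℝ} (hmg : mg z ≠ 0) :
    f z + g z * feedback mf mg lam kc xd t z =
      -kc * filtered lam (z - refState xd t) + disturbance f g mf mg lam kc xd t z -
        lead lam xd t z + iteratedDeriv (n + 1) xd t := by
  rw [disturbance, feedback]
  have hnu : nu lam kc xd t z = -kc * filtered lam (z - refState xd t) -
    lead lam xd t z + iteratedDeriv (n + 1) xd t := rfl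
  set v := nu lam kc xd t z
  field_simp
  rw [hnu]
  ring

/-- After the transient, trajectories are Lipschitz in time, uniformly in the plant and the gain. -/
lemma LoopBounds.dist_le (hL : LoopBounds X mf mg Φ α lam xd s A B)
    (hP : PlantBounds X f g mf mg Φ α s) (hkc : 0 < kc) (ha : 0 ≤ a)
    (hab : a ≤ b) (h : IsSolOn X f g (feedback mf mg lam kc xd) x a b)
    (hr : ∀ t ∈ Set.Icc a b, |filtered lam (x t - refState xd t)| ≤ scaledBound A B / kc) :
    dist (x b) (x a) ≤ (n + 1) * (2 * scaledBound A B + 3 * B) * (b - a) := by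
  set Q := scaledBound A B with hQ
  have hQ0 : 0 < Q := hL.scaledBound_pos
  have hB := hL.B_nonneg
  rw [dist_eq_norm, mul_assoc]
  refine norm_le_of_abs_le (mul_nonneg (by positivity) (sub_nonneg.2 hab)) fun i => ?_
  induction i using Fin.lastCases with
  | cast i =>
    refine norm_image_sub_le_of_norm_deriv_right_le_segment (f := fun t => x t i.castSucc)
      (f' := fun t => x t i.succ) (h.cont _) (fun t ht => h.chain t ht i) (fun t ht => ?_) b
      ⟨hab, le_rfl⟩
    have := hL.state_le _ (h.mem t ⟨ht.1, ht.2.le⟩) i.succ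
    rw [Real.norm_eq_abs]
    linarith
  | last =>
    refine norm_image_sub_le_of_norm_deriv_right_le_segment (f := fun t => x t (Fin.last n))
      (f' := fun t => f (x t) + g (x t) * feedback mf mg lam kc xd t (x t)) (h.cont _)
      (fun t ht => h.last t ht) (fun t ht => ?_) b ⟨hab, le_rfl⟩
    have ht0 := ha.trans ht.1
    have hz := h.mem t ⟨ht.1, ht.2.le⟩
    -- In this form the gain appears only through `kc * r`, which is at most `Q` after the
    -- transient; so the speed bound is free of `kc`.
    rw [closedLoop_eq (hL.mg_ne _ hz), Real.norm_eq_abs]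
    have h1 := hL.abs_disturbance_le' hP hkc ht0 hz
    have h2 := hr t ⟨ht.1, ht.2.le⟩
    rw [le_div_iff₀ hkc] at h2
    have h3 := hL.total_le t ht0 _ hz
    have h4 := hL.deriv_le t ht0
    have h5 : s ≤ Φ (x t) := hL.Phi_ge _ hz
    have h6 := hL.s_pos
    have h7 : A * (kc * |filtered lam (x t - refState xd t)|) ≤ 1 * Q :=
      mul_le_mul hL.A_lt_one.le (by linarith) (by positivity) zero_le_one
    have h8 : |-kc * filtered lam (x t - refState xd t)| ≤ Q := by
      rw [abs_mul, abs_neg, abs_of_pos hkc]; linarith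
    have h9 := abs_nonneg (iteratedDeriv (n + 1) xd t - mf (x t))
    refine (abs_add_le _ _).trans ?_
    have := (abs_sub (-kc * filtered lam (x t - refState xd t) +
      disturbance f g mf mg lam kc xd t (x t)) (lead lam xd t (x t)))
    have := abs_add_le (-kc * filtered lam (x t - refState xd t))
      (disturbance f g mf mg lam kc xd t (x t))
    linarith

/-- The scaled bound varies slowly along Lipschitz curves. -/
lemma LoopBounds.exists_modulus (hL : LoopBounds X mf mg Φ α lam xd s A B) (hX : IsCompact X)
    (hmf : ContinuousOn mf X) (hΦ : ContinuousOn Φ X) (hα : ContinuousOn α X)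
    (huc : UniformContinuousOn (iteratedDeriv (n + 1) xd) (Set.Ici 0)) (V : ℝ) {ε : ℝ}
    (hε : 0 < ε) :
    ∃ h : ℝ, 0 < h ∧ ∀ t t' : ℝ, 0 ≤ t → 0 ≤ t' → |t - t'| ≤ h → ∀ z ∈ X, ∀ z' ∈ X,
      dist z z' ≤ V * |t - t'| →
        |scaledErrBound mf Φ α xd t z - scaledErrBound mf Φ α xd t' z'| ≤ ε := by
  -- Time enters only through the value of `x_d^(d)`. As a function of the state and this value the
  -- bound is continuous on a compact set, hence uniformly continuous.
  let G : State (n + 1) × ℝ → ℝ := fun q => (Φ q.1 + α q.1 * |q.2 - mf q.1|) / (1 - α q.1)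
  have hfst : Set.MapsTo Prod.fst (X ×ˢ Set.Icc (-B) B) X := fun q hq => hq.1
  have hG : ContinuousOn G (X ×ˢ Set.Icc (-B) B) := by
    have h1 := hΦ.comp continuousOn_fst hfst
    have h2 := hα.comp continuousOn_fst hfst
    have h3 := hmf.comp continuousOn_fst hfst
    exact (h1.add (h2.mul (continuousOn_snd.sub h3).abs)).div (continuousOn_const.sub h2)
      fun q hq => (hL.one_sub_alpha_pos hq.1).ne'
  have hGu := (hX.prod isCompact_Icc).uniformContinuousOn_of_continuous hG
  obtain ⟨η, hη, hGη⟩ := Metric.uniformContinuousOn_iff.1 hGu ε hε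
  obtain ⟨h₁, hh₁, hd⟩ := Metric.uniformContinuousOn_iff.1 huc η hη
  refine ⟨min (h₁ / 2) (η / (2 * (|V| + 1))), by positivity,
    fun t t' ht ht' htt z hz z' hz' hzz => ?_⟩
  have hd' := hd t ht t' ht' (by
    rw [Real.dist_eq]
    have := htt.trans (min_le_left _ _)
    linarith)
  have hzd : dist z z' < η := by
    have h1 := htt.trans (min_le_right _ _)
    rw [le_div_iff₀ (by positivity)] at h1
    have h2 : V * |t - t'| ≤ |V| * |t - t'| :=
      mul_le_mul_of_nonneg_right (le_abs_self V) (abs_nonneg _)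
    have h3 := abs_nonneg (t - t')
    have h4 := abs_nonneg V
    nlinarith
  have := hGη (z, iteratedDeriv (n + 1) xd t) ⟨hz, abs_le.1 (hL.deriv_le t ht)⟩
    (z', iteratedDeriv (n + 1) xd t') ⟨hz', abs_le.1 (hL.deriv_le t' ht')⟩
    (max_lt hzd hd')
  rw [Real.dist_eq] at this
  exact this.le

/-- The filtered state ultimately respects the time-varying bound. -/
lemma LoopBounds.exists_gain_of_uniformContinuous (hL : LoopBounds X mf mg Φ α lam xd s A B)
    (hlam : IsHurwitz lam) (hxd : ContDiff ℝ (n + 1 : ℕ) xd) (hX : IsCompact X)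
    (hmf : ContinuousOn mf X) (hΦ : ContinuousOn Φ X) (hα : ContinuousOn α X)
    (huc : UniformContinuousOn (iteratedDeriv (n + 1) xd) (Set.Ici 0)) :
    ∃ K : ℝ, 0 < K ∧ ∀ f g : State (n + 1) → ℝ, PlantBounds X f g mf mg Φ α s →
      ∀ kc, K ≤ kc → ∀ x, IsTrajectory X f g (feedback mf mg lam kc xd) x →
        ∀ᶠ t in atTop, kc * |filtered lam (x t - refState xd t)| ≤
          scaledErrBound mf Φ α xd t (x t) := by
  obtain ⟨K, hK, hev⟩ := hL.exists_eventually hlam hxd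
  have hs := hL.s_pos
  set Q := scaledBound A B with hQ
  have hQ0 : 0 < Q := hL.scaledBound_pos
  obtain ⟨h, hh, hmod⟩ := hL.exists_modulus hX hmf hΦ hα huc
    ((n + 1) * (2 * Q + 3 * B)) (show 0 < s / 4 by positivity)
  -- The window length `h` does not depend on the gain. At the start of a window `|r| ≤ Q / kc ≤ s h
  -- / 4`, so decrease at rate `s / 4` uses this up within the window.
  refine ⟨max K (4 * Q / (s * h)), lt_max_of_lt_left hK, fun f g hP kc hk x hx => ?_⟩
  have hkK := (le_max_left _ _).trans hk
  have hkh := (le_max_right _ _).trans hk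
  have hkc := hK.trans_le hkK
  obtain ⟨T, hT⟩ := eventually_atTop.1 ((hev f g hP kc hkK x hx).and
    (eventually_ge_atTop (0 : ℝ)))
  have hT0 : 0 ≤ T := (hT T le_rfl).2
  filter_upwards [eventually_ge_atTop (T + h)] with t ht
  have hth : T ≤ t - h := by linarith
  have hth0 := hT0.trans hth
  have ht0 : 0 ≤ t := by linarith
  have hzt := hx.mem t ht0
  have hsol := hx.isSolOn (b := t) hth0
  set p := scaledErrBound mf Φ α xd t (x t) with hp
  have hp0 : 0 ≤ p := hL.scaledErrBound_nonneg hzt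
  -- The level is frozen at its value at the end `t` of the window. Within the window the scaled
  -- bound exceeds `p` by at most `s / 4`, which leaves the rate `s / 4` of the remaining margin `s
  -- / 2`.
  have key := abs_le_max_of_disturbance (c := s / 4) (k := kc) (ℓ := p / kc)
    (show t - h ≤ t by linarith) (by positivity) (by positivity)
    (hsol.continuousOn_filtered hxd (lam := lam))
    (fun t ht => hsol.hasDerivWithinAt_filtered hxd hL.mg_ne ht) (fun t' ht' hle => by
      have hTt' : T ≤ t' := hth.trans ht'.1
      obtain ⟨⟨-, h1⟩, h3⟩ := hT t' hTt'
      have hz := hx.mem t' h3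
      have h4 := hL.one_sub_alpha_pos hz
      have h5 := hL.alpha_nonneg _ hz
      rw [div_le_iff₀ hkc] at hle
      have habs : |t - t'| = t - t' := abs_of_nonneg (by linarith [ht'.2])
      have hdist := hL.dist_le hP hkc h3 ht'.2.le (hx.isSolOn h3)
        (fun u hu => (hT u (hTt'.trans hu.1)).1.1)
      have h6 := hmod t t' ht0 h3 (by rw [habs]; linarith [ht'.1]) _ hzt _ hz (by
        rw [habs]; exact hdist)
      have h7 : scaledErrBound mf Φ α xd t' (x t') ≤ p + s / 4 := by
        linarith [(abs_le.1 h6).1]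
      rw [scaledErrBound, div_le_iff₀ h4] at h7
      have h8 := mul_le_mul_of_nonneg_right hle h4.le
      have h9 : (s / 4) * (1 - α (x t')) ≤ (s / 4) * 1 :=
        mul_le_mul_of_nonneg_left (by linarith) (by positivity)
      linarith)
  have h2 : |filtered lam (x (t - h) - refState xd (t - h))| - s / 4 * (t - (t - h)) ≤ p / kc := by
    have h1 := (hT (t - h) hth).1.1
    have h3 : Q / kc ≤ s / 4 * h := by
      rw [div_le_iff₀ hkc]
      rw [div_le_iff₀ (by positivity)] at hkh
      linarith
    have h4 : 0 ≤ p / kc := by positivity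
    linarith
  have h3 := key.trans (max_le le_rfl h2)
  rw [le_div_iff₀ hkc] at h3
  linarith

end Ultimate

/-! ### Calculus of bounded Lipschitz functions -/

section BoundedLipschitz

variable {α : Type*} [PseudoMetricSpace α] {X : Set α} {h h' : α → ℝ}

/-- `h` is bounded and Lipschitz continuous on `X`. -/
def BoundedLipschitzOn (X : Set α) (h : α → ℝ) : Prop :=
  (∃ C, 0 ≤ C ∧ ∀ x ∈ X, |h x| ≤ C) ∧
    ∃ K, 0 ≤ K ∧ ∀ x ∈ X, ∀ x' ∈ X, |h x - h x'| ≤ K * dist x x'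

lemma BoundedLipschitzOn.add (hh : BoundedLipschitzOn X h) (hh' : BoundedLipschitzOn X h') :
    BoundedLipschitzOn X fun x => h x + h' x := by
  obtain ⟨⟨C, hC, hb⟩, K, hK, hl⟩ := hh
  obtain ⟨⟨C', hC', hb'⟩, K', hK', hl'⟩ := hh'
  refine ⟨⟨C + C', by positivity, fun x hx =>
    (abs_add_le _ _).trans (add_le_add (hb x hx) (hb' x hx))⟩, K + K', by positivity,
    fun x hx x' hx' => ?_⟩
  rw [add_sub_add_comm, add_mul]
  exact (abs_add_le _ _).trans (add_le_add (hl x hx x' hx') (hl' x hx x' hx'))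

/-- Boundedness is carried along because products of Lipschitz functions are Lipschitz only with it.
-/
lemma BoundedLipschitzOn.mul (hh : BoundedLipschitzOn X h) (hh' : BoundedLipschitzOn X h') :
    BoundedLipschitzOn X fun x => h x * h' x := by
  obtain ⟨⟨C, hC, hb⟩, K, hK, hl⟩ := hh
  obtain ⟨⟨C', hC', hb'⟩, K', hK', hl'⟩ := hh'
  refine ⟨⟨C * C', by positivity, fun x hx => ?_⟩, K * C' + C * K', by positivity,
    fun x hx x' hx' => ?_⟩
  · rw [abs_mul]
    exact mul_le_mul (hb x hx) (hb' x hx) (abs_nonneg _) hC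
  · have e : h x * h' x - h x' * h' x' = (h x - h x') * h' x + h x' * (h' x - h' x') := by ring
    rw [e]
    refine (abs_add_le _ _).trans ?_
    rw [abs_mul, abs_mul]
    have hd : 0 ≤ dist x x' := dist_nonneg
    have h1 := mul_le_mul (hl x hx x' hx') (hb' x hx) (abs_nonneg _) (by positivity)
    have h2 := mul_le_mul (hb x' hx') (hl' x hx x' hx') (abs_nonneg _) hC
    linarith

lemma BoundedLipschitzOn.const (c : ℝ) : BoundedLipschitzOn X fun _ => c :=
  ⟨⟨|c|, abs_nonneg _, fun _ _ => le_rfl⟩, 0, le_rfl, fun _ _ _ _ => by simp⟩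

lemma BoundedLipschitzOn.sum {ι : Type*} (s : Finset ι) {h : ι → α → ℝ}
    (hh : ∀ i, BoundedLipschitzOn X (h i)) : BoundedLipschitzOn X fun x => ∑ i ∈ s, h i x := by
  classical
  induction s using Finset.induction_on with
  | empty => simpa using BoundedLipschitzOn.const 0
  | insert i s hi ih => simpa only [Finset.sum_insert hi] using (hh i).add ih

lemma BoundedLipschitzOn.of_lipschitzOnWith (hX : IsCompact X) {K : ℝ≥0}
    (hh : LipschitzOnWith K h X) : BoundedLipschitzOn X h := by
  obtain ⟨C, hC⟩ := hX.exists_bound_of_continuousOn hh.continuousOn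
  exact ⟨⟨|C|, abs_nonneg _, fun x hx => (hC x hx).trans (le_abs_self _)⟩, K, K.2,
    fun x hx x' hx' => hh.dist_le_mul x hx x' hx'⟩

lemma BoundedLipschitzOn.inv (hX : IsCompact X) {K : ℝ≥0} (hh : LipschitzOnWith K h X)
    (h0 : ∀ x ∈ X, h x ≠ 0) : BoundedLipschitzOn X fun x => (h x)⁻¹ := by
  obtain ⟨C, hC⟩ := hX.exists_bound_of_continuousOn (hh.continuousOn.inv₀ h0)
  have hb : ∀ x ∈ X, |(h x)⁻¹| ≤ |C| := fun x hx => (hC x hx).trans (le_abs_self _)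
  refine ⟨⟨|C|, abs_nonneg _, hb⟩, |C| * |C| * K, by positivity, fun x hx x' hx' => ?_⟩
  have hd : 0 ≤ dist x x' := dist_nonneg
  have e : (h x)⁻¹ - (h x')⁻¹ = ((h x)⁻¹ * (h x')⁻¹) * (h x' - h x) := by
    field_simp [h0 x hx, h0 x' hx']
  have h1 : |h x' - h x| ≤ K * dist x x' := by
    rw [dist_comm]; exact hh.dist_le_mul x' hx' x hx
  rw [e, abs_mul, abs_mul, mul_assoc _ (K : ℝ)]
  exact mul_le_mul (mul_le_mul (hb x hx) (hb x' hx') (abs_nonneg _) (abs_nonneg _)) h1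
    (abs_nonneg _) (by positivity)

/-- Extend with the same Lipschitz constant and truncate to `[-C, C]`; truncation keeps the constant
and does not alter the values on `X`. -/
lemma BoundedLipschitzOn.exists_extension (hh : BoundedLipschitzOn X h) :
    ∃ h' : α → ℝ, BoundedLipschitzOn Set.univ h' ∧ Set.EqOn h' h X := by
  obtain ⟨⟨C, hC, hb⟩, K, hK, hl⟩ := hh
  obtain ⟨e, he, hee⟩ := LipschitzOnWith.extend_real
    (LipschitzOnWith.of_dist_le_mul (K := ⟨K, hK⟩) (f := h) (s := X) fun x hx x' hx' =>
      hl x hx x' hx')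
  have hlip := (he.max_const (-C)).min_const C
  refine ⟨fun x => min (max (e x) (-C)) C, ⟨⟨C, hC, fun x _ => abs_le.2
    ⟨le_min (le_max_right _ _) (by linarith), min_le_right _ _⟩⟩, K, hK,
    fun x _ x' _ => hlip.dist_le_mul x x'⟩, fun x hx => ?_⟩
  have := abs_le.1 (hb x hx)
  simp only [← hee hx, max_eq_left this.1, min_eq_left this.2]

end BoundedLipschitz

/-! ### Existence of closed-loop trajectories -/

section Existence

variable {n : ℕ} {X : Set (State (n + 1))}

/-- A vector field of canonical form that is bounded and Lipschitz on `X` has curves that solve the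
equation as long as they stay in `X`. -/
lemma exists_solution_while_mem {p q : State (n + 1) → ℝ} {θ : ℝ → ℝ} {D : ℝ}
    (hcoord : ∀ i, BoundedLipschitzOn X fun x : State (n + 1) => x i)
    (hp : BoundedLipschitzOn X p) (hq : BoundedLipschitzOn X q) (hθ : Continuous θ)
    (hθD : ∀ t, 0 ≤ t → |θ t| ≤ D) (x₀ : State (n + 1)) :
    ∃ x : ℝ → State (n + 1), x 0 = x₀ ∧ (∀ i, ContinuousOn (fun t => x t i) (Set.Ici 0)) ∧
      ∀ t, 0 ≤ t → x t ∈ X →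
        (∀ i : Fin n, HasDerivWithinAt (fun s => x s i.castSucc) (x t i.succ) (Set.Ici 0) t) ∧
        HasDerivWithinAt (fun s => x s (Fin.last n)) (p (x t) + q (x t) * θ t) (Set.Ici 0) t := by
  choose c hc hcX using fun i => (hcoord i).exists_extension
  obtain ⟨p', hp', hpX⟩ := hp.exists_extension
  obtain ⟨q', hq', hqX⟩ := hq.exists_extension
  -- Even the coordinates are replaced by bounded extensions, so that the whole field is bounded.
  -- Since `θ` is bounded only for nonnegative times, it is evaluated at `max t 0`.
  let v : ℝ → Fin (n + 1) → State (n + 1) → ℝ := fun t =>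
    Fin.snoc (fun i : Fin n => c i.succ) (fun x => p' x + q' x * θ (max t 0))
  have hvl : ∀ t, v t (Fin.last n) = fun x => p' x + q' x * θ (max t 0) := fun t => by
    simp [v, Fin.snoc_last]
  have hvc : ∀ t (i : Fin n), v t i.castSucc = c i.succ := fun t i => by
    simp [v, Fin.snoc_castSucc]
  have hθ' : ∀ t, |θ (max t 0)| ≤ D := fun t => hθD _ (le_max_right _ _)
  have hD0 : 0 ≤ D := (abs_nonneg _).trans (hθ' 0)
  obtain ⟨⟨Cp, hCp, hpb⟩, Kp, hKp, hpl⟩ := hp'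
  obtain ⟨⟨Cq, hCq, hqb⟩, Kq, hKq, hql⟩ := hq'
  choose hcb hcl using hc
  choose Cc hCc hcb using hcb
  choose Kc hKc hcl using hcl
  set Cs := ∑ i, Cc i with hCs
  set Ks := ∑ i, Kc i with hKs
  have hCs0 : 0 ≤ Cs := Finset.sum_nonneg fun i _ => hCc i
  have hKs0 : 0 ≤ Ks := Finset.sum_nonneg fun i _ => hKc i
  have hCi : ∀ i, Cc i ≤ Cs := fun i =>
    Finset.single_le_sum (fun j _ => hCc j) (Finset.mem_univ i)
  have hKi : ∀ i, Kc i ≤ Ks := fun i =>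
    Finset.single_le_sum (fun j _ => hKc j) (Finset.mem_univ i)
  have hvb : ∀ t i x, |v t i x| ≤ Cs + (Cp + Cq * D) := by
    intro t i x
    induction i using Fin.lastCases with
    | cast i =>
      rw [hvc]
      have := (hcb i.succ x trivial).trans (hCi _)
      have : 0 ≤ Cp + Cq * D := by positivity
      linarith
    | last =>
      rw [hvl]
      have h1 := abs_add_le (p' x) (q' x * θ (max t 0))
      rw [abs_mul] at h1
      have h2 := hpb x trivial
      have h3 := mul_le_mul (hqb x trivial) (hθ' t) (abs_nonneg _) hCq
      show |p' x + q' x * θ (max t 0)| ≤ _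
      linarith
  have hvlip : ∀ t i x x', |v t i x - v t i x'| ≤ (Ks + (Kp + Kq * D)) * dist x x' := by
    intro t i x x'
    have hd : 0 ≤ dist x x' := dist_nonneg
    induction i using Fin.lastCases with
    | cast i =>
      rw [hvc]
      refine (hcl i.succ x trivial x' trivial).trans (mul_le_mul_of_nonneg_right ?_ hd)
      have := hKi i.succ
      have : 0 ≤ Kp + Kq * D := by positivity
      linarith
    | last =>
      rw [hvl]
      show |p' x + q' x * θ (max t 0) - (p' x' + q' x' * θ (max t 0))| ≤ _
      have e : p' x + q' x * θ (max t 0) - (p' x' + q' x' * θ (max t 0)) =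
        (p' x - p' x') + (q' x - q' x') * θ (max t 0) := by ring
      rw [e]
      have h1 := abs_add_le (p' x - p' x') ((q' x - q' x') * θ (max t 0))
      rw [abs_mul] at h1
      have h2 := hpl x trivial x' trivial
      have h3 := mul_le_mul (hql x trivial x' trivial) (hθ' t) (abs_nonneg _) (by positivity)
      have h4 : 0 ≤ Ks * dist x x' := by positivity
      linarith
  let F : ℝ → State (n + 1) → State (n + 1) := fun t x => WithLp.toLp 2 fun i => v t i x
  have hF0 : (0 : ℝ) ≤ (n + 1) * (Ks + (Kp + Kq * D)) := by positivity
  have hL0 : (0 : ℝ) ≤ (n + 1) * (Cs + (Cp + Cq * D)) := by positivity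
  obtain ⟨x, hx0, hx⟩ := exists_global_solution (F := F) (K := NNReal.mk _ hF0)
    (L := NNReal.mk _ hL0)
    (fun t => LipschitzWith.of_dist_le_mul fun x x' => by
      rw [dist_eq_norm, NNReal.coe_mk, mul_assoc]
      exact norm_le_of_abs_le (by positivity) fun i => hvlip t i x x')
    (fun x => by
      refine (PiLp.continuous_toLp 2 _).comp (continuous_pi fun i => ?_)
      induction i using Fin.lastCases with
      | cast i => simp only [hvc]; exact continuous_const
      | last => simp only [hvl]; fun_prop)
    (fun t x => norm_le_of_abs_le (by positivity) fun i => hvb t i x) x₀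
  have hcd : ∀ t, 0 ≤ t → ∀ i, HasDerivWithinAt (fun s => x s i) (v t i (x t)) (Set.Ici 0) t :=
    fun t ht i => (EuclideanSpace.proj (𝕜 := ℝ) i :
      State (n + 1) →L[ℝ] ℝ).hasFDerivAt.comp_hasDerivWithinAt t (hx t ht)
  refine ⟨x, hx0, fun i t ht => (hcd t ht i).continuousWithinAt, fun t ht hmem =>
    ⟨fun i => ?_, ?_⟩⟩
  · have := hcd t ht i.castSucc
    rwa [hvc, hcX _ hmem] at this
  · have := hcd t ht (Fin.last n)
    rw [hvl] at this
    simpa only [hpX hmem, hqX hmem, max_eq_left ht] using this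

variable {f g mf mg Φ α : State (n + 1) → ℝ} {lam : Fin n → ℝ} {kc : ℝ}
  {xd : ℝ → ℝ} {x : ℝ → State (n + 1)} {s A B : ℝ}

lemma boundedLipschitzOn_coord (hX : IsCompact X) (i : Fin (n + 1)) :
    BoundedLipschitzOn X fun x : State (n + 1) => x i := by
  refine BoundedLipschitzOn.of_lipschitzOnWith hX (K := 1) ?_
  refine (LipschitzWith.of_dist_le_mul fun x x' => ?_).lipschitzOnWith
  rw [Real.dist_eq, dist_eq_norm, NNReal.coe_one, one_mul]
  exact PiLp.norm_apply_le (x - x') i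

lemma abs_filtered_le_mul_norm (lam : Fin n → ℝ) (e : State (n + 1)) :
    |filtered lam e| ≤ (∑ i, |lamExt lam i|) * ‖e‖ := by
  rw [filtered, dotProduct, Finset.sum_mul]
  refine (Finset.abs_sum_le_sum_abs _ _).trans (Finset.sum_le_sum fun i _ => ?_)
  rw [abs_mul]
  exact mul_le_mul_of_nonneg_left (PiLp.norm_apply_le e i) (abs_nonneg _)

/-- The input to the linearized system splits into a state-dependent and a time-dependent part. -/
lemma nu_eq_add (lam : Fin n → ℝ) (kc : ℝ) (xd : ℝ → ℝ) (t : ℝ) (z : State (n + 1)) :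
    nu lam kc xd t z = (-kc * (∑ i : Fin n, lam i * z i.castSucc + z (Fin.last n)) +
      ∑ i : Fin n, (-lam i) * z i.succ) + nu lam kc xd t 0 := by
  simp only [nu, filtered_eq, PiLp.sub_apply, mul_sub, Finset.sum_sub_distrib, PiLp.zero_apply,
    mul_zero, Finset.sum_const_zero, neg_mul, Finset.sum_neg_distrib]
  ring

lemma continuous_nu_zero (hxd : ContDiff ℝ (n + 1 : ℕ) xd) (lam : Fin n → ℝ) (kc : ℝ) :
    Continuous fun t => nu lam kc xd t 0 := by
  have h : ∀ i ≤ n + 1, Continuous (iteratedDeriv i xd) := fun i hi =>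
    hxd.continuous_iteratedDeriv i (by exact_mod_cast hi)
  have hc : ∀ i : Fin (n + 1), Continuous fun t => (0 - refState (n := n) xd t).ofLp i := fun i =>
    continuous_const.sub (h i (by omega))
  simp only [nu, filtered_eq]
  exact ((continuous_const.mul ((continuous_finsetSum _ fun (i : Fin n) _ =>
    continuous_const.mul (hc i.castSucc)).add (hc _))).sub
      (continuous_finsetSum _ fun (i : Fin n) _ => continuous_const.mul (hc i.succ))).add
        (h _ le_rfl)

lemma abs_nu_zero_le {D : ℝ} (hD : ∀ i ≤ n + 1, ∀ t, 0 ≤ t → |iteratedDeriv i xd t| ≤ D)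
    (lam : Fin n → ℝ) (kc : ℝ) {t : ℝ} (ht : 0 ≤ t) :
    |nu lam kc xd t 0| ≤
      |kc| * ((∑ i, |lamExt lam i|) * ((n + 1) * D)) + (∑ i, |lam i|) * D + D := by
  have hD0 : 0 ≤ D := (abs_nonneg _).trans (hD 0 (by omega) 0 le_rfl)
  have hr : ∀ i : Fin (n + 1), |(0 - refState (n := n) xd t).ofLp i| ≤ D := fun i => by
    rw [zero_sub, PiLp.neg_apply, abs_neg]
    exact hD i (by omega) t ht
  have h1 : |(-kc) * filtered lam (0 - refState xd t)| ≤
      |kc| * ((∑ i, |lamExt lam i|) * ((n + 1) * D)) := by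
    rw [abs_mul, abs_neg]
    refine mul_le_mul_of_nonneg_left ((abs_filtered_le_mul_norm _ _).trans ?_) (abs_nonneg _)
    exact mul_le_mul_of_nonneg_left (norm_le_of_abs_le hD0 hr)
      (Finset.sum_nonneg fun i _ => abs_nonneg _)
  have h2 : |∑ i : Fin n, lam i * (0 - refState xd t).ofLp i.succ| ≤ (∑ i, |lam i|) * D := by
    rw [Finset.sum_mul]
    refine (Finset.abs_sum_le_sum_abs _ _).trans (Finset.sum_le_sum fun i _ => ?_)
    rw [abs_mul]
    exact mul_le_mul_of_nonneg_left (hr _) (abs_nonneg _)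
  rw [nu]
  exact (abs_add_le _ _).trans (add_le_add ((abs_sub _ _).trans (add_le_add h1 h2))
    (hD _ le_rfl t ht))

/-- With Lipschitz models the closed loop has curves that solve it as long as they stay in `X`. -/
lemma exists_closedLoop_while_mem (hX : IsCompact X) (hxd : ContDiff ℝ (n + 1 : ℕ) xd) {D : ℝ}
    (hD : ∀ i ≤ n + 1, ∀ t, 0 ≤ t → |iteratedDeriv i xd t| ≤ D) {Kf Kg Kmf Kmg : ℝ≥0}
    (hf : LipschitzOnWith Kf f X) (hg : LipschitzOnWith Kg g X) (hmf : LipschitzOnWith Kmf mf X)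
    (hmg : LipschitzOnWith Kmg mg X) (hmg0 : ∀ x ∈ X, mg x ≠ 0) (lam : Fin n → ℝ) (kc : ℝ)
    (x₀ : State (n + 1)) :
    ∃ x : ℝ → State (n + 1), x 0 = x₀ ∧ (∀ i, ContinuousOn (fun t => x t i) (Set.Ici 0)) ∧
      ∀ t, 0 ≤ t → x t ∈ X →
        (∀ i : Fin n, HasDerivWithinAt (fun s => x s i.castSucc) (x t i.succ) (Set.Ici 0) t) ∧
        HasDerivWithinAt (fun s => x s (Fin.last n))
          (f (x t) + g (x t) * feedback mf mg lam kc xd t (x t)) (Set.Ici 0) t := by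
  have hc := boundedLipschitzOn_coord hX
  have hf' := BoundedLipschitzOn.of_lipschitzOnWith hX hf
  have hg' := BoundedLipschitzOn.of_lipschitzOnWith hX hg
  have hmf' := BoundedLipschitzOn.of_lipschitzOnWith hX hmf
  -- `ν` is affine in the state and time enters it additively, so the last component is `p(x) + q(x)
  -- θ(t)` with `q = g / mg` and `θ(t) = ν(t, 0)`.
  have hq := hg'.mul (BoundedLipschitzOn.inv hX hmg hmg0)
  have hl : BoundedLipschitzOn X fun z : State (n + 1) =>
      -kc * (∑ i : Fin n, lam i * z i.castSucc + z (Fin.last n)) +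
        ∑ i : Fin n, (-lam i) * z i.succ :=
    ((BoundedLipschitzOn.const (-kc)).mul ((BoundedLipschitzOn.sum _ fun i =>
      (BoundedLipschitzOn.const (lam i)).mul (hc i.castSucc)).add (hc _))).add
        (BoundedLipschitzOn.sum _ fun i => (BoundedLipschitzOn.const (-lam i)).mul (hc i.succ))
  have hp := hf'.add (hq.mul (hl.add ((BoundedLipschitzOn.const (-1)).mul hmf')))
  obtain ⟨x, hx0, hcont, hx⟩ := exists_solution_while_mem hc hp hq (continuous_nu_zero hxd lam kc)
    (fun t ht => abs_nu_zero_le hD lam kc ht) x₀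
  refine ⟨x, hx0, hcont, fun t ht hmem => ⟨(hx t ht hmem).1, (hx t ht hmem).2.congr_deriv ?_⟩⟩
  rw [feedback, nu_eq_add lam kc xd t (x t)]
  ring

/-- Small initial errors stay small in the closed loop. -/
lemma LoopBounds.exists_norm_err_lt (hL : LoopBounds X mf mg Φ α lam xd s A B)
    (hlam : IsHurwitz lam) (hxd : ContDiff ℝ (n + 1 : ℕ) xd) {ρ : ℝ} (hρ : 0 < ρ) :
    ∃ K : ℝ, 0 < K ∧ ∃ ε : ℝ, 0 < ε ∧ ε ≤ ρ ∧ ∀ f g : State (n + 1) → ℝ,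
      PlantBounds X f g mf mg Φ α s → ∀ kc, K ≤ kc → ∀ x T, 0 ≤ T →
        IsSolOn X f g (feedback mf mg lam kc xd) x 0 T → ‖x 0 - refState xd 0‖ < ε →
          ‖x T - refState xd T‖ < ρ := by
  obtain ⟨κ, hκ, C, hC, hfil⟩ := hlam.exists_bound
  set Q := scaledBound A B with hQ
  have hQ0 : 0 < Q := hL.scaledBound_pos
  set Λ := ∑ i, |lamExt lam i| with hΛ
  have hΛ0 : 0 ≤ Λ := Finset.sum_nonneg fun i _ => abs_nonneg _
  set D := (n + 1) * C + 1 with hD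
  have hD0 : 0 < D := by positivity
  -- On the whole interval `|r| ≤ Λ ε + Q / kc`, so the components of the error are at most `C ((1 +
  -- Λ) ε + Q / kc)`. Both summands are made at most `ρ / (4 D)`, where `D` exceeds `(n + 1) C`; the
  -- norm is then at most `ρ / 2`.
  refine ⟨4 * D * Q / ρ, by positivity, min ρ (ρ / (4 * D * (1 + Λ))), by positivity,
    min_le_left _ _, fun f g hP kc hk x T hT hx he => ?_⟩
  have hkc : 0 < kc := lt_of_lt_of_le (by positivity) hk
  set ε := min ρ (ρ / (4 * D * (1 + Λ))) with hε
  have hε0 : 0 < ε := by positivity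
  have hr : ∀ t ∈ Set.Icc 0 T, |filtered lam (x t - refState xd t)| ≤ Λ * ε + Q / kc := by
    intro t ht
    have h0 : |filtered lam (x 0 - refState xd 0)| ≤ Λ * ε :=
      (abs_filtered_le_mul_norm _ _).trans (mul_le_mul_of_nonneg_left he.le hΛ0)
    have hsol : IsSolOn X f g (feedback mf mg lam kc xd) x 0 t :=
      { mem := fun u hu => hx.mem u ⟨hu.1, hu.2.trans ht.2⟩
        cont := fun i => (hx.cont i).mono (Set.Icc_subset_Icc_right ht.2)
        chain := fun u hu => hx.chain u ⟨hu.1, hu.2.trans_le ht.2⟩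
        last := fun u hu => hx.last u ⟨hu.1, hu.2.trans_le ht.2⟩ }
    have h1 : 0 ≤ Q / kc := by positivity
    have h2 : 0 ≤ Λ * ε := by positivity
    have h3 := ht.1
    exact (hL.abs_filtered_le hP hxd hkc le_rfl ht.1 hsol).trans
      (max_le (by linarith) (by linarith))
  have hcomp := hfil 0 T (fun t => (x t - refState xd t).ofLp) ε (Λ * ε + Q / kc) hε0.le
    (by positivity) (fun i => hx.continuousOn_err hxd i.castSucc)
    (fun i t ht => hx.hasDerivWithinAt_err hxd ht i)
    (fun i => (PiLp.norm_apply_le (x 0 - refState xd 0) i).trans he.le)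
    (fun t ht => by
      have h1 : |filtered lam (x t - refState xd t)| ≤ Λ * ε + Q / kc := hr t ht
      exact h1.trans (le_add_of_nonneg_left (mul_nonneg hε0.le (Real.exp_pos _).le)))
    T ⟨hT, le_rfl⟩
  have hexp : ε * Real.exp (-(κ * (T - 0))) ≤ ε * 1 := by
    refine mul_le_mul_of_nonneg_left (Real.exp_le_one_iff.2 ?_) hε0.le
    have : 0 ≤ κ * (T - 0) := mul_nonneg hκ.le (by linarith)
    linarith
  have hcomp' : ∀ i, |(x T - refState xd T).ofLp i| ≤ C * ((1 + Λ) * ε + Q / kc) := fun i =>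
    (hcomp i).trans (mul_le_mul_of_nonneg_left (by linarith) hC)
  have h1 := norm_le_of_abs_le (by positivity) hcomp'
  have h2 : (1 + Λ) * ε ≤ ρ / (4 * D) := by
    calc (1 + Λ) * ε ≤ (1 + Λ) * (ρ / (4 * D * (1 + Λ))) :=
          mul_le_mul_of_nonneg_left (min_le_right _ _) (by positivity)
      _ = ρ / (4 * D) := by field_simp
  have h3 : Q / kc ≤ ρ / (4 * D) := by
    rw [div_le_iff₀ hρ] at hk
    rw [div_le_div_iff₀ hkc (by positivity)]
    linarith
  calc ‖x T - refState xd T‖ ≤ (n + 1) * (C * ((1 + Λ) * ε + Q / kc)) := h1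
    _ = ((n + 1) * C) * ((1 + Λ) * ε + Q / kc) := by ring
    _ ≤ D * (ρ / (4 * D) + ρ / (4 * D)) :=
        mul_le_mul (by linarith) (add_le_add h2 h3) (by positivity) hD0.le
    _ = ρ / 2 := by field_simp; ring
    _ < ρ := by linarith

/-- Small initial errors admit global trajectories. -/
lemma LoopBounds.exists_trajectory (hL : LoopBounds X mf mg Φ α lam xd s A B)
    (hlam : IsHurwitz lam) (hX : IsCompact X) (hxd : ContDiff ℝ (n + 1 : ℕ) xd) {D : ℝ}
    (hD : ∀ i ≤ n + 1, ∀ t, 0 ≤ t → |iteratedDeriv i xd t| ≤ D) {Kmf Kmg : ℝ≥0}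
    (hmf : LipschitzOnWith Kmf mf X) (hmg : LipschitzOnWith Kmg mg X) {ρ : ℝ} (hρ : 0 < ρ)
    (hball : ∀ t, 0 ≤ t → Metric.closedBall (refState xd t) ρ ⊆ X) :
    ∃ K : ℝ, 0 < K ∧ ∃ ε : ℝ, 0 < ε ∧ ∀ (f g : State (n + 1) → ℝ) (Kf Kg : ℝ≥0),
      PlantBounds X f g mf mg Φ α s → LipschitzOnWith Kf f X → LipschitzOnWith Kg g X →
        ∀ kc, K ≤ kc → ∀ x₀, dist x₀ (refState xd 0) < ε →
          ∃ x, IsTrajectory X f g (feedback mf mg lam kc xd) x ∧ x 0 = x₀ := by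
  obtain ⟨K, hK, ε, hε, hερ, hstay⟩ := hL.exists_norm_err_lt hlam hxd hρ
  refine ⟨K, hK, ε, hε, fun f g Kf Kg hP hf hg kc hk x₀ hx₀ => ?_⟩
  obtain ⟨x, hx0, hcont, hx⟩ :=
    exists_closedLoop_while_mem hX hxd hD hf hg hmf hmg hL.mg_ne lam kc x₀
  have he0 : ‖x 0 - refState xd 0‖ < ε := by rwa [hx0, ← dist_eq_norm]
  have hin : ∀ t, 0 ≤ t → ‖x t - refState xd t‖ ≤ ρ → x t ∈ X := fun t ht h =>
    hball t ht (by rwa [Metric.mem_closedBall, dist_eq_norm])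
  have hecont : ContinuousOn (fun t => ‖x t - refState xd t‖) (Set.Ici 0) := by
    have : ContinuousOn (fun t => x t - refState xd t) (Set.Ici 0) :=
      (PiLp.continuous_toLp 2 fun _ : Fin (n + 1) => ℝ).comp_continuousOn
        (continuousOn_pi.2 fun i => (hcont i).sub fun t _ =>
          (hasDerivAt_refState hxd t i).continuousAt.continuousWithinAt)
    exact this.norm
  -- At the first time `T` with error `ρ` the curve has stayed in the closed tube, hence in `X`, so
  -- it solves the true closed loop on `[0, T]`. The a priori estimate then gives an error below `ρ`
  -- at `T`.
  have hlt : ∀ t, 0 ≤ t → ‖x t - refState xd t‖ < ρ := by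
    by_contra! hcon
    obtain ⟨t₁, ht₁, hbad⟩ := hcon
    have hcc := hecont.mono (Set.Icc_subset_Ici_self : Set.Icc 0 t₁ ⊆ Set.Ici 0)
    have hhit : ∀ t, 0 ≤ t → ρ ≤ ‖x t - refState xd t‖ →
        ∃ u ∈ Set.Icc 0 t, ‖x u - refState xd u‖ = ρ := fun t ht hle =>
      intermediate_value_Icc ht (hecont.mono Set.Icc_subset_Ici_self) ⟨(he0.trans_le hερ).le, hle⟩
    have hcomp : IsCompact (Set.Icc 0 t₁ ∩ (fun t => ‖x t - refState xd t‖) ⁻¹' {ρ}) :=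
      isCompact_Icc.of_isClosed_subset (hcc.preimage_isClosed_of_isClosed isClosed_Icc
        isClosed_singleton) Set.inter_subset_left
    obtain ⟨u, hu, hue⟩ := hhit t₁ ht₁ hbad
    obtain ⟨T, ⟨hT, hTe⟩, hTmin⟩ := hcomp.exists_isLeast ⟨u, hu, hue⟩
    have hTρ : ‖x T - refState xd T‖ = ρ := hTe
    have hle : ∀ t ∈ Set.Icc 0 T, ‖x t - refState xd t‖ ≤ ρ := by
      intro t ht
      by_contra! h
      obtain ⟨v, hv, hve⟩ := hhit t ht.1 h.le
      have h1 : T ≤ v := hTmin ⟨⟨hv.1, hv.2.trans (ht.2.trans hT.2)⟩, hve⟩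
      have h2 : t = T := le_antisymm ht.2 (h1.trans hv.2)
      rw [h2, hTρ] at h
      exact lt_irrefl _ h
    have hsol : IsSolOn X f g (feedback mf mg lam kc xd) x 0 T :=
      { mem := fun t ht => hin t ht.1 (hle t ht)
        cont := fun i => (hcont i).mono Set.Icc_subset_Ici_self
        chain := fun t ht i => ((hx t ht.1 (hin t ht.1 (hle t ⟨ht.1, ht.2.le⟩))).1 i).mono
          (Set.Ici_subset_Ici.2 ht.1)
        last := fun t ht => (hx t ht.1 (hin t ht.1 (hle t ⟨ht.1, ht.2.le⟩))).2.mono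
          (Set.Ici_subset_Ici.2 ht.1) }
    exact (hstay f g hP kc hk x T hT.1 hsol he0).ne hTρ
  exact ⟨x, { mem := fun t ht => hin t ht (hlt t ht).le
              chain := fun t ht => (hx t ht (hin t ht (hlt t ht).le)).1
              last := fun t ht => (hx t ht (hin t ht (hlt t ht).le)).2 }, hx0⟩

end Existence

/-! ### From the posterior to the loop bounds -/

section Posterior

variable {n N : ℕ} {X : Set (State (n + 1))} {M : Model (n + 1) N} {δ τ : ℝ} {y : Fin N → ℝ}
  {L : LipConsts} {lam : Fin n → ℝ} {kc : ℝ} {xd : ℝ → ℝ}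

/-- The uniform bound on the error of the posterior mean of `f`. -/
noncomputable def errf (M : Model (n + 1) N) (X : Set (State (n + 1))) (δ τ : ℝ) (L : LipConsts)
    (x : State (n + 1)) : ℝ :=
  √(beta X δ τ) * M.sigf x + gammaf X δ τ L

lemma gammaf_nonneg (X : Set (State (n + 1))) (δ : ℝ) (hτ : 0 < τ) (L : LipConsts) :
    0 ≤ gammaf X δ τ L := by
  unfold gammaf; positivity

lemma gammag_nonneg (X : Set (State (n + 1))) (δ : ℝ) (hτ : 0 < τ) (L : LipConsts) :
    0 ≤ gammag X δ τ L := by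
  unfold gammag; positivity

lemma alpha_nonneg (hτ : 0 < τ) (x : State (n + 1)) : 0 ≤ alpha M X δ τ y L x := by
  have := gammag_nonneg X δ hτ L
  unfold alpha Model.sigg
  positivity

lemma LipConsts.ValidPosterior.continuousOn_errf (hV : L.ValidPosterior M X y) :
    ContinuousOn (errf M X δ τ L) X :=
  (continuousOn_const.mul hV.varf.continuousOn.sqrt).add continuousOn_const

lemma LipConsts.ValidPosterior.continuousOn_alpha (hV : L.ValidPosterior M X y)
    (hmug : ∀ x ∈ X, M.mug y x ≠ 0) : ContinuousOn (alpha M X δ τ y L) X :=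
  ((continuousOn_const.mul hV.varg.continuousOn.sqrt).add continuousOn_const).div
    hV.mug.continuousOn.abs fun x hx => abs_ne_zero.2 (hmug x hx)

/-- The posterior provides uniform bounds for the closed loop, with a margin left by a confidence
parameter `κ * √β` smaller than `√β`. -/
lemma LipConsts.ValidPosterior.exists_loopBounds (hV : L.ValidPosterior M X y) (hn : 1 ≤ n)
    (hX : IsCompact X) (hδ : 0 < δ) (hδ1 : δ < 1) (hτ : 0 < τ)
    (hvarf : ∀ x ∈ X, 0 < M.varf x) (hmug : ∀ x ∈ X, M.mug y x ≠ 0) (hlam : IsHurwitz lam)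
    {k₀ : ℝ} (hk₀ : 0 < k₀) (hα : ∀ x ∈ X, alpha M X δ τ y L x < eta lam k₀) {D : ℝ}
    (hD : ∀ i ≤ n + 1, ∀ t, 0 ≤ t → |iteratedDeriv i xd t| ≤ D) {κ : ℝ} (hκ0 : 0 ≤ κ)
    (hκ : κ < 1) :
    ∃ s A B : ℝ, LoopBounds X (M.muf y) (M.mug y) (errf M X δ τ L) (alpha M X δ τ y L) lam xd
      s A B ∧ ∀ x ∈ X, κ * √(beta X δ τ) * M.sigf x + gammaf X δ τ L ≤ errf M X δ τ L x - s := by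
  have hβ := Real.sqrt_pos.2 (beta_pos X hδ hδ1 hτ)
  -- The margin is a positive lower bound of `(1 - κ) √β σ_f`, a continuous positive function on a
  -- compact set.
  obtain ⟨s, hs, hsX⟩ := hX.exists_forall_le' (a := 0)
    (f := fun x => (1 - κ) * √(beta X δ τ) * M.sigf x)
    (continuousOn_const.mul hV.varf.continuousOn.sqrt) fun x hx =>
      mul_pos (mul_pos (by linarith) hβ) (Real.sqrt_pos.2 (hvarf x hx))
  have hγ := gammaf_nonneg X δ hτ L
  have hmargin : ∀ x ∈ X,
      κ * √(beta X δ τ) * M.sigf x + gammaf X δ τ L ≤ errf M X δ τ L x - s := fun x hx => by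
    have := hsX x hx
    rw [errf]
    linarith
  obtain ⟨R, hR0, hR⟩ := hX.isBounded.exists_pos_norm_le
  obtain ⟨C₁, hC₁⟩ := hX.exists_bound_of_continuousOn (hV.continuousOn_errf (δ := δ) (τ := τ))
  obtain ⟨C₂, hC₂⟩ := hX.exists_bound_of_continuousOn hV.muf.continuousOn
  have hD0 : 0 ≤ D := (abs_nonneg _).trans (hD 0 (by omega) 0 le_rfl)
  set Λ := ∑ i, |lam i| with hΛ
  have hΛ0 : 0 ≤ Λ := Finset.sum_nonneg fun i _ => abs_nonneg _
  have hstate : ∀ x ∈ X, ∀ i, |x i| ≤ R := fun x hx i => (PiLp.norm_apply_le x i).trans (hR x hx)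
  have herr : ∀ t, 0 ≤ t → ∀ x ∈ X, ∀ i, |(x - refState xd t).ofLp i| ≤ R + D :=
    fun t ht x hx i => (abs_sub _ _).trans (add_le_add (hstate x hx i) (hD i (by omega) t ht))
  have hΛRD : 0 ≤ Λ * (R + D) := by positivity
  have hC₁' := abs_nonneg C₁
  have hC₂' := abs_nonneg C₂
  -- `A = η(k₀)` bounds `α` independently of the gain used later.
  refine ⟨s, eta lam k₀, |C₁| + (R + D) + Λ * (R + D) + D + |C₂|,
    { s_pos := hs
      A_lt_one := hlam.eta_lt_one hn hk₀
      B_nonneg := by positivity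
      alpha_nonneg := fun x _ => alpha_nonneg hτ x
      alpha_le := fun x hx => (hα x hx).le
      mg_ne := hmug
      Phi_ge := fun x hx => ?_
      state_le := fun x hx i => (hstate x hx i).trans (by linarith)
      err_le := fun t ht x hx i => (herr t ht x hx i).trans (by linarith)
      deriv_le := fun t ht => (hD _ le_rfl t ht).trans (by linarith)
      total_le := fun t ht x hx => ?_ }, hmargin⟩
  · have h2 : 0 ≤ √(beta X δ τ) * M.sigf x := mul_nonneg hβ.le (Real.sqrt_nonneg _)
    have h3 := hmargin x hx
    have h4 : 0 ≤ κ * √(beta X δ τ) * M.sigf x := by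
      rw [mul_assoc]; exact mul_nonneg hκ0 h2
    linarith
  · have h1 : |lead lam xd t x| ≤ Λ * (R + D) := by
      rw [lead, Finset.sum_mul]
      refine (Finset.abs_sum_le_sum_abs _ _).trans (Finset.sum_le_sum fun i _ => ?_)
      rw [abs_mul]
      exact mul_le_mul_of_nonneg_left (herr t ht x hx _) (abs_nonneg _)
    have h2 := (le_abs_self _).trans ((hC₁ x hx).trans (le_abs_self _))
    have h3 := (abs_sub (iteratedDeriv (n + 1) xd t) (M.muf y x)).trans
      (add_le_add (hD _ le_rfl t ht) ((hC₂ x hx).trans (le_abs_self _)))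
    linarith

/-- As `η < 1`, `α / η ≥ α`, and so the effective gain is at most `kc (1 - α)`. The claimed bound is
therefore the weaker one. -/
lemma scaledErrBound_le_mul_errBound (hτ : 0 < τ) (hkc : 0 < kc) {x : State (n + 1)}
    (hα : alpha M X δ τ y L x < eta lam kc) (hη : eta lam kc < 1) (t : ℝ) :
    scaledErrBound (M.muf y) (errf M X δ τ L) (alpha M X δ τ y L) xd t x ≤
      kc * errBound M X δ τ y L lam kc xd t x := by
  have h0 := alpha_nonneg (M := M) (X := X) (δ := δ) (y := y) (L := L) hτ x
  have hη0 := h0.trans_lt hα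
  have h1 : alpha M X δ τ y L x ≤ alpha M X δ τ y L x / eta lam kc := by
    rw [le_div_iff₀ hη0]
    exact mul_le_of_le_one_right h0 hη.le
  have h2 : 0 < 1 - alpha M X δ τ y L x / eta lam kc := by
    rw [sub_pos, div_lt_one hη0]
    exact hα
  have h3 : 0 ≤ errf M X δ τ L x + alpha M X δ τ y L x * feedforward M y xd t x :=
    add_nonneg (add_nonneg (mul_nonneg (Real.sqrt_nonneg _) (Real.sqrt_nonneg _))
      (gammaf_nonneg X δ hτ L)) (mul_nonneg h0 (abs_nonneg _))
  calc _ ≤ (errf M X δ τ L x + alpha M X δ τ y L x * feedforward M y xd t x) /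
        (1 - alpha M X δ τ y L x / eta lam kc) :=
        div_le_div_of_nonneg_left h3 h2 (by linarith)
    _ = kc * errBound M X δ τ y L lam kc xd t x := by
        rw [errBound, effGain, errf]
        field_simp

end Posterior

end GPTracking

/-! ### The theorem -/

theorem theorem2 {n N : ℕ} (hn : 1 ≤ n)
    (X : Set (State (n + 1))) (hX : IsCompact X)
    (M : Model (n + 1) N) (hsf : 0 < M.sf) (hsg : 0 ≤ M.sg) (hlf : 0 < M.lf) (hlg : 0 < M.lg)
    (hson : 0 < M.son)
    {Ω : Type*} [MeasurableSpace Ω] (P : Measure Ω) [IsProbabilityMeasure P]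
    (f g : Ω → State (n + 1) → ℝ) (noise : Ω → Fin N → ℝ)
    (hdata : GPData M X f g noise P)
    (δ τ : ℝ) (hδ : 0 < δ) (hδ1 : δ < 1) (hτ : 0 < τ)
    (lam : Fin n → ℝ) (hlam : IsHurwitz lam)
    (xd : ℝ → ℝ) (hxd : ContDiff ℝ (n + 1 : ℕ) xd)
    (hxd_bdd : ∀ i ≤ n + 1, ∃ C, ∀ t, 0 ≤ t → |iteratedDeriv i xd t| ≤ C) :
    -- an event whose conditional probability given the training data is at least `1 - 2δ`
    ∃ E : Set Ω, MeasurableSet E ∧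
      (∀ᵐ ω ∂P, 1 - 2 * δ ≤
        (P⟦E | MeasurableSpace.comap (M.targets f g noise) inferInstance⟧) ω) ∧
      ∀ (y : Fin N → ℝ) (L : LipConsts), L.ValidPosterior M X y →
        (∀ x ∈ X, M.mug y x ≠ 0) →
        (∃ k₀, 0 < k₀ ∧ ∀ x ∈ X, alpha M X δ τ y L x < eta lam k₀) →
        -- the gain and the admissible initial error depend on the data, not on `f` and `g`
        ∃ K, 0 < K ∧ ∃ ε, 0 < ε ∧
          ∀ ω ∈ E, M.targets f g noise ω = y →
            LipschitzOnWith L.f (f ω) X → LipschitzOnWith L.g (g ω) X →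
            ∀ kc, K ≤ kc →
              (∀ x ∈ X, alpha M X δ τ y L x < eta lam kc) ∧
              (∀ x, IsTrajectory X (f ω) (g ω) (control M y lam kc xd) x →
                (UniformContinuousOn (iteratedDeriv (n + 1) xd) (Set.Ici 0) →
                  ∀ᶠ t in atTop,
                    x t - refState xd t ∈ ultimateSet M X δ τ y L lam kc xd t) ∧
                (∀ b, (∀ᶠ t in atTop, errBound M X δ τ y L lam kc xd t (x t) ≤ b) →
                  ∀ᶠ t in atTop, errSize lam (x t - refState xd t) ≤ b)) ∧
              ((∃ ρ, 0 < ρ ∧ ∀ t, 0 ≤ t → Metric.closedBall (refState xd t) ρ ⊆ X) →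
                ∀ x₀, dist x₀ (refState xd 0) < ε →
                  ∃ x, IsTrajectory X (f ω) (g ω) (control M y lam kc xd) x ∧ x 0 = x₀) := by
  obtain ⟨κ, hκ0, hκ, E, hE, hPE, hgood⟩ :=
    hdata.exists_event hX.isBounded hson hδ hδ1 hτ
  refine ⟨E, hE, hPE, fun y L hV hmug ⟨k₀, hk₀, hα⟩ => ?_⟩
  obtain ⟨D, hD⟩ : ∃ D, ∀ i ≤ n + 1, ∀ t, 0 ≤ t → |iteratedDeriv i xd t| ≤ D := by
    choose! C hC using hxd_bdd
    refine ⟨∑ i ∈ Finset.range (n + 2), |C i|, fun i hi t ht => ?_⟩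
    exact ((hC i hi t ht).trans (le_abs_self _)).trans
      (Finset.single_le_sum (f := fun i => |C i|) (fun j _ => abs_nonneg _)
        (Finset.mem_range.2 (by omega)))
  obtain ⟨s, A, B, hL, hmargin⟩ := hV.exists_loopBounds hn hX hδ hδ1 hτ
    (fun x hx => hdata.varf_pos hsf hson hx) hmug hlam hk₀ hα hD hκ0.le hκ
  obtain ⟨K₁, hK₁, hbd⟩ := hL.exists_gain_of_le hlam hxd
  -- The gain has to be fixed before uniform continuity is assumed. That property concerns only
  -- `xd`, so a case distinction settles it; the tube condition is treated alike.
  have huc : ∃ K : ℝ, UniformContinuousOn (iteratedDeriv (n + 1) xd) (Set.Ici 0) →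
      ∀ f g : State (n + 1) → ℝ,
        PlantBounds X f g (M.muf y) (M.mug y) (errf M X δ τ L) (alpha M X δ τ y L) s →
        ∀ kc, K ≤ kc → ∀ x, IsTrajectory X f g (feedback (M.muf y) (M.mug y) lam kc xd) x →
          ∀ᶠ t in atTop, kc * |filtered lam (x t - refState xd t)| ≤
            scaledErrBound (M.muf y) (errf M X δ τ L) (alpha M X δ τ y L) xd t (x t) := by
    by_cases h : UniformContinuousOn (iteratedDeriv (n + 1) xd) (Set.Ici 0)
    · obtain ⟨K, -, hK⟩ := hL.exists_gain_of_uniformContinuous hlam hxd hX hV.muf.continuousOn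
        hV.continuousOn_errf (hV.continuousOn_alpha hmug) h
      exact ⟨K, fun _ => hK⟩
    · exact ⟨0, fun h' => absurd h' h⟩
  obtain ⟨K₂, huc⟩ := huc
  have hex : ∃ K : ℝ, ∃ ε : ℝ, 0 < ε ∧
      ((∃ ρ, 0 < ρ ∧ ∀ t, 0 ≤ t → Metric.closedBall (refState xd t) ρ ⊆ X) →
        ∀ (f g : State (n + 1) → ℝ) (Kf Kg : ℝ≥0),
          PlantBounds X f g (M.muf y) (M.mug y) (errf M X δ τ L) (alpha M X δ τ y L) s →
          LipschitzOnWith Kf f X → LipschitzOnWith Kg g X → ∀ kc, K ≤ kc →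
            ∀ x₀, dist x₀ (refState xd 0) < ε →
              ∃ x, IsTrajectory X f g (feedback (M.muf y) (M.mug y) lam kc xd) x ∧ x 0 = x₀) := by
    by_cases h : ∃ ρ, 0 < ρ ∧ ∀ t, 0 ≤ t → Metric.closedBall (refState xd t) ρ ⊆ X
    · obtain ⟨ρ, hρ, hball⟩ := h
      obtain ⟨K, -, ε, hε, hK⟩ := hL.exists_trajectory hlam hX hxd hD hV.muf hV.mug hρ hball
      exact ⟨K, ε, hε, fun _ => hK⟩
    · exact ⟨0, 1, one_pos, fun h' => absurd h' h⟩
  obtain ⟨K₃, ε, hε, hex⟩ := hex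
  refine ⟨max (max k₀ K₁) (max K₂ K₃), lt_max_of_lt_left (lt_max_of_lt_left hk₀), ε, hε,
    fun ω hω hy hf hg kc hkc => ?_⟩
  have hk0 : k₀ ≤ kc := ((le_max_left _ _).trans (le_max_left _ _)).trans hkc
  have hk1 : K₁ ≤ kc := ((le_max_right _ _).trans (le_max_left _ _)).trans hkc
  have hk2 : K₂ ≤ kc := ((le_max_left _ _).trans (le_max_right _ _)).trans hkc
  have hk3 : K₃ ≤ kc := ((le_max_right _ _).trans (le_max_right _ _)).trans hkc
  have hkpos : 0 < kc := hk₀.trans_le hk0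
  have hαk : ∀ x ∈ X, alpha M X δ τ y L x < eta lam kc := fun x hx =>
    (hα x hx).trans_le (hlam.eta_mono hk₀ hk0)
  have hgood := hgood ω hω L (hy.symm ▸ hV) hf hg
  rw [hy] at hgood
  have hP : PlantBounds X (f ω) (g ω) (M.muf y) (M.mug y) (errf M X δ τ L)
      (alpha M X δ τ y L) s :=
    { f_le := fun x hx => (hgood x hx).1.trans (hmargin x hx)
      g_le := fun x hx => by
        rw [alpha, div_mul_cancel₀ _ (abs_ne_zero.2 (hmug x hx))]
        exact (hgood x hx).2 }
  have hle : ∀ {x : ℝ → State (n + 1)},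
      IsTrajectory X (f ω) (g ω) (control M y lam kc xd) x → ∀ t, 0 ≤ t →
        scaledErrBound (M.muf y) (errf M X δ τ L) (alpha M X δ τ y L) xd t (x t) ≤
          kc * errBound M X δ τ y L lam kc xd t (x t) := fun hx t ht =>
    scaledErrBound_le_mul_errBound hτ hkpos (hαk _ (hx.mem t ht)) (hlam.eta_lt_one hn hkpos) t
  refine ⟨hαk, fun x hx => ⟨fun h => ?_, fun b hb => ?_⟩,
    fun h => hex h (f ω) (g ω) L.f L.g hP hf hg kc hk3⟩
  · filter_upwards [huc h (f ω) (g ω) hP kc hk2 x hx, eventually_ge_atTop 0] with t ht ht0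
    rw [ultimateSet, Set.mem_ofPred_eq, add_sub_cancel, errSize_eq_abs_filtered]
    exact le_of_mul_le_mul_left (ht.trans (hle hx t ht0)) hkpos
  · simp only [errSize_eq_abs_filtered]
    refine hbd (f ω) (g ω) hP kc hk1 x hx b ?_
    filter_upwards [hb, eventually_ge_atTop 0] with t ht ht0
    exact (hle hx t ht0).trans (mul_le_mul_of_nonneg_left ht hkpos.le)
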